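/- Let $0<\alpha<1$ and let $G(x)=\varphi(\alpha)|x|^{-\alpha}$, $\varphi(\alpha)=\frac{\Gamma(\alpha/2)}{\pi 2^{2-\alpha}\Gamma((2-\alpha)/2)}$, be the Green function of $(-\Delta)^{1-\alpha/2}$ on $\mathbb R^2$; put $\nabla^\perp=(\partial_2,-\partial_1)$ and $K=\nabla^\perp G$. The modified surface quasi-geostrophic (mSQG) equation is $\partial_t\theta+u\cdot\nabla\theta=0$, $u(x,t)=\int K(x-y)\,\theta(y,t)\,dy$. By a solution on $[0,T)$, $0<T\le\infty$, we mean a function $\theta(\cdot,t)\in L^1\cap L^\infty(\mathbb R^2)$, $t\in[0,T)$, satisfying the weak form $$\frac{d}{dt}\int\theta f\,dx=\int\theta\,(u\cdot\nabla f+\partial_t f)\,dx$$ for all smooth compactly supported $f(x,t)$, together with a motion of fluid particles $x_0\mapsto x(x_0,t)$ that solves $\frac{d}{dt}x(x_0,t)=u(x(x_0,t),t)$, $x(x_0,0)=x_0$, for every $x_0\in\mathbb R^2$, preserves area, and conserves $\theta$: $\theta(x(x_0,t),t)=\theta(x_0,0)$ for a.e. $x_0$. Let $a_1,\dots,a_N\in\mathbb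 R$, $M>0$, and let $z_1,\dots,z_N\in\mathbb R^2$ be such that the pseudo-vortex system $$\dot z_i(t)=\sum_{j\ne i}a_j\,K(z_i(t)-z_j(t)),\qquad z_i(0)=z_i,$$ has a solution for all $t\ge0$ without collapse, that is, with $\inf_{t\ge0}|z_i(t)-z_j(t)|>0$ for all $i\ne j$. For $\epsilon>0$ consider initial data $\theta_\epsilon(\cdot,0)=\sum_{i=1}^N\theta_{i,\epsilon}$ where each $\theta_{i,\epsilon}$ is integrable and has a definite sign, $\Lambda_{i,\epsilon}:=\operatorname{supp}\theta_{i,\epsilon}$ is contained in the open disk $\Sigma(z_i,\epsilon)$, the disks $\Sigma(z_i,\epsilon)$ are pairwise disjoint, $\int\theta_{i,\epsilon}\,dx=a_i$, and $|\theta_\epsilon(x,0)|\le M\epsilon^{-2}$. For a solution on $[0,T)$ with such an initial datum and $\beta>0$ let $$T_{\epsilon,\beta}=\min_i\sup\{t\in(0,T):|x(x_0,s)-z_i(s)|<\epsilon^\beta\ \ \forall s\in[0,t]\ \forall x_0\in\Lambda_{i,\epsilon}\}.$$ Then for each $\beta\in\left(0,\frac{2-2\alpha}{4-\alpha}\right)$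 there exist $0<\epsilon_0<1$ and $\zeta_0>0$, depending only on $\alpha$, $N$, the $a_i$, the $z_i$, $M$ and $\beta$, such that for every $\epsilon\in(0,\epsilon_0)$ and every global solution ($T=\infty$) with an initial datum as above $$T_{\epsilon,\beta}>\zeta_0|\log\epsilon|;$$ if the solution is only defined on $[0,T)$ with $T<\infty$, then $T_{\epsilon,\beta}>\zeta_0|\log\epsilon|$ or $T_{\epsilon,\beta}=T$. -/

import Mathlib

open MeasureTheory Set
open scoped ContDiff

noncomputable section

namespace MSQG

/-- The Euclidean plane. -/
abbrev Plane : Type := EuclideanSpace ℝ (Fin 2)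

/-- The perpendicular gradient `∇^⊥ f = (∂₂ f, -∂₁ f)`. -/
def perpGrad (f : Plane → ℝ) (x : Plane) : Plane :=
  !₂[fderiv ℝ f x (EuclideanSpace.single 1 1), -fderiv ℝ f x (EuclideanSpace.single 0 1)]

/-- The constant `φ(α) = Γ(α/2) / (π 2^(2-α) Γ((2-α)/2))`. -/
def greenConst (α : ℝ) : ℝ :=
  1 / (Real.pi * 2 ^ (2 - α)) * (Real.Gamma (α / 2) / Real.Gamma ((2 - α) / 2))

/-- The Green function `G(x) = φ(α) |x|^(-α)` of `(-Δ)^(1-α/2)` in the plane, vanishing at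
infinity. -/
def green (α : ℝ) (x : Plane) : ℝ := greenConst α * ‖x‖ ^ (-α)

/-- The kernel `K = ∇^⊥ G`. -/
def kernel (α : ℝ) (x : Plane) : Plane := perpGrad (green α) x

/-- The velocity `u(x) = ∫ K(x - y) θ(y) dy` generated by the active scalar `θ`. -/
def velocity (α : ℝ) (θ : Plane → ℝ) (x : Plane) : Plane :=
  ∫ y, θ y • kernel α (x - y)

/-- `θ` is a bounded integrable weak solution of the mSQG equation on the time interval `[0, T)`:
`d/dt θ[f] = θ[u · ∇f] + θ[∂ₜ f]`, where `θ[f] = ∫ θ(x,t) f(x,t) dx`. -/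
structure IsWeakSolution (α : ℝ) (T : EReal) (θ : ℝ → Plane → ℝ) : Prop where
  integrable : ∀ t : ℝ, 0 ≤ t → (t : EReal) < T → Integrable (θ t)
  bounded : ∀ t : ℝ, 0 ≤ t → (t : EReal) < T → MemLp (θ t) ⊤
  weak : ∀ f : ℝ → Plane → ℝ, ContDiff ℝ ∞ (fun p : ℝ × Plane => f p.1 p.2) →
    HasCompactSupport (fun p : ℝ × Plane => f p.1 p.2) →
    ∀ t : ℝ, 0 ≤ t → (t : EReal) < T →
      HasDerivWithinAt (fun s => ∫ x, θ s x * f s x)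
        ((∫ x, θ t x * fderiv ℝ (f t) x (velocity α (θ t) x))
          + ∫ x, θ t x * deriv (fun s => f s x) t)
        (Ici 0) t

/-- `Φ t x₀ = x(x₀, t)` is the motion of the fluid particles on `[0, T)`: the particles follow
the velocity field, the motion preserves area (the velocity is divergence free), and the active
scalar is conserved along it. -/
structure IsParticleFlow (α : ℝ) (T : EReal) (θ : ℝ → Plane → ℝ) (Φ : ℝ → Plane → Plane) :
    Prop where
  initial : ∀ x₀, Φ 0 x₀ = x₀
  trajectory : ∀ x₀, ∀ t : ℝ, 0 ≤ t → (t : EReal) < T →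
    HasDerivWithinAt (fun s => Φ s x₀) (velocity α (θ t) (Φ t x₀)) (Ici 0) t
  measurePreserving : ∀ t : ℝ, 0 ≤ t → (t : EReal) < T → MeasurePreserving (Φ t) volume volume
  transport : ∀ t : ℝ, 0 ≤ t → (t : EReal) < T → ∀ᵐ x₀, θ t (Φ t x₀) = θ 0 x₀

/-- The blobs `θ₀ i` are an initial datum concentrated in `N` disjoint disks of radius `ε` around
the points `z₀ i`, with intensities `a i`. -/
structure IsConcentratedDatum {N : ℕ} (a : Fin N → ℝ) (z₀ : Fin N → Plane) (M ε : ℝ)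
    (θ₀ : Fin N → Plane → ℝ) : Prop where
  integrable : ∀ i, Integrable (θ₀ i)
  sign : ∀ i, (∀ x, 0 ≤ θ₀ i x) ∨ (∀ x, θ₀ i x ≤ 0)
  support : ∀ i, tsupport (θ₀ i) ⊆ Metric.ball (z₀ i) ε
  disjoint : ∀ i j, i ≠ j → Disjoint (Metric.ball (z₀ i) ε) (Metric.ball (z₀ j) ε)
  intensity : ∀ i, ∫ x, θ₀ i x = a i
  bound : ∀ x, |∑ i, θ₀ i x| ≤ M * ε ^ (-2 : ℤ)

/-- `z` is a solution, for all times `t ≥ 0`, of the pseudo-vortex system with intensities `a`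
issuing from `z₀`. -/
structure IsPseudoVortexSolution (α : ℝ) {N : ℕ} (a : Fin N → ℝ) (z₀ : Fin N → Plane)
    (z : Fin N → ℝ → Plane) : Prop where
  initial : ∀ i, z i 0 = z₀ i
  motion : ∀ i, ∀ t : ℝ, 0 ≤ t →
    HasDerivWithinAt (z i)
      (∑ j ∈ Finset.univ.erase i, a j • kernel α (z i t - z j t)) (Ici 0) t

/-- The pseudo-vortices never collapse: their mutual distances stay bounded away from zero over
`[0, ∞)`, so that the field which each of them feels is bounded and Lipschitz uniformly in time. -/
def NoCollapse {N : ℕ} (z : Fin N → ℝ → Plane) : Prop :=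
  ∃ d : ℝ, 0 < d ∧ ∀ t : ℝ, 0 ≤ t → ∀ i j, i ≠ j → d ≤ dist (z i t) (z j t)

/-- The time horizon
`T_{ε,β} = min_i sup {t > 0 : |x(x₀,s) - z_i(s)| < ε^β for all s ∈ [0,t], x₀ ∈ Λ_i}`
for a solution that lives on `[0, T)`; it takes values in `[-∞, ∞]`. -/
def localizationTime {N : ℕ} (T : EReal) (Λ : Fin N → Set Plane) (Φ : ℝ → Plane → Plane)
    (z : Fin N → ℝ → Plane) (ε β : ℝ) : EReal :=
  ⨅ i, sSup ((fun t : ℝ => (t : EReal)) '' {t : ℝ | 0 < t ∧ (t : EReal) < T ∧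
    ∀ s ∈ Icc 0 t, ∀ x₀ ∈ Λ i, dist (Φ s x₀) (z i s) < ε ^ β})

end MSQG

end

/-! The proof is a bootstrap. While every particle of blob `i` stays within `ε^β` of `z i`, the
blobs keep away from each other, so the field of the other blobs is Lipschitz on each blob uniformly
in time. Exponential growth over times of order `|log ε|` then costs only a small power `ε^(-χ)`. It
suffices to show that the distance is in fact at most `ε^β / 2` (`BlobSystem.dist_le`); continuous
induction (`dist_lt_of_bootstrap`) does the rest.

The singular self-interaction is harmless for low moments: `K` is odd and `K(x) ⊥ x`, so a blob
moves neither its center nor its moment of inertia. Hence the second moments about the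
pseudo-vortices stay below `J` of order `ε^(2-χ)` (`BlobSystem.totalMoment_le`), and the centers
stay within `R₀ = ε^β'` of the pseudo-vortices, where `β'` lies between `β` and the threshold.

A moment bound does not control every particle, so the radial velocity at distance `R` from the
center is split. The core `|y| < R/2` contributes at most `R^(-(2+α)) J`, because centering removes
the leading term (`abs_integral_core_le`). The outer part has mass at most `4J/R²`, but with density
up to `M ε^(-2)` the crude velocity bound is far too large. The outer mass is therefore shown to be
smaller than a prescribed power of `ε`, by means of high moments of `(|x - B|² - R(t)²)₊` about the
center `B`. The exponentially growing `R(t)` absorbs the drift due to the external field. The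
self-interaction is symmetrized against the gradient of the test function, which is locally
Lipschitz, and this lowers the singularity to `|x - y|^(-α)`. Cutting the Riesz potential of the
outer part at `r = ε^(2-β')`, where density and mass balance, bounds the self-interaction by `q` of
order `ε^(2-2α-(2-α)β'-χ)`. Up to the arbitrarily small `χ`, this is negligible against `R₀²`
precisely when `(4-α)β' < 2-2α`, which is the source of the admissible range of `β`.

The moment of order `k + 2` thus leaves outside `2R(t)` a mass of order `(w/R₀²)^(k+2)` up to
`ε^(-χ)`, with `q ≪ w ≪ R₀²` (`BlobSystem.excessMoment_le`). For large `k` its velocity is below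
`R₀`, and a barrier argument confines all particles to `4R(t)` around the center. Blobs of zero
intensity are passive and are compared with the pseudo-vortex directly. -/

noncomputable section

namespace MSQG

/-! ### Explicit form and Lipschitz bound of the kernel. -/

/-- The rotation `x ↦ x^⊥ = (x₂, -x₁)` of the plane. -/
def perp (x : Plane) : Plane := !₂[x 1, -x 0]

lemma inner_perp_self (x : Plane) : inner ℝ x (perp x) = 0 := by
  simp [perp, PiLp.inner_apply, Fin.sum_univ_two]
  ring

lemma norm_perp (x : Plane) : ‖perp x‖ = ‖x‖ := by
  simp [perp, EuclideanSpace.norm_eq, Fin.sum_univ_two, add_comm]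

lemma perp_sub (x y : Plane) : perp (x - y) = perp x - perp y := by
  ext i
  fin_cases i
  · simp [perp]
  · simp [perp]
    ring

lemma perp_neg (x : Plane) : perp (-x) = -perp x := by
  ext i
  fin_cases i <;> simp [perp]

lemma continuous_perp : Continuous perp := by
  unfold perp
  fun_prop

/-- The signed constant in the explicit formula for the kernel. -/
def kernelConst (α : ℝ) : ℝ := -(α * greenConst α)

lemma not_differentiableAt_green {α : ℝ} (hα : 0 < α) (hc : greenConst α ≠ 0) :
    ¬ DifferentiableAt ℝ (green α) 0 := by
  intro h
  have h1 : Filter.Tendsto (fun t : ℝ => green α (t • EuclideanSpace.single 0 1))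
      (nhdsWithin 0 (Ioi 0)) (nhds 0) := by
    have hc0 : ContinuousAt (fun t : ℝ => green α (t • (EuclideanSpace.single 0 1 : Plane))) 0 := by
      apply ContinuousAt.comp (g := green α)
      · simpa using h.continuousAt
      · fun_prop
    have := hc0.tendsto.mono_left (nhdsWithin_le_nhds (s := Ioi 0))
    simpa [green, Real.zero_rpow (neg_ne_zero.2 hα.ne')] using this
  have h2 : Filter.Tendsto (fun t : ℝ => t ^ (-α)) (nhdsWithin 0 (Ioi 0)) (nhds 0) := by
    have h3 := h1.const_mul (greenConst α)⁻¹
    rw [mul_zero] at h3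
    refine h3.congr' ?_
    filter_upwards [self_mem_nhdsWithin] with t ht
    have ht : 0 < t := ht
    simp [green, norm_smul, abs_of_pos ht, hc]
  exact not_tendsto_nhds_of_tendsto_atTop (tendsto_rpow_neg_nhdsGT_zero (by linarith)) 0 h2

lemma hasFDerivAt_green {α : ℝ} {x : Plane} (hx : x ≠ 0) :
    HasFDerivAt (green α)
      ((greenConst α * (-α * ‖x‖ ^ (-(2 + α)))) • innerSL ℝ x) x := by
  have hn : 0 < ‖x‖ := norm_pos_iff.2 hx
  have h1 := (hasStrictFDerivAt_norm_sq x).hasFDerivAt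
  have h2 := (h1.rpow_const (p := -α / 2) (Or.inl (by positivity))).const_mul (greenConst α)
  have h3 : (fun y : Plane => greenConst α * (‖y‖ ^ 2) ^ (-α / 2)) = green α := by
    ext y
    rw [green, ← Real.rpow_natCast, ← Real.rpow_mul (norm_nonneg _)]
    congr 2
    push_cast
    ring
  rw [h3] at h2
  have h4 : (‖x‖ ^ 2) ^ (-α / 2 - 1) = ‖x‖ ^ (-(2 + α)) := by
    rw [← Real.rpow_natCast, ← Real.rpow_mul (norm_nonneg _)]
    congr 1
    push_cast
    ring
  rw [h4] at h2
  refine h2.congr_fderiv ?_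
  module

/-- Away from the origin this is the chain rule. At the origin both sides vanish: either the Green
function is identically zero, or it is not differentiable there and `fderiv` takes its default value
`0`. -/
lemma kernel_eq {α : ℝ} (hα : 0 < α) (x : Plane) :
    kernel α x = (kernelConst α * ‖x‖ ^ (-(2 + α))) • perp x := by
  by_cases hx : x = 0
  · subst hx
    have h0 : perp (0 : Plane) = 0 := by
      rw [← norm_eq_zero, norm_perp, norm_zero]
    rw [h0, smul_zero]
    by_cases hc : greenConst α = 0
    · have : green α = fun _ => 0 := by
        ext y
        simp [green, hc]
      ext i
      fin_cases i <;> simp [kernel, perpGrad, this]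
    · have := fderiv_zero_of_not_differentiableAt (not_differentiableAt_green hα hc)
      ext i
      fin_cases i <;> simp [kernel, perpGrad, this]
  · rw [kernel, perpGrad, (hasFDerivAt_green hx).fderiv]
    ext i
    fin_cases i <;>
      simp [perp, kernelConst, EuclideanSpace.inner_single_right, mul_assoc] <;> ring

lemma norm_kernel {α : ℝ} (hα : 0 < α) (x : Plane) :
    ‖kernel α x‖ = |kernelConst α| * ‖x‖ ^ (-(1 + α)) := by
  rw [kernel_eq hα, norm_smul, norm_perp, Real.norm_eq_abs, abs_mul,
    abs_of_nonneg (Real.rpow_nonneg (norm_nonneg x) _)]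
  rcases eq_or_ne x 0 with rfl | hx
  · rw [norm_zero, Real.zero_rpow (by linarith), Real.zero_rpow (by linarith)]
    ring
  · have hn : 0 < ‖x‖ := norm_pos_iff.2 hx
    rw [mul_assoc, ← Real.rpow_add_one hn.ne']
    congr 2
    ring

lemma inner_kernel_self {α : ℝ} (hα : 0 < α) (x : Plane) : inner ℝ x (kernel α x) = 0 := by
  rw [kernel_eq hα, inner_smul_right, inner_perp_self, mul_zero]

lemma kernel_neg {α : ℝ} (hα : 0 < α) (x : Plane) : kernel α (-x) = -kernel α x := by
  rw [kernel_eq hα, kernel_eq hα, perp_neg, norm_neg, smul_neg]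

lemma measurable_kernel {α : ℝ} (hα : 0 < α) : Measurable (kernel α) := by
  have : kernel α = fun x => (kernelConst α * ‖x‖ ^ (-(2 + α))) • perp x :=
    funext (kernel_eq hα)
  rw [this]
  exact ((measurable_norm.pow_const _).const_mul _).smul continuous_perp.measurable

/-- Writing `t = s (t/s)`, the inequalities `1 + u ≤ exp u` and `log v ≤ v - 1` give `(t/s)^(-p) ≥ 1
- p (t/s - 1)`. The factor `s` makes up for the power lost in the difference. -/
lemma rpow_neg_sub_le {p s t : ℝ} (hp : 0 ≤ p) (hs : 0 < s) (hst : s ≤ t) :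
    s * |s ^ (-p) - t ^ (-p)| ≤ p * s ^ (-p) * (t - s) := by
  have ht : 0 < t := hs.trans_le hst
  have h1 : t ^ (-p) ≤ s ^ (-p) := Real.rpow_le_rpow_of_nonpos hs hst (by linarith)
  rw [abs_of_nonneg (sub_nonneg.2 h1)]
  have h2 : t ^ (-p) = s ^ (-p) * (t / s) ^ (-p) := by
    rw [← Real.mul_rpow hs.le (by positivity)]
    congr 1
    field_simp
  have h3 : 1 - p * (t / s - 1) ≤ (t / s) ^ (-p) := by
    rw [Real.rpow_def_of_pos (by positivity)]
    have h4 := Real.add_one_le_exp (Real.log (t / s) * -p)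
    have h5 := Real.log_le_sub_one_of_pos (show 0 < t / s by positivity)
    nlinarith
  have h6 : s * (s ^ (-p) - t ^ (-p)) ≤ s * (s ^ (-p) * (p * (t / s - 1))) := by
    have := Real.rpow_nonneg hs.le (-p)
    rw [h2]
    gcongr
    nlinarith
  refine h6.trans (le_of_eq ?_)
  field_simp

lemma kernel_lipschitz_of_le {α : ℝ} (hα : 0 < α) {ρ : ℝ} (hρ : 0 < ρ) {x y : Plane}
    (hx : ρ ≤ ‖x‖) (hy : ‖x‖ ≤ ‖y‖) :
    ‖kernel α x - kernel α y‖ ≤ |kernelConst α| * (3 + α) * ρ ^ (-(2 + α)) * ‖x - y‖ := by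
  have hx0 : 0 < ‖x‖ := hρ.trans_le hx
  have hy0 : 0 < ‖y‖ := hx0.trans_le hy
  -- The increment of the scalar factor is attached to the shorter vector `x`, whose length absorbs
  -- the lost power. The two terms give `1 + (2 + α)`.
  have h1 : kernel α x - kernel α y = (kernelConst α * ‖y‖ ^ (-(2 + α))) • perp (x - y) +
      (kernelConst α * (‖x‖ ^ (-(2 + α)) - ‖y‖ ^ (-(2 + α)))) • perp x := by
    rw [kernel_eq hα, kernel_eq hα, perp_sub]
    module
  have h2 : ‖x‖ ^ (-(2 + α)) ≤ ρ ^ (-(2 + α)) := Real.rpow_le_rpow_of_nonpos hρ hx (by linarith)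
  have h3 : ‖y‖ ^ (-(2 + α)) ≤ ‖x‖ ^ (-(2 + α)) :=
    Real.rpow_le_rpow_of_nonpos hx0 hy (by linarith)
  have h4 : ‖y‖ - ‖x‖ ≤ ‖x - y‖ := by
    rw [norm_sub_rev]
    exact norm_sub_norm_le y x
  have h5 := rpow_neg_sub_le (p := 2 + α) (by linarith) hx0 hy
  have h6 := Real.rpow_nonneg (norm_nonneg y) (-(2 + α))
  rw [h1]
  refine (norm_add_le _ _).trans ?_
  rw [norm_smul, norm_smul, norm_perp, norm_perp, Real.norm_eq_abs, Real.norm_eq_abs, abs_mul,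
    abs_mul, abs_of_nonneg h6]
  have h7 : ‖x‖ * |‖x‖ ^ (-(2 + α)) - ‖y‖ ^ (-(2 + α))| ≤
      (2 + α) * ρ ^ (-(2 + α)) * ‖x - y‖ := by
    refine h5.trans ?_
    have : 0 ≤ ‖y‖ - ‖x‖ := sub_nonneg.2 hy
    gcongr
  have h8 : ‖y‖ ^ (-(2 + α)) * ‖x - y‖ ≤ ρ ^ (-(2 + α)) * ‖x - y‖ := by
    exact mul_le_mul_of_nonneg_right (h3.trans h2) (norm_nonneg _)
  have h9 := abs_nonneg (kernelConst α)
  nlinarith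

/-- Away from the origin the kernel is Lipschitz. -/
lemma kernel_lipschitz {α : ℝ} (hα : 0 < α) {ρ : ℝ} (hρ : 0 < ρ) {x y : Plane}
    (hx : ρ ≤ ‖x‖) (hy : ρ ≤ ‖y‖) :
    ‖kernel α x - kernel α y‖ ≤ |kernelConst α| * (3 + α) * ρ ^ (-(2 + α)) * ‖x - y‖ := by
  rcases le_total ‖x‖ ‖y‖ with h | h
  · exact kernel_lipschitz_of_le hα hρ hx h
  · rw [norm_sub_rev, norm_sub_rev x]
    exact kernel_lipschitz_of_le hα hρ hy h

/-! ### Riesz potentials of measures with bounded density. -/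

/-- The constant in the bound for the Riesz potential of a bounded density. -/
def rieszConst (γ : ℝ) : ℝ := 2 * (volume (Metric.ball (0 : Plane) 1)).toReal / (2 - γ)

lemma rieszConst_nonneg {γ : ℝ} (hγ : γ < 2) : 0 ≤ rieszConst γ := by
  unfold rieszConst
  have : 0 ≤ 2 - γ := by linarith
  positivity

lemma radial_indicator_eq {γ r y : ℝ} (hy : y ∈ Ioi (0 : ℝ)) :
    y ^ (Module.finrank ℝ Plane - 1) • (Iio r).indicator (fun t : ℝ => t ^ (-γ)) y =
      (Iio r).indicator (fun t : ℝ => t ^ (1 - γ)) y := by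
  have hy : 0 < y := hy
  simp only [finrank_euclideanSpace, Fintype.card_fin, indicator]
  split_ifs
  · rw [smul_eq_mul, sub_eq_add_neg, Real.rpow_add hy]
    simp
  · simp

lemma integrable_riesz_ball {γ r : ℝ} (hγ : γ < 2) (hr : 0 < r) :
    Integrable (fun x : Plane => (Iio r).indicator (fun t : ℝ => t ^ (-γ)) ‖x‖) := by
  rw [integrable_fun_norm_addHaar (volume : Measure Plane)]
  refine (integrableOn_congr_fun (fun y hy => radial_indicator_eq hy) measurableSet_Ioi).2 ?_
  rw [IntegrableOn, integrable_indicator_iff measurableSet_Iio, IntegrableOn,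
    Measure.restrict_restrict measurableSet_Iio]
  have h := intervalIntegral.intervalIntegrable_rpow' (a := 0) (b := r) (r := 1 - γ) (by linarith)
  rw [intervalIntegrable_iff_integrableOn_Ioo_of_le hr.le] at h
  rwa [inter_comm, Ioi_inter_Iio]

lemma integral_riesz_ball {γ r : ℝ} (hγ : γ < 2) (hr : 0 < r) :
    ∫ x : Plane, (Iio r).indicator (fun t : ℝ => t ^ (-γ)) ‖x‖ = rieszConst γ * r ^ (2 - γ) := by
  rw [integral_fun_norm_addHaar (volume : Measure Plane),
    setIntegral_congr_fun measurableSet_Ioi (fun y hy => radial_indicator_eq hy),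
    setIntegral_indicator measurableSet_Iio, Ioi_inter_Iio, ← integral_Ioc_eq_integral_Ioo,
    ← intervalIntegral.integral_of_le hr.le, integral_rpow (Or.inl (by linarith)),
    Real.zero_rpow (by linarith)]
  simp only [finrank_euclideanSpace, Fintype.card_fin, rieszConst, Measure.real]
  rw [show 1 - γ + 1 = 2 - γ by ring, nsmul_eq_mul, smul_eq_mul]
  push_cast
  ring

section Riesz

variable {ν : Measure Plane} {D γ : ℝ}

lemma rpow_neg_le_indicator_add {γ r : ℝ} (hγ : 0 < γ) (hr : 0 < r) {t : ℝ} :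
    t ^ (-γ) ≤ (Iio r).indicator (fun t : ℝ => t ^ (-γ)) t + r ^ (-γ) := by
  by_cases h : t < r
  · rw [indicator_of_mem (by exact h)]
    have := Real.rpow_nonneg hr.le (-γ)
    linarith
  · rw [indicator_of_notMem (by exact h), zero_add]
    exact Real.rpow_le_rpow_of_nonpos hr (not_lt.1 h) (by linarith)

lemma integrable_riesz_indicator (hν : ν ≤ ENNReal.ofReal D • volume) (hγ : γ < 2) {r : ℝ}
    (hr : 0 < r) (x : Plane) :
    Integrable (fun y => (Iio r).indicator (fun t : ℝ => t ^ (-γ)) ‖x - y‖) ν :=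
  Integrable.of_measure_le_smul ENNReal.ofReal_ne_top hν
    ((integrable_riesz_ball hγ hr).comp_sub_left x)

lemma integrable_riesz [IsFiniteMeasure ν] (hν : ν ≤ ENNReal.ofReal D • volume) (hγ₀ : 0 < γ)
    (hγ : γ < 2)
    (x : Plane) : Integrable (fun y => ‖x - y‖ ^ (-γ)) ν := by
  refine ((integrable_riesz_indicator hν hγ one_pos x).add
    (integrable_const ((1 : ℝ) ^ (-γ)))).mono' ?_ (ae_of_all _ fun y => ?_)
  · exact ((measurable_const.sub measurable_id).norm.pow_const _).aestronglyMeasurable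
  · rw [Real.norm_of_nonneg (Real.rpow_nonneg (norm_nonneg _) _)]
    exact rpow_neg_le_indicator_add hγ₀ one_pos

/-- The Riesz potential of a measure with bounded density. -/
lemma integral_riesz_le [IsFiniteMeasure ν] (hD : 0 ≤ D) (hν : ν ≤ ENNReal.ofReal D • volume)
    (hγ₀ : 0 < γ)
    (hγ : γ < 2) {r : ℝ} (hr : 0 < r) (x : Plane) :
    ∫ y, ‖x - y‖ ^ (-γ) ∂ν ≤ D * (rieszConst γ * r ^ (2 - γ)) + r ^ (-γ) * ν.real univ := by
  have h1 := integrable_riesz_indicator hν hγ hr x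
  -- Within distance `r` of `x` only the density matters, beyond it only the mass. The radius stays
  -- free so that it can be tuned to each pair of density and mass.
  calc ∫ y, ‖x - y‖ ^ (-γ) ∂ν
      ≤ ∫ y, ((Iio r).indicator (fun t : ℝ => t ^ (-γ)) ‖x - y‖ + r ^ (-γ)) ∂ν :=
        integral_mono (integrable_riesz hν hγ₀ hγ x) (h1.add (integrable_const _))
          fun y => rpow_neg_le_indicator_add hγ₀ hr
    _ = ∫ y, (Iio r).indicator (fun t : ℝ => t ^ (-γ)) ‖x - y‖ ∂ν + r ^ (-γ) * ν.real univ := by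
        rw [integral_add h1 (integrable_const _), integral_const, smul_eq_mul, mul_comm (ν.real _)]
    _ ≤ _ := by
        gcongr
        have h2 : Integrable (fun y => (Iio r).indicator (fun t : ℝ => t ^ (-γ)) ‖x - y‖)
            (ENNReal.ofReal D • (volume : Measure Plane)) :=
          ((integrable_riesz_ball hγ hr).comp_sub_left x).smul_measure ENNReal.ofReal_ne_top
        refine (integral_mono_measure hν (ae_of_all _ fun y => ?_) h2).trans_eq ?_
        · exact indicator_apply_nonneg fun _ => Real.rpow_nonneg (norm_nonneg _) _
        · rw [integral_smul_measure, ENNReal.toReal_ofReal hD, smul_eq_mul,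
            integral_sub_left_eq_self (fun y : Plane => (Iio r).indicator _ ‖y‖),
            integral_riesz_ball hγ hr]

end Riesz

/-! ### Velocity of a measure, symmetrization, and the field of a centered core. -/

/-- The velocity field `x ↦ ∫ K(x - y) dν(y)` generated by a measure. -/
def measureVelocity (α : ℝ) (ν : Measure Plane) (x : Plane) : Plane :=
  ∫ y, kernel α (x - y) ∂ν

section Static

variable {α D : ℝ} {ν : Measure Plane} [IsFiniteMeasure ν]

lemma measurable_kernel_sub (hα : 0 < α) :
    Measurable fun p : Plane × Plane => kernel α (p.1 - p.2) :=
  (measurable_kernel hα).comp (measurable_fst.sub measurable_snd)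

/-- The singularity has order `1 + α`, which is integrable in the plane because `α < 1`. -/
lemma integrable_kernel (hα₀ : 0 < α) (hα₁ : α < 1) (hν : ν ≤ ENNReal.ofReal D • volume)
    (x : Plane) : Integrable (fun y => kernel α (x - y)) ν := by
  refine ((integrable_riesz (γ := 1 + α) hν (by linarith) (by linarith) x).const_mul
    |kernelConst α|).mono' ?_ (ae_of_all _ fun y => (norm_kernel hα₀ _).le)
  exact ((measurable_kernel hα₀).comp (measurable_const.sub measurable_id)).aestronglyMeasurable

lemma integral_norm_kernel_le (hα₀ : 0 < α) (hα₁ : α < 1) (hD : 0 ≤ D)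
    (hν : ν ≤ ENNReal.ofReal D • volume) {r : ℝ} (hr : 0 < r) (x : Plane) :
    ∫ y, ‖kernel α (x - y)‖ ∂ν ≤ |kernelConst α| *
      (D * (rieszConst (1 + α) * r ^ (1 - α)) + r ^ (-(1 + α)) * ν.real univ) := by
  simp only [norm_kernel hα₀]
  rw [integral_const_mul]
  have := integral_riesz_le (γ := 1 + α) hD hν (by linarith) (by linarith) hr x
  rw [show 2 - (1 + α) = 1 - α by ring] at this
  gcongr

lemma norm_measureVelocity_le (hα₀ : 0 < α) (hα₁ : α < 1) (hD : 0 ≤ D)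
    (hν : ν ≤ ENNReal.ofReal D • volume) {r : ℝ} (hr : 0 < r) (x : Plane) :
    ‖measureVelocity α ν x‖ ≤ |kernelConst α| *
      (D * (rieszConst (1 + α) * r ^ (1 - α)) + r ^ (-(1 + α)) * ν.real univ) :=
  (norm_integral_le_integral_norm _).trans (integral_norm_kernel_le hα₀ hα₁ hD hν hr x)

lemma integrable_prod_kernel (hα₀ : 0 < α) (hα₁ : α < 1) (hD : 0 ≤ D)
    (hν : ν ≤ ENNReal.ofReal D • volume) :
    Integrable (fun p : Plane × Plane => kernel α (p.1 - p.2)) (ν.prod ν) := by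
  have hm := measurable_kernel_sub hα₀
  rw [integrable_prod_iff hm.aestronglyMeasurable]
  refine ⟨ae_of_all _ fun x => integrable_kernel hα₀ hα₁ hν x, ?_⟩
  refine (integrable_const (|kernelConst α| * (D * (rieszConst (1 + α) * (1 : ℝ) ^ (1 - α)) +
    1 ^ (-(1 + α)) * ν.real univ))).mono' ?_ (ae_of_all _ fun x => ?_)
  · exact hm.norm.stronglyMeasurable.integral_prod_right.aestronglyMeasurable
  · rw [Real.norm_of_nonneg (integral_nonneg fun y => norm_nonneg _)]
    exact integral_norm_kernel_le hα₀ hα₁ hD hν one_pos x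

lemma stronglyMeasurable_measureVelocity (hα : 0 < α) :
    StronglyMeasurable (measureVelocity α ν) :=
  (measurable_kernel_sub hα).stronglyMeasurable.integral_prod_right

lemma integrable_inner_kernel (hα₀ : 0 < α) (hα₁ : α < 1) (hD : 0 ≤ D)
    (hν : ν ≤ ENNReal.ofReal D • volume) {φ : Plane → Plane} (hφ : Measurable φ) {C : ℝ}
    (hC : ∀ᵐ x ∂ν, ‖φ x‖ ≤ C) :
    Integrable (fun p : Plane × Plane => inner ℝ (φ p.1) (kernel α (p.1 - p.2))) (ν.prod ν) := by
  refine ((integrable_prod_kernel hα₀ hα₁ hD hν).norm.const_mul C).mono' ?_ ?_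
  · exact ((hφ.comp measurable_fst).inner (measurable_kernel_sub hα₀)).aestronglyMeasurable
  · have h : ∀ᵐ p ∂ν.prod ν, ‖φ p.1‖ ≤ C := Measure.quasiMeasurePreserving_fst.ae hC
    filter_upwards [h] with p hp
    exact (norm_inner_le_norm _ _).trans (by gcongr)

/-- Symmetrization of the self-interaction. -/
lemma integral_inner_measureVelocity (hα₀ : 0 < α) (hα₁ : α < 1) (hD : 0 ≤ D)
    (hν : ν ≤ ENNReal.ofReal D • volume) {φ : Plane → Plane} (hφ : Measurable φ) {C : ℝ}
    (hC : ∀ᵐ x ∂ν, ‖φ x‖ ≤ C) :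
    ∫ x, inner ℝ (φ x) (measureVelocity α ν x) ∂ν =
      (∫ p : Plane × Plane, inner ℝ (φ p.1 - φ p.2) (kernel α (p.1 - p.2)) ∂ν.prod ν) / 2 := by
  have h1 := integrable_inner_kernel hα₀ hα₁ hD hν hφ hC
  have h2 : ∫ x, inner ℝ (φ x) (measureVelocity α ν x) ∂ν =
      ∫ p : Plane × Plane, inner ℝ (φ p.1) (kernel α (p.1 - p.2)) ∂ν.prod ν := by
    rw [integral_prod _ h1]
    refine integral_congr_ae (ae_of_all _ fun x => ?_)
    exact (integral_inner (integrable_kernel hα₀ hα₁ hν x) (φ x)).symm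
  have h3 : ∫ p : Plane × Plane, inner ℝ (φ p.2) (kernel α (p.1 - p.2)) ∂ν.prod ν =
      -∫ p : Plane × Plane, inner ℝ (φ p.1) (kernel α (p.1 - p.2)) ∂ν.prod ν := by
    rw [← integral_prod_swap, ← integral_neg]
    refine integral_congr_ae (ae_of_all _ fun p => ?_)
    simp only [Prod.fst_swap, Prod.snd_swap]
    rw [← neg_sub, kernel_neg hα₀, inner_neg_right]
  have h4 : Integrable (fun p : Plane × Plane => inner ℝ (φ p.2) (kernel α (p.1 - p.2)))
      (ν.prod ν) := by
    refine (h1.swap.neg).congr (ae_of_all _ fun p => ?_)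
    simp only [Pi.neg_apply, Function.comp, Prod.fst_swap, Prod.snd_swap]
    rw [← neg_sub p.1, kernel_neg hα₀, inner_neg_right, neg_neg]
  simp only [inner_sub_left]
  rw [integral_sub h1 h4, h3, h2]
  ring

/-- A blob does not move its own moments of order one and two. -/
lemma integral_inner_sub_measureVelocity (hα₀ : 0 < α) (hα₁ : α < 1) (hD : 0 ≤ D)
    (hν : ν ≤ ENNReal.ofReal D • volume) (w : Plane) {C : ℝ} (hC : ∀ᵐ x ∂ν, ‖x‖ ≤ C) :
    ∫ x, inner ℝ (x - w) (measureVelocity α ν x) ∂ν = 0 := by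
  rw [integral_inner_measureVelocity hα₀ hα₁ hD hν (φ := fun x => x - w)
    (measurable_id.sub_const w) (C := C + ‖w‖)]
  -- After symmetrization the test field contributes `x - y`, which is orthogonal to `K(x - y)`.
  · simp [inner_kernel_self hα₀]
  · filter_upwards [hC] with x hx
    exact (norm_sub_le _ _).trans (by gcongr)

lemma integrable_measureVelocity (hα₀ : 0 < α) (hα₁ : α < 1) (hD : 0 ≤ D)
    (hν : ν ≤ ENNReal.ofReal D • volume) : Integrable (measureVelocity α ν) ν :=
  (integrable_prod_kernel hα₀ hα₁ hD hν).integral_prod_left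

/-- A constant test field has zero increments, so its symmetrized integral vanishes. Consequently
the center of a blob is moved only by the other blobs. -/
lemma integral_measureVelocity (hα₀ : 0 < α) (hα₁ : α < 1) (hD : 0 ≤ D)
    (hν : ν ≤ ENNReal.ofReal D • volume) : ∫ x, measureVelocity α ν x ∂ν = 0 := by
  refine ext_inner_left ℝ fun v => ?_
  rw [inner_zero_right, ← integral_inner (integrable_measureVelocity hα₀ hα₁ hD hν),
    integral_inner_measureVelocity hα₀ hα₁ hD hν (φ := fun _ => v) measurable_const (C := ‖v‖)
      (ae_of_all _ fun _ => le_rfl)]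
  simp

/-- The constant in the bound for the radial velocity created by the core of a blob. -/
def coreConst (α : ℝ) : ℝ := |kernelConst α| * (2 + (3 + α) * 2 ^ (2 + α))

lemma coreConst_nonneg (hα : 0 < α) : 0 ≤ coreConst α := by
  unfold coreConst
  positivity

/-- The radial velocity created by the core of a centered blob is controlled by its moment of
inertia. -/
lemma abs_integral_core_le (hα₀ : 0 < α) (hα₁ : α < 1) (hν : ν ≤ ENNReal.ofReal D • volume)
    {C : ℝ} (hC : ∀ᵐ x ∂ν, ‖x‖ ≤ C) (hcenter : ∫ x, x ∂ν = 0) {ρ : ℝ} (hρ : 0 < ρ) {x : Plane}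
    (hx : ρ ≤ ‖x‖) :
    |inner ℝ x (measureVelocity α (ν.restrict {y | ρ / 2 ≤ ‖y‖}ᶜ) x)| ≤
      coreConst α * ρ ^ (-(2 + α)) * ∫ y, ‖y‖ ^ 2 ∂ν := by
  have hE : MeasurableSet {y : Plane | ρ / 2 ≤ ‖y‖} := measurableSet_le measurable_const
      measurable_norm
  have hid : Integrable (fun y : Plane => y) ν :=
    (integrable_const C).mono' measurable_id.aestronglyMeasurable hC
  have hK := integrable_kernel hα₀ hα₁ hν x
  have hsq : Integrable (fun y : Plane => ‖y‖ ^ 2) ν := by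
    refine (integrable_const (C ^ 2)).mono'
      (measurable_norm.pow_const 2).aestronglyMeasurable ?_
    filter_upwards [hC] with y hy
    rw [Real.norm_of_nonneg (by positivity)]
    gcongr
  -- Centering enters here: the term linear in `y` has zero mean over the whole blob and may be
  -- subtracted at no cost.
  have hz : ∫ y, inner ℝ (kernel α x) y ∂ν = 0 := by
    rw [integral_inner hid, hcenter, inner_zero_right]
  have h1 : inner ℝ x (measureVelocity α (ν.restrict {y | ρ / 2 ≤ ‖y‖}ᶜ) x) =
      ∫ y, (indicator {y | ρ / 2 ≤ ‖y‖}ᶜ (fun y => inner ℝ x (kernel α (x - y))) y -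
        inner ℝ (kernel α x) y) ∂ν := by
    rw [integral_sub ((hK.const_inner x).indicator hE.compl) (hid.const_inner _), hz, sub_zero,
      integral_indicator hE.compl, measureVelocity, integral_inner hK.restrict]
  rw [h1, ← Real.norm_eq_abs, ← integral_const_mul]
  refine norm_integral_le_of_norm_le (hsq.const_mul _) (ae_of_all _ fun y => ?_)
  have hκ := abs_nonneg (kernelConst α)
  have hρp : 0 < ρ ^ (-(2 + α)) := Real.rpow_pos_of_pos hρ _
  have hx0 : 0 < ‖x‖ := hρ.trans_le hx
  -- Outside the core only the subtracted linear term is left, and `ρ ≤ 2‖y‖` makes it quadratic in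
  -- `y`.
  by_cases hy : ρ / 2 ≤ ‖y‖
  · rw [indicator_of_notMem (by simpa using hy), zero_sub, norm_neg]
    refine (norm_inner_le_norm _ _).trans ?_
    rw [norm_kernel hα₀]
    have h2 : ‖x‖ ^ (-(1 + α)) ≤ ρ ^ (-(2 + α)) * ρ := by
      rw [← Real.rpow_add_one hρ.ne', show -(2 + α) + 1 = -(1 + α) by ring]
      exact Real.rpow_le_rpow_of_nonpos hρ hx (by linarith)
    calc |kernelConst α| * ‖x‖ ^ (-(1 + α)) * ‖y‖
        ≤ |kernelConst α| * (ρ ^ (-(2 + α)) * (2 * ‖y‖)) * ‖y‖ := by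
          gcongr
          refine h2.trans ?_
          gcongr
          linarith
      _ = |kernelConst α| * 2 * (ρ ^ (-(2 + α)) * ‖y‖ ^ 2) := by ring
      _ ≤ coreConst α * (ρ ^ (-(2 + α)) * ‖y‖ ^ 2) := by
          unfold coreConst
          gcongr
          have : (0 : ℝ) ≤ (3 + α) * 2 ^ (2 + α) := by positivity
          linarith
      _ = _ := by ring
  · rw [indicator_of_mem (by simpa using hy)]
    have hy := not_le.1 hy
    -- Orthogonality replaces `x` by `y` and yields one factor `‖y‖`; the Lipschitz bound for the
    -- kernel yields the other.
    have h2 : inner ℝ x (kernel α (x - y)) = inner ℝ y (kernel α (x - y)) := by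
      have := inner_kernel_self hα₀ (x - y)
      rw [inner_sub_left] at this
      linarith
    have h3 : ρ / 2 ≤ ‖x - y‖ := by
      have := norm_sub_norm_le x y
      linarith
    have h4 := kernel_lipschitz hα₀ (half_pos hρ) h3 (y := x) (by linarith)
    rw [h2, real_inner_comm y (kernel α x), ← inner_sub_right]
    refine (norm_inner_le_norm _ _).trans ?_
    have h5 : ‖x - y - x‖ = ‖y‖ := by
      rw [sub_sub_cancel_left, norm_neg]
    have h6 : (ρ / 2) ^ (-(2 + α)) = ρ ^ (-(2 + α)) * 2 ^ (2 + α) := by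
      rw [Real.div_rpow hρ.le (by norm_num), Real.rpow_neg (by norm_num : (0:ℝ) ≤ 2),
          div_inv_eq_mul]
    rw [h5, h6] at h4
    calc ‖y‖ * ‖kernel α (x - y) - kernel α x‖
        ≤ ‖y‖ * (|kernelConst α| * (3 + α) * (ρ ^ (-(2 + α)) * 2 ^ (2 + α)) * ‖y‖) := by gcongr
      _ = |kernelConst α| * ((3 + α) * 2 ^ (2 + α)) * (ρ ^ (-(2 + α)) * ‖y‖ ^ 2) := by ring
      _ ≤ coreConst α * (ρ ^ (-(2 + α)) * ‖y‖ ^ 2) := by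
          unfold coreConst
          gcongr
          linarith
      _ = _ := by ring

end Static

/-! ### Powers of the excess and the variation of their gradients. -/

/-- The excess `(|x|² - R²)₊` of a point over the disk of radius `R`. -/
def excess (R : ℝ) (x : Plane) : ℝ := max (‖x‖ ^ 2 - R ^ 2) 0

lemma excess_nonneg (R : ℝ) (x : Plane) : 0 ≤ excess R x := le_max_right _ _

lemma continuous_excess (R : ℝ) : Continuous (excess R) := by
  unfold excess
  fun_prop

lemma excess_eq_zero {R : ℝ} {x : Plane} (hx : ‖x‖ ≤ R) : excess R x = 0 := by
  have : ‖x‖ ^ 2 ≤ R ^ 2 := by gcongr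
  exact max_eq_right (by linarith)

lemma excess_le_sq (R : ℝ) (x : Plane) : excess R x ≤ ‖x‖ ^ 2 :=
  max_le (by nlinarith [sq_nonneg R]) (by positivity)

/-- Where the excess is positive, `‖x‖²` is the excess plus `R²`; elsewhere both sides vanish
because `n ≠ 0`. This trades squared norms for powers of the excess. -/
lemma excess_pow_mul_sq {R : ℝ} {x : Plane} {n : ℕ} (hn : n ≠ 0) :
    excess R x ^ n * ‖x‖ ^ 2 = excess R x ^ n * (excess R x + R ^ 2) := by
  rcases le_total (‖x‖ ^ 2 - R ^ 2) 0 with h | h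
  · simp [excess, max_eq_right h, hn]
  · rw [excess, max_eq_left h]
    ring

lemma pow_sub_pow_le {s t : ℝ} (ht : 0 ≤ t) (hts : t ≤ s) (n : ℕ) :
    s ^ n - t ^ n ≤ n * s ^ (n - 1) * (s - t) := by
  have hs : 0 ≤ s := ht.trans hts
  rw [← (Commute.all s t).geom_sum₂_mul n]
  gcongr
  calc ∑ i ∈ Finset.range n, s ^ i * t ^ (n - 1 - i)
      ≤ ∑ i ∈ Finset.range n, s ^ (n - 1) := by
          refine Finset.sum_le_sum fun i hi => ?_
          have hi := Finset.mem_range.1 hi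
          calc s ^ i * t ^ (n - 1 - i) ≤ s ^ i * s ^ (n - 1 - i) := by gcongr
            _ = s ^ (n - 1) := by rw [← pow_add]; congr 1; omega
      _ = n * s ^ (n - 1) := by simp

/-- The local Lipschitz constant of the gradient of a power of the excess. -/
def excessHessian (R : ℝ) (n : ℕ) (x : Plane) : ℝ :=
  (1 + 2 * n) * excess R x ^ n + 2 * n * (R ^ 2 * excess R x ^ (n - 1))

lemma excessHessian_nonneg (R : ℝ) (n : ℕ) (x : Plane) : 0 ≤ excessHessian R n x := by
  have := excess_nonneg R x
  unfold excessHessian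
  positivity

lemma continuous_excessHessian (R : ℝ) (n : ℕ) : Continuous (excessHessian R n) := by
  have := continuous_excess R
  unfold excessHessian
  fun_prop

/-- Up to a constant the vector field is the gradient of the power `n + 1` of the excess. Moving `x`
costs `excess^n`, and varying the scalar factor costs `2n excess^(n-1) ‖x‖²`; rewriting `‖x‖²` by
`excess_pow_mul_sq` gives the two terms of `excessHessian`. -/
lemma norm_excess_smul_sub_le_of_le {R : ℝ} {n : ℕ} (hn : 2 ≤ n) {x y : Plane}
    (hxy : ‖y‖ ≤ ‖x‖) :
    ‖excess R x ^ n • x - excess R y ^ n • y‖ ≤ excessHessian R n x * ‖x - y‖ := by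
  have hx := excess_nonneg R x
  have hy := excess_nonneg R y
  have hsq : ‖y‖ ^ 2 ≤ ‖x‖ ^ 2 := by gcongr
  have hle : excess R y ≤ excess R x := max_le_max (by linarith) le_rfl
  have hnn : ‖x‖ - ‖y‖ ≤ ‖x - y‖ := norm_sub_norm_le x y
  have hdiff : excess R x - excess R y ≤ 2 * ‖x‖ * ‖x - y‖ := by
    have h1 : excess R x - excess R y ≤ ‖x‖ ^ 2 - ‖y‖ ^ 2 := by
      have h2 := le_max_left (‖y‖ ^ 2 - R ^ 2) 0
      have h3 : excess R x ≤ excess R y + (‖x‖ ^ 2 - ‖y‖ ^ 2) :=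
        max_le (by unfold excess; linarith) (by linarith)
      linarith
    have h4 := norm_nonneg y
    nlinarith
  have h5 : excess R x ^ n • x - excess R y ^ n • y =
      excess R x ^ n • (x - y) + (excess R x ^ n - excess R y ^ n) • y := by module
  have h6 : 0 ≤ excess R x ^ n - excess R y ^ n := sub_nonneg.2 (by gcongr)
  rw [h5]
  refine (norm_add_le _ _).trans ?_
  rw [norm_smul, norm_smul, Real.norm_of_nonneg (by positivity), Real.norm_of_nonneg h6]
  have h7 : (excess R x ^ n - excess R y ^ n) * ‖y‖ ≤
      2 * n * (excess R x ^ (n - 1) * ‖x‖ ^ 2) * ‖x - y‖ := by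
    calc (excess R x ^ n - excess R y ^ n) * ‖y‖
        ≤ (n * excess R x ^ (n - 1) * (2 * ‖x‖ * ‖x - y‖)) * ‖x‖ := by
          gcongr
          refine (pow_sub_pow_le hy hle n).trans ?_
          gcongr
      _ = _ := by ring
  rw [excess_pow_mul_sq (by omega), mul_add, ← pow_succ, show n - 1 + 1 = n by omega] at h7
  unfold excessHessian
  linarith

lemma norm_excess_smul_sub_le {R : ℝ} {n : ℕ} (hn : 2 ≤ n) (x y : Plane) :
    ‖excess R x ^ n • x - excess R y ^ n • y‖ ≤
      (excessHessian R n x + excessHessian R n y) * ‖x - y‖ := by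
  have hx := excessHessian_nonneg R n x
  have hy := excessHessian_nonneg R n y
  have h := norm_nonneg (x - y)
  rcases le_total ‖y‖ ‖x‖ with hxy | hxy
  · have := norm_excess_smul_sub_le_of_le (R := R) hn hxy
    nlinarith
  · have := norm_excess_smul_sub_le_of_le (R := R) hn hxy
    rw [norm_sub_rev, norm_sub_rev y] at this
    nlinarith

/-- Young's inequality in the form used for the moments of the excess. -/
lemma mul_pow_le_pow_add_pow {q w s : ℝ} (hs : 0 ≤ s) (hw : 0 ≤ w) {n k : ℕ}
    (hq : q ≤ w ^ k) : q * s ^ n ≤ s ^ (n + k) + w ^ (n + k) := by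
  have h1 : q * s ^ n ≤ w ^ k * s ^ n := by gcongr
  refine h1.trans ?_
  rcases le_total w s with h | h
  · have h2 : w ^ k * s ^ n ≤ s ^ k * s ^ n := by gcongr
    have h3 : 0 ≤ w ^ (n + k) := by positivity
    rw [← pow_add, add_comm k n] at h2
    linarith
  · have h2 : w ^ k * s ^ n ≤ w ^ k * w ^ n := by gcongr
    have h3 : 0 ≤ s ^ (n + k) := by positivity
    rw [← pow_add, add_comm k n] at h2
    linarith

lemma exists_bound_of_continuous {ν : Measure Plane} {f : Plane → Plane} (hf : Continuous f) {C : ℝ}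
    (hC : ∀ᵐ x ∂ν, ‖x‖ ≤ C) : ∃ K, ∀ᵐ x ∂ν, ‖f x‖ ≤ K := by
  obtain ⟨K, hK⟩ := (isCompact_closedBall (0 : Plane) C).exists_bound_of_continuousOn
    hf.continuousOn
  refine ⟨K, ?_⟩
  filter_upwards [hC] with x hx
  exact hK x (by simpa using hx)

/-! ### Self-interaction tested against powers of the excess. -/

section Static

variable {α D : ℝ} {ν : Measure Plane} [IsFiniteMeasure ν]

lemma integrable_of_continuous_of_bounded {f : Plane → ℝ} (hf : Continuous f) {C : ℝ}
    (hC : ∀ᵐ x ∂ν, ‖x‖ ≤ C) : Integrable f ν := by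
  obtain ⟨K, hK⟩ := (isCompact_closedBall (0 : Plane) C).exists_bound_of_continuousOn
    hf.continuousOn
  refine (integrable_const K).mono' hf.aestronglyMeasurable ?_
  filter_upwards [hC] with x hx
  exact hK x (by simpa using hx)

lemma integrable_prod_mul_riesz (hα₀ : 0 < α) (hα₁ : α < 1) {D : ℝ} (hD : 0 ≤ D)
    (hν : ν ≤ ENNReal.ofReal D • volume) {g : Plane → ℝ} (hg : Continuous g) {C : ℝ}
    (hC : ∀ᵐ x ∂ν, ‖x‖ ≤ C) :
    Integrable (fun p : Plane × Plane => g p.1 * ‖p.1 - p.2‖ ^ (-α)) (ν.prod ν) := by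
  obtain ⟨K, hK⟩ := (isCompact_closedBall (0 : Plane) C).exists_bound_of_continuousOn
    hg.continuousOn
  have hm : Measurable fun p : Plane × Plane => ‖p.1 - p.2‖ ^ (-α) :=
    (measurable_fst.sub measurable_snd).norm.pow_const _
  have h1 : Integrable (fun p : Plane × Plane => ‖p.1 - p.2‖ ^ (-α)) (ν.prod ν) := by
    rw [integrable_prod_iff hm.aestronglyMeasurable]
    refine ⟨ae_of_all _ fun x => integrable_riesz hν hα₀ (by linarith) x, ?_⟩
    refine (integrable_const (D * (rieszConst α * (1 : ℝ) ^ (2 - α)) +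
      1 ^ (-α) * ν.real univ)).mono'
      hm.norm.stronglyMeasurable.integral_prod_right.aestronglyMeasurable (ae_of_all _ fun x => ?_)
    rw [Real.norm_of_nonneg (integral_nonneg fun y => norm_nonneg _)]
    refine le_trans (le_of_eq ?_) (integral_riesz_le hD hν hα₀ (by linarith) one_pos x)
    exact integral_congr_ae (ae_of_all _ fun y =>
      Real.norm_of_nonneg (Real.rpow_nonneg (norm_nonneg _) _))
  refine (h1.const_mul K).mono' ?_ ?_
  · exact ((hg.measurable.comp measurable_fst).mul hm).aestronglyMeasurable
  · have h : ∀ᵐ p ∂ν.prod ν, ‖p.1‖ ≤ C := Measure.quasiMeasurePreserving_fst.ae hC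
    filter_upwards [h] with p hp
    rw [norm_mul, Real.norm_of_nonneg (Real.rpow_nonneg (norm_nonneg (p.1 - p.2)) _)]
    have := Real.rpow_nonneg (norm_nonneg (p.1 - p.2)) (-α)
    gcongr
    exact hK p.1 (by simpa using hp)

/-- The self-interaction of the outer part of a blob. -/
lemma integral_excess_outer_le (hα₀ : 0 < α) (hα₁ : α < 1) (hD : 0 ≤ D)
    (hν : ν ≤ ENNReal.ofReal D • volume) {C : ℝ} (hC : ∀ᵐ x ∂ν, ‖x‖ ≤ C) {R Q : ℝ} {n : ℕ}
    (hn : 2 ≤ n) (hQ : ∀ x, ∫ y, ‖x - y‖ ^ (-α) ∂ν ≤ Q) :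
    |∫ x, inner ℝ (excess R x ^ n • x) (measureVelocity α ν x) ∂ν| ≤
      |kernelConst α| * Q * ∫ x, excessHessian R n x ∂ν := by
  have hφ : Continuous fun x : Plane => excess R x ^ n • x :=
    ((continuous_excess R).pow n).smul continuous_id
  have hgc := continuous_excessHessian R n
  obtain ⟨K, hK⟩ := exists_bound_of_continuous hφ hC
  rw [integral_inner_measureVelocity hα₀ hα₁ hD hν hφ.measurable hK, abs_div, abs_two]
  have hi := integrable_prod_mul_riesz hα₀ hα₁ hD hν hgc hC
  have hswap : Integrable (fun p : Plane × Plane => excessHessian R n p.2 * ‖p.1 - p.2‖ ^ (-α))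
      (ν.prod ν) := by
    refine hi.swap.congr (ae_of_all _ fun p => ?_)
    simp only [Function.comp, Prod.fst_swap, Prod.snd_swap]
    rw [norm_sub_rev]
  have hval : ∫ p : Plane × Plane, excessHessian R n p.2 * ‖p.1 - p.2‖ ^ (-α) ∂ν.prod ν =
      ∫ p : Plane × Plane, excessHessian R n p.1 * ‖p.1 - p.2‖ ^ (-α) ∂ν.prod ν := by
    rw [← integral_prod_swap]
    refine integral_congr_ae (ae_of_all _ fun p => ?_)
    simp only [Prod.fst_swap, Prod.snd_swap]
    rw [norm_sub_rev]
  have h1 : |∫ p : Plane × Plane, inner ℝ (excess R p.1 ^ n • p.1 - excess R p.2 ^ n • p.2)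
      (kernel α (p.1 - p.2)) ∂ν.prod ν| ≤
      |kernelConst α| * (2 * ∫ p : Plane × Plane,
        excessHessian R n p.1 * ‖p.1 - p.2‖ ^ (-α) ∂ν.prod ν) := by
    have h2 : 2 * ∫ p : Plane × Plane, excessHessian R n p.1 * ‖p.1 - p.2‖ ^ (-α) ∂ν.prod ν =
        ∫ p : Plane × Plane, (excessHessian R n p.1 * ‖p.1 - p.2‖ ^ (-α) +
          excessHessian R n p.2 * ‖p.1 - p.2‖ ^ (-α)) ∂ν.prod ν := by
      rw [integral_add hi hswap, hval]
      ring
    rw [h2, ← integral_const_mul, ← Real.norm_eq_abs]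
    refine norm_integral_le_of_norm_le ((hi.add hswap).const_mul _) (ae_of_all _ fun p => ?_)
    refine (norm_inner_le_norm _ _).trans ?_
    rw [norm_kernel hα₀]
    have h3 := norm_excess_smul_sub_le (R := R) hn p.1 p.2
    rcases eq_or_ne (p.1 - p.2) 0 with h0 | h0
    · rw [h0, norm_zero, Real.zero_rpow (by linarith), mul_zero, mul_zero,
        Real.zero_rpow (by linarith)]
      simp
    · have hpos : 0 < ‖p.1 - p.2‖ := norm_pos_iff.2 h0
      -- This is the gain from symmetrization: the Lipschitz factor `‖p.1 - p.2‖` lowers the order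
      -- of the singularity from `1 + α` to `α`.
      have h4 : ‖p.1 - p.2‖ ^ (-α) = ‖p.1 - p.2‖ * ‖p.1 - p.2‖ ^ (-(1 + α)) := by
        rw [mul_comm, ← Real.rpow_add_one hpos.ne']
        congr 1
        ring
      have h5 := Real.rpow_nonneg (norm_nonneg (p.1 - p.2)) (-(1 + α))
      calc ‖excess R p.1 ^ n • p.1 - excess R p.2 ^ n • p.2‖ *
            (|kernelConst α| * ‖p.1 - p.2‖ ^ (-(1 + α)))
          ≤ ((excessHessian R n p.1 + excessHessian R n p.2) * ‖p.1 - p.2‖) *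
            (|kernelConst α| * ‖p.1 - p.2‖ ^ (-(1 + α))) := by gcongr
        _ = _ := by rw [h4]; ring
  have h6 : ∫ p : Plane × Plane, excessHessian R n p.1 * ‖p.1 - p.2‖ ^ (-α) ∂ν.prod ν ≤
      Q * ∫ x, excessHessian R n x ∂ν := by
    rw [integral_prod _ hi, ← integral_const_mul]
    refine integral_mono hi.integral_prod_left
      ((integrable_of_continuous_of_bounded hgc hC).const_mul Q) fun x => ?_
    simp only
    rw [integral_const_mul, mul_comm]
    exact mul_le_mul_of_nonneg_right (hQ x) (excessHessian_nonneg R n x)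
  have h7 := mul_le_mul_of_nonneg_left h6 (abs_nonneg (kernelConst α))
  linarith

/-- The self-interaction contributes little to the growth of the moments of the excess. -/
lemma integral_excess_self_le (hα₀ : 0 < α) (hα₁ : α < 1) (hD : 0 ≤ D)
    (hν : ν ≤ ENNReal.ofReal D • volume) {C : ℝ} (hC : ∀ᵐ x ∂ν, ‖x‖ ≤ C)
    (hcenter : ∫ x, x ∂ν = 0) {R Q q : ℝ} (hR : 0 < R) {n : ℕ} (hn : 2 ≤ n)
    (hcore : coreConst α * R ^ (-(2 + α)) * ∫ y, ‖y‖ ^ 2 ∂ν ≤ q)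
    (hQ : ∀ x, ∫ y in {y | R / 2 ≤ ‖y‖}, ‖x - y‖ ^ (-α) ∂ν ≤ Q) (hQq : |kernelConst α| * Q ≤ q) :
    |∫ x, inner ℝ (excess R x ^ n • x) (measureVelocity α ν x) ∂ν| ≤
      q * ∫ x, (excess R x ^ n + excessHessian R n x) ∂ν := by
  set E : Set Plane := {y | R / 2 ≤ ‖y‖} with hEdef
  have hE : MeasurableSet E := measurableSet_le measurable_const measurable_norm
  have hφ : Continuous fun x : Plane => excess R x ^ n • x :=
    ((continuous_excess R).pow n).smul continuous_id
  obtain ⟨K, hK⟩ := exists_bound_of_continuous hφ hC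
  have hs : Integrable (fun x => excess R x ^ n) ν :=
    integrable_of_continuous_of_bounded ((continuous_excess R).pow n) hC
  have hg : Integrable (excessHessian R n) ν :=
    integrable_of_continuous_of_bounded (continuous_excessHessian R n) hC
  have hνE : ν.restrict E ≤ ENNReal.ofReal D • volume := Measure.restrict_le_self.trans hν
  have hνc : ν.restrict Eᶜ ≤ ENNReal.ofReal D • volume := Measure.restrict_le_self.trans hν
  have hsplit : ∀ x, measureVelocity α ν x =
      measureVelocity α (ν.restrict Eᶜ) x + measureVelocity α (ν.restrict E) x := fun x => by
    rw [add_comm]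
    exact (integral_add_compl hE (integrable_kernel hα₀ hα₁ hν x)).symm
  have hint : ∀ μ' : Measure Plane, [IsFiniteMeasure μ'] → μ' ≤ ENNReal.ofReal D • volume →
      Integrable (fun x => inner ℝ (excess R x ^ n • x) (measureVelocity α μ' x)) ν := by
    intro μ' _ hμ'
    refine (integrable_const (K * (|kernelConst α| * (D * (rieszConst (1 + α) * 1 ^ (1 - α)) +
      1 ^ (-(1 + α)) * μ'.real univ)))).mono' ?_ ?_
    · exact (hφ.stronglyMeasurable.inner
        (stronglyMeasurable_measureVelocity hα₀)).aestronglyMeasurable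
    · filter_upwards [hK] with x hx
      refine (norm_inner_le_norm _ _).trans ?_
      have := norm_measureVelocity_le hα₀ hα₁ hD hμ' one_pos x
      exact mul_le_mul hx this (norm_nonneg _) ((norm_nonneg _).trans hx)
  have h1 : |∫ x, inner ℝ (excess R x ^ n • x) (measureVelocity α (ν.restrict Eᶜ) x) ∂ν| ≤
      q * ∫ x, excess R x ^ n ∂ν := by
    rw [← integral_const_mul, ← Real.norm_eq_abs]
    refine norm_integral_le_of_norm_le (hs.const_mul q) (ae_of_all _ fun x => ?_)
    rw [real_inner_smul_left, mul_comm, norm_mul, Real.norm_eq_abs,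
      Real.norm_of_nonneg (pow_nonneg (excess_nonneg R x) n)]
    rcases le_total ‖x‖ R with hx | hx
    · rw [excess_eq_zero hx]
      simp [show n ≠ 0 by omega]
    · have h2 := abs_integral_core_le hα₀ hα₁ hν hC hcenter hR hx
      exact mul_le_mul_of_nonneg_right (h2.trans hcore) (pow_nonneg (excess_nonneg R x) n)
  have h4 : |∫ x, inner ℝ (excess R x ^ n • x) (measureVelocity α (ν.restrict E) x) ∂ν| ≤
      q * ∫ x, excessHessian R n x ∂ν := by
    -- The excess vanishes off `E`, so the field of the outer part is tested against the outer part
    -- alone and can be symmetrized within it.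
    have h5 : ∫ x, inner ℝ (excess R x ^ n • x) (measureVelocity α (ν.restrict E) x) ∂ν =
        ∫ x in E, inner ℝ (excess R x ^ n • x) (measureVelocity α (ν.restrict E) x) ∂ν := by
      refine (setIntegral_eq_integral_of_forall_compl_eq_zero fun x hx => ?_).symm
      have hx : ‖x‖ < R / 2 := not_le.1 hx
      rw [excess_eq_zero (by linarith)]
      simp [show n ≠ 0 by omega]
    rw [h5]
    refine (integral_excess_outer_le hα₀ hα₁ hD hνE (ae_restrict_of_ae hC) hn hQ).trans ?_
    have h6 : ∫ x in E, excessHessian R n x ∂ν ≤ ∫ x, excessHessian R n x ∂ν :=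
      setIntegral_le_integral hg (ae_of_all _ fun x => excessHessian_nonneg R n x)
    have h7 : 0 ≤ ∫ x in E, excessHessian R n x ∂ν :=
      integral_nonneg fun x => excessHessian_nonneg R n x
    have hq0 : 0 ≤ q := le_trans (by
      have := coreConst_nonneg hα₀
      have := Real.rpow_nonneg hR.le (-(2 + α))
      positivity) hcore
    exact mul_le_mul hQq h6 h7 hq0
  simp only [hsplit, inner_add_right]
  rw [integral_add (hint _ hνc) (hint _ hνE), integral_add hs hg, mul_add]
  exact (abs_add_le _ _).trans (add_le_add h1 h4)

/-- Young's inequality at the scale `w` converts both `q excess^n` and `q R² excess^(n-1)` into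
`excess^(n+1) + w^(n+1)`, which closes the differential inequality for a single moment. The
coefficients add up to `1 + (1 + 2n) + 2n = 4n + 2`. -/
lemma integral_excess_self_le_moment (hα₀ : 0 < α) (hα₁ : α < 1) (hD : 0 ≤ D)
    (hν : ν ≤ ENNReal.ofReal D • volume) {C : ℝ} (hC : ∀ᵐ x ∂ν, ‖x‖ ≤ C)
    (hcenter : ∫ x, x ∂ν = 0) {R Q q w : ℝ} (hR : 0 < R) {n : ℕ} (hn : 2 ≤ n)
    (hcore : coreConst α * R ^ (-(2 + α)) * ∫ y, ‖y‖ ^ 2 ∂ν ≤ q)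
    (hQ : ∀ x, ∫ y in {y | R / 2 ≤ ‖y‖}, ‖x - y‖ ^ (-α) ∂ν ≤ Q) (hQq : |kernelConst α| * Q ≤ q)
    (hw : 0 ≤ w) (hqw : q ≤ w) (hqR : q * R ^ 2 ≤ w ^ 2) :
    |∫ x, inner ℝ (excess R x ^ n • x) (measureVelocity α ν x) ∂ν| ≤
      (4 * n + 2) * (∫ x, excess R x ^ (n + 1) ∂ν + w ^ (n + 1) * ν.real univ) := by
  have hi : ∀ k, Integrable (fun x => excess R x ^ k) ν := fun k =>
    integrable_of_continuous_of_bounded ((continuous_excess R).pow k) hC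
  have hg : Integrable (excessHessian R n) ν :=
    integrable_of_continuous_of_bounded (continuous_excessHessian R n) hC
  refine (integral_excess_self_le hα₀ hα₁ hD hν hC hcenter hR hn hcore hQ hQq).trans ?_
  have h1 : ∫ x, excess R x ^ (n + 1) ∂ν + w ^ (n + 1) * ν.real univ =
      ∫ x, (excess R x ^ (n + 1) + w ^ (n + 1)) ∂ν := by
    rw [integral_add (hi _) (integrable_const _), integral_const, smul_eq_mul, mul_comm (w ^ _)]
  rw [h1, ← integral_const_mul, ← integral_const_mul]
  refine integral_mono (((hi n).add hg).const_mul q)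
    (((hi _).add (integrable_const _)).const_mul _) fun x => ?_
  have h2 := mul_pow_le_pow_add_pow (q := q) (n := n) (k := 1) (excess_nonneg R x) hw
      (by simpa using hqw)
  have h3 := mul_pow_le_pow_add_pow (q := q * R ^ 2) (n := n - 1) (k := 2) (excess_nonneg R x) hw
      hqR
  rw [show n - 1 + 2 = n + 1 by omega] at h3
  simp only [excessHessian]
  have hn0 : (0 : ℝ) ≤ n := by positivity
  nlinarith

end Static

/-! ### Differentiation under the integral, Gronwall and barrier arguments. -/

section Calculus

lemma hasDerivWithinAt_Ici_of_Icc {E : Type*} [NormedAddCommGroup E] [NormedSpace ℝ E]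
    {f : ℝ → E} {f' : E} {b t : ℝ} (h : HasDerivWithinAt f f' (Icc 0 b) t) (ht : t ∈ Ico 0 b) :
    HasDerivWithinAt f f' (Ici t) t :=
  h.mono_of_mem_nhdsWithin (Icc_mem_nhdsGE_of_mem ht)

/-- Differentiation under the integral sign on a closed time interval. -/
lemma hasDerivWithinAt_integral {Ω E : Type*} [MeasurableSpace Ω] [NormedAddCommGroup E]
    [NormedSpace ℝ E] {μ : Measure Ω} [IsFiniteMeasure μ] {b C : ℝ} {g g' : ℝ → Ω → E}
    {S : Set Ω} (hS : ∀ᵐ y ∂μ, y ∈ S) (hg : ∀ t ∈ Icc 0 b, Integrable (g t) μ)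
    (hd : ∀ y ∈ S, ∀ t ∈ Icc 0 b, HasDerivWithinAt (fun t => g t y) (g' t y) (Icc 0 b) t)
    (hC : ∀ y ∈ S, ∀ t ∈ Icc 0 b, ‖g' t y‖ ≤ C) {t : ℝ} (ht : t ∈ Icc 0 b) :
    HasDerivWithinAt (fun t => ∫ y, g t y ∂μ) (∫ y, g' t y ∂μ) (Icc 0 b) t := by
  rw [hasDerivWithinAt_iff_tendsto_slope]
  have hmem : ∀ᶠ s in nhdsWithin t (Icc 0 b \ {t}), s ∈ Icc 0 b \ {t} := self_mem_nhdsWithin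
  have h1 : Filter.Tendsto (fun s => ∫ y, slope (fun t => g t y) t s ∂μ)
      (nhdsWithin t (Icc 0 b \ {t})) (nhds (∫ y, g' t y ∂μ)) := by
    refine tendsto_integral_filter_of_dominated_convergence (fun _ => C) ?_ ?_
      (integrable_const C) ?_
    · filter_upwards [hmem] with s hs
      simp only [slope_def_module]
      exact (((hg s hs.1).sub (hg t ht)).smul _).aestronglyMeasurable
    · filter_upwards [hmem] with s hs
      filter_upwards [hS] with y hy
      have h2 := Convex.norm_image_sub_le_of_norm_hasDerivWithin_le (hd y hy) (hC y hy)
        (convex_Icc 0 b) ht hs.1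
      have h3 : 0 < ‖s - t‖ := norm_pos_iff.2 (sub_ne_zero.2 hs.2)
      rw [slope_def_module, norm_smul, norm_inv, inv_mul_le_iff₀ h3, mul_comm]
      exact h2
    · filter_upwards [hS] with y hy
      exact hasDerivWithinAt_iff_tendsto_slope.1 (hd y hy t ht)
  refine h1.congr' ?_
  filter_upwards [hmem] with s hs
  simp only [slope_def_module]
  rw [integral_smul, integral_sub (hg s hs.1) (hg t ht)]

/-- Gronwall: `(f + e) exp(-C t)` has nonpositive derivative. No signs are required of `f`, `C` or
`e`. -/
lemma le_mul_exp_of_deriv_le {f f' : ℝ → ℝ} {b C e : ℝ}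
    (hf : ∀ t ∈ Icc 0 b, HasDerivWithinAt f (f' t) (Icc 0 b) t)
    (hle : ∀ t ∈ Icc 0 b, f' t ≤ C * (f t + e)) {t : ℝ} (ht : t ∈ Icc 0 b) :
    f t + e ≤ (f 0 + e) * Real.exp (C * t) := by
  have hexp : ∀ s, HasDerivAt (fun s => Real.exp (-(C * s))) (Real.exp (-(C * s)) * -(C * 1)) s :=
    fun s => (((hasDerivAt_id s).const_mul C).neg).exp
  have hprod : ∀ s ∈ Icc 0 b, HasDerivWithinAt (fun s => (f s + e) * Real.exp (-(C * s)))
      (f' s * Real.exp (-(C * s)) + (f s + e) * (Real.exp (-(C * s)) * -(C * 1))) (Icc 0 b) s :=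
    fun s hs => ((hf s hs).add_const e).mul (hexp s).hasDerivWithinAt
  have h1 := image_le_of_deriv_right_le_deriv_boundary (a := 0) (b := b)
    (f := fun s => (f s + e) * Real.exp (-(C * s))) (B := fun _ => f 0 + e) (B' := fun _ => 0)
    (fun s hs => (hprod s hs).continuousWithinAt)
    (fun s hs => hasDerivWithinAt_Ici_of_Icc (hprod s (Ico_subset_Icc_self hs)) hs)
    (by simp) continuousOn_const (fun s _ => hasDerivWithinAt_const _ _ _)
    (fun s hs => by
      have h2 := hle s (Ico_subset_Icc_self hs)
      have h3 := Real.exp_pos (-(C * s))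
      nlinarith) ht
  simp only [Real.exp_neg] at h1
  rwa [← div_eq_mul_inv, div_le_iff₀ (Real.exp_pos _)] at h1

lemma le_of_barrier {f f' B B' : ℝ → ℝ} {b : ℝ}
    (hf : ∀ t ∈ Icc 0 b, HasDerivWithinAt f (f' t) (Icc 0 b) t)
    (hB : ∀ t ∈ Icc 0 b, HasDerivWithinAt B (B' t) (Icc 0 b) t) (h0 : f 0 ≤ B 0)
    (hlt : ∀ t ∈ Icc 0 b, f t = B t → f' t < B' t) {t : ℝ} (ht : t ∈ Icc 0 b) : f t ≤ B t :=
  image_le_of_deriv_right_lt_deriv_boundary' (fun s hs => (hf s hs).continuousWithinAt)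
    (fun s hs => hasDerivWithinAt_Ici_of_Icc (hf s (Ico_subset_Icc_self hs)) hs) h0
    (fun s hs => (hB s hs).continuousWithinAt)
    (fun s hs => hasDerivWithinAt_Ici_of_Icc (hB s (Ico_subset_Icc_self hs)) hs)
    (fun s hs => hlt s (Ico_subset_Icc_self hs)) ht

/-- A power at least two of the positive part is differentiable. -/
lemma hasDerivAt_max_zero_pow (n : ℕ) (x : ℝ) :
    HasDerivAt (fun x : ℝ => max x 0 ^ (n + 2)) ((n + 2) * max x 0 ^ (n + 1)) x := by
  rcases lt_trichotomy x 0 with h | rfl | h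
  · have h1 : (fun x : ℝ => max x 0 ^ (n + 2)) =ᶠ[nhds x] fun _ => 0 := by
      filter_upwards [eventually_lt_nhds h] with y hy
      simp [max_eq_right hy.le]
    rw [max_eq_right h.le]
    simpa using (hasDerivAt_const x (0 : ℝ)).congr_of_eventuallyEq h1
  · rw [max_self, zero_pow (by omega), mul_zero, hasDerivAt_iff_isLittleO]
    simp only [max_self, sub_zero, smul_zero]
    have h1 : (fun x : ℝ => max x 0 ^ (n + 2) - 0 ^ (n + 2)) =O[nhds 0]
        fun x : ℝ => x ^ (n + 2) := by
      refine Asymptotics.IsBigO.of_bound 1 (Filter.Eventually.of_forall fun y => ?_)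
      rw [zero_pow (by omega), sub_zero, one_mul, norm_pow, norm_pow]
      gcongr
      rw [Real.norm_of_nonneg (le_max_right _ _)]
      exact max_le (Real.le_norm_self y) (norm_nonneg y)
    refine h1.trans_isLittleO ?_
    simpa using Asymptotics.isLittleO_pow_pow (𝕜 := ℝ) (show 1 < n + 2 by omega)
  · have h1 : (fun x : ℝ => max x 0 ^ (n + 2)) =ᶠ[nhds x] fun x => x ^ (n + 2) := by
      filter_upwards [eventually_gt_nhds h] with y hy
      rw [max_eq_left hy.le]
    rw [max_eq_left h.le]
    have := (hasDerivAt_pow (n + 2) x).congr_of_eventuallyEq h1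
    simpa using this

end Calculus

/-! ### Blobs in Lagrangian form, the external field and the second moments. -/

/-- A system of blobs on the time interval `[0, b]`, in Lagrangian form: the blob `i` is the image
of the measure `σ i • μ i`, which lives on `Λ i`, under the motion `Φ`, and it stays within a
quarter of the minimal distance `d` of the pseudo-vortices from the pseudo-vortex `z i`. -/
structure BlobSystem (α d D ε b : ℝ) {N : ℕ} (a : Fin N → ℝ) (z : Fin N → ℝ → Plane)
    (μ : Fin N → Measure Plane) (σ : Fin N → ℝ) (Φ : ℝ → Plane → Plane)
    (Λ : Fin N → Set Plane) : Prop where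
  alpha_pos : 0 < α
  alpha_lt_one : α < 1
  d_pos : 0 < d
  D_nonneg : 0 ≤ D
  eps_pos : 0 < ε
  finite : ∀ i, IsFiniteMeasure (μ i)
  sign : ∀ i, |σ i| = 1
  mass : ∀ i, σ i * (μ i).real univ = a i
  mem_support : ∀ i, ∀ᵐ y ∂μ i, y ∈ Λ i
  measurable : ∀ t ∈ Icc 0 b, Measurable (Φ t)
  density : ∀ t ∈ Icc 0 b, ∀ i, (μ i).map (Φ t) ≤ ENNReal.ofReal D • volume
  initial : ∀ i, ∀ y ∈ Λ i, dist (Φ 0 y) (z i 0) ≤ ε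
  trajectory : ∀ i, ∀ y ∈ Λ i, ∀ t ∈ Icc 0 b, HasDerivWithinAt (fun s => Φ s y)
    (∑ j, σ j • measureVelocity α ((μ j).map (Φ t)) (Φ t y)) (Icc 0 b) t
  close : ∀ i, ∀ y ∈ Λ i, ∀ t ∈ Icc 0 b, dist (Φ t y) (z i t) ≤ d / 4
  motion : ∀ i, ∀ t ∈ Icc 0 b, HasDerivWithinAt (z i)
    (∑ j ∈ Finset.univ.erase i, a j • kernel α (z i t - z j t)) (Icc 0 b) t
  separated : ∀ t ∈ Icc 0 b, ∀ i j, i ≠ j → d ≤ dist (z i t) (z j t)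

/-- The Lipschitz constant of the kernel at distances at least `d / 2` from its singularity. -/
def kernelLip (α d : ℝ) : ℝ := |kernelConst α| * (3 + α) * (d / 2) ^ (-(2 + α))

/-- The field felt by the blob `i`. -/
def externalField (α : ℝ) {N : ℕ} (μ : Fin N → Measure Plane) (σ : Fin N → ℝ)
    (Φ : ℝ → Plane → Plane) (i : Fin N) (t : ℝ) (x : Plane) : Plane :=
  ∑ j ∈ Finset.univ.erase i, σ j • measureVelocity α ((μ j).map (Φ t)) x

/-- The total second moment of the blobs with respect to the pseudo-vortices. -/
def totalMoment {N : ℕ} (z : Fin N → ℝ → Plane) (μ : Fin N → Measure Plane)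
    (Φ : ℝ → Plane → Plane) (t : ℝ) : ℝ :=
  ∑ i, ∫ y, ‖Φ t y - z i t‖ ^ 2 ∂μ i

lemma sum_abs_erase_le {N : ℕ} (a : Fin N → ℝ) (i : Fin N) :
    ∑ j ∈ Finset.univ.erase i, |a j| ≤ ∑ j, |a j| :=
  Finset.sum_le_sum_of_subset_of_nonneg (Finset.erase_subset _ _) fun _ _ _ => abs_nonneg _

lemma velocity_eq {N : ℕ} (α : ℝ) (μ : Fin N → Measure Plane) (σ : Fin N → ℝ)
    (Φ : ℝ → Plane → Plane) (t : ℝ) (i : Fin N) (x : Plane) :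
    ∑ j, σ j • measureVelocity α ((μ j).map (Φ t)) x =
      σ i • measureVelocity α ((μ i).map (Φ t)) x + externalField α μ σ Φ i t x :=
  (Finset.add_sum_erase _ _ (Finset.mem_univ i)).symm

namespace BlobSystem

variable {α d D ε b : ℝ} {N : ℕ} {a : Fin N → ℝ} {z : Fin N → ℝ → Plane}
  {μ : Fin N → Measure Plane} {σ : Fin N → ℝ} {Φ : ℝ → Plane → Plane} {Λ : Fin N → Set Plane}

lemma kernelLip_nonneg (h : BlobSystem α d D ε b a z μ σ Φ Λ) :
    0 ≤ kernelLip α d := by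
  have := h.alpha_pos
  have := h.d_pos
  unfold kernelLip
  positivity

lemma real_univ (h : BlobSystem α d D ε b a z μ σ Φ Λ)
    (i : Fin N) : (μ i).real univ = |a i| := by
  rw [← h.mass i, abs_mul, h.sign, one_mul, abs_of_nonneg measureReal_nonneg]

lemma real_map_univ (h : BlobSystem α d D ε b a z μ σ Φ Λ)
    {t : ℝ} (ht : t ∈ Icc 0 b) (i : Fin N) :
    ((μ i).map (Φ t)).real univ = |a i| := by
  rw [← h.real_univ i, measureReal_def, Measure.map_apply (h.measurable t ht) MeasurableSet.univ,
    preimage_univ, measureReal_def]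

lemma ae_map (h : BlobSystem α d D ε b a z μ σ Φ Λ)
    {t : ℝ} (ht : t ∈ Icc 0 b) (i : Fin N) :
    ∀ᵐ x ∂(μ i).map (Φ t), ‖x - z i t‖ ≤ d / 4 := by
  rw [ae_map_iff (h.measurable t ht).aemeasurable
    (measurableSet_le (by fun_prop) measurable_const)]
  filter_upwards [h.mem_support i] with y hy
  rw [← dist_eq_norm]
  exact h.close i y hy t ht

lemma ae_map_norm_le (h : BlobSystem α d D ε b a z μ σ Φ Λ)
    {t : ℝ} (ht : t ∈ Icc 0 b) (i : Fin N) :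
    ∀ᵐ x ∂(μ i).map (Φ t), ‖x‖ ≤ d / 4 + ‖z i t‖ := by
  filter_upwards [h.ae_map ht i] with x hx
  have := norm_sub_norm_le x (z i t)
  linarith

lemma half_le_norm_sub (h : BlobSystem α d D ε b a z μ σ Φ Λ)
    {t : ℝ} (ht : t ∈ Icc 0 b) {i j : Fin N} (hij : i ≠ j) {x w : Plane}
    (hx : ‖x - z i t‖ ≤ d / 4) (hw : ‖w - z j t‖ ≤ d / 4) : d / 2 ≤ ‖x - w‖ := by
  have h1 := h.separated t ht i j hij
  rw [dist_eq_norm] at h1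
  have h2 : z i t - z j t = (x - w) - (x - z i t) + (w - z j t) := by abel
  have h3 := norm_add_le ((x - w) - (x - z i t)) (w - z j t)
  have h4 := norm_sub_le (x - w) (x - z i t)
  rw [← h2] at h3
  linarith

lemma norm_measureVelocity_sub_le (h : BlobSystem α d D ε b a z μ σ Φ Λ)
    {t : ℝ} (ht : t ∈ Icc 0 b) {i j : Fin N} (hij : i ≠ j)
    {x x' : Plane} (hx : ‖x - z i t‖ ≤ d / 4) (hx' : ‖x' - z i t‖ ≤ d / 4) :
    ‖measureVelocity α ((μ j).map (Φ t)) x - measureVelocity α ((μ j).map (Φ t)) x'‖ ≤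
      kernelLip α d * |a j| * ‖x - x'‖ := by
  have := h.finite j
  have hK := integrable_kernel h.alpha_pos h.alpha_lt_one (h.density t ht j)
  rw [measureVelocity, measureVelocity, ← integral_sub (hK x) (hK x'), ← h.real_map_univ ht j]
  have h1 : ∀ᵐ w ∂(μ j).map (Φ t), ‖kernel α (x - w) - kernel α (x' - w)‖ ≤
      kernelLip α d * ‖x - x'‖ := by
    filter_upwards [h.ae_map ht j] with w hw
    have h2 := kernel_lipschitz h.alpha_pos (half_pos h.d_pos) (h.half_le_norm_sub ht hij hx hw)
      (h.half_le_norm_sub ht hij hx' hw)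
    rwa [sub_sub_sub_cancel_right] at h2
  refine (norm_integral_le_of_norm_le_const h1).trans_eq ?_
  ring

lemma norm_externalField_sub_le (h : BlobSystem α d D ε b a z μ σ Φ Λ)
    {t : ℝ} (ht : t ∈ Icc 0 b) {i : Fin N} {x x' : Plane}
    (hx : ‖x - z i t‖ ≤ d / 4) (hx' : ‖x' - z i t‖ ≤ d / 4) :
    ‖externalField α μ σ Φ i t x - externalField α μ σ Φ i t x'‖ ≤
      kernelLip α d * (∑ j, |a j|) * ‖x - x'‖ := by
  have hL := h.kernelLip_nonneg
  unfold externalField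
  rw [← Finset.sum_sub_distrib]
  calc ‖∑ j ∈ Finset.univ.erase i, (σ j • measureVelocity α ((μ j).map (Φ t)) x -
        σ j • measureVelocity α ((μ j).map (Φ t)) x')‖
      ≤ ∑ j ∈ Finset.univ.erase i, kernelLip α d * |a j| * ‖x - x'‖ := by
        refine norm_sum_le_of_le _ fun j hj => ?_
        rw [← smul_sub, norm_smul, Real.norm_eq_abs, h.sign, one_mul]
        exact h.norm_measureVelocity_sub_le ht (Finset.ne_of_mem_erase hj).symm hx hx'
    _ = kernelLip α d * (∑ j ∈ Finset.univ.erase i, |a j|) * ‖x - x'‖ := by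
        rw [Finset.mul_sum, Finset.sum_mul]
    _ ≤ _ := by
        have := sum_abs_erase_le a i
        exact mul_le_mul_of_nonneg_right (mul_le_mul_of_nonneg_left this hL) (norm_nonneg _)

lemma integrable_comp (h : BlobSystem α d D ε b a z μ σ Φ Λ)
    {t : ℝ} (ht : t ∈ Icc 0 b) (i : Fin N) {f : Plane → ℝ}
    (hf : Continuous f) : Integrable f ((μ i).map (Φ t)) := by
  have := h.finite i
  exact integrable_of_continuous_of_bounded hf (h.ae_map_norm_le ht i)

/-- The velocity due to the pseudo-vortex `j` is the integral of a constant over the blob `j`, whose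
signed mass is `a j`. The difference is thus an integral of kernel increments at distance at least
`d / 2` from the singularity. -/
lemma norm_velocity_sub_vortex_le (h : BlobSystem α d D ε b a z μ σ Φ Λ)
    {t : ℝ} (ht : t ∈ Icc 0 b) {i j : Fin N} (hij : i ≠ j)
    {x : Plane} (hx : ‖x - z i t‖ ≤ d / 4) :
    ‖σ j • measureVelocity α ((μ j).map (Φ t)) x - a j • kernel α (z i t - z j t)‖ ≤
      kernelLip α d * (|a j| * ‖x - z i t‖ + ∫ w, ‖w - z j t‖ ∂(μ j).map (Φ t)) := by
  have := h.finite j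
  have hK := integrable_kernel h.alpha_pos h.alpha_lt_one (h.density t ht j) x
  have hd := h.d_pos
  have hn : Integrable (fun w => ‖w - z j t‖) ((μ j).map (Φ t)) :=
    h.integrable_comp ht j (by fun_prop)
  have h1 : a j • kernel α (z i t - z j t) =
      σ j • ∫ _w, kernel α (z i t - z j t) ∂(μ j).map (Φ t) := by
    have hm : ((μ j).map (Φ t)).real univ = (μ j).real univ := by
      rw [h.real_map_univ ht, h.real_univ]
    rw [integral_const, smul_smul, hm, h.mass]
  rw [h1, ← smul_sub, norm_smul, Real.norm_eq_abs, h.sign, one_mul, measureVelocity,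
    ← integral_sub hK (integrable_const _)]
  have h2 : kernelLip α d * (|a j| * ‖x - z i t‖ + ∫ w, ‖w - z j t‖ ∂(μ j).map (Φ t)) =
      ∫ w, kernelLip α d * (‖x - z i t‖ + ‖w - z j t‖) ∂(μ j).map (Φ t) := by
    rw [integral_const_mul, integral_add (integrable_const _) hn, integral_const, smul_eq_mul,
      h.real_map_univ ht]
  rw [h2]
  refine norm_integral_le_of_norm_le (((integrable_const _).add hn).const_mul _) ?_
  filter_upwards [h.ae_map ht j] with w hw
  have h3 := kernel_lipschitz h.alpha_pos (half_pos hd) (h.half_le_norm_sub ht hij hx hw)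
    (h.half_le_norm_sub ht hij (x := z i t) (w := z j t) (by simp; linarith) (by simp; linarith))
  refine h3.trans ?_
  have hL := h.kernelLip_nonneg
  change kernelLip α d * _ ≤ _
  gcongr
  calc ‖x - w - (z i t - z j t)‖ = ‖(x - z i t) - (w - z j t)‖ := by congr 1; abel
    _ ≤ _ := norm_sub_le _ _

/-- The field felt by a blob differs little from the velocity of its pseudo-vortex. -/
lemma norm_externalField_sub_vortex_le (h : BlobSystem α d D ε b a z μ σ Φ Λ)
    {t : ℝ} (ht : t ∈ Icc 0 b) {i : Fin N} {x : Plane}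
    (hx : ‖x - z i t‖ ≤ d / 4) :
    ‖externalField α μ σ Φ i t x - ∑ j ∈ Finset.univ.erase i, a j • kernel α (z i t - z j t)‖ ≤
      kernelLip α d * ((∑ j, |a j|) * ‖x - z i t‖ +
        ∑ j, ∫ w, ‖w - z j t‖ ∂(μ j).map (Φ t)) := by
  have hL := h.kernelLip_nonneg
  unfold externalField
  rw [← Finset.sum_sub_distrib]
  calc ‖∑ j ∈ Finset.univ.erase i, (σ j • measureVelocity α ((μ j).map (Φ t)) x -
        a j • kernel α (z i t - z j t))‖
      ≤ ∑ j ∈ Finset.univ.erase i,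
          kernelLip α d * (|a j| * ‖x - z i t‖ + ∫ w, ‖w - z j t‖ ∂(μ j).map (Φ t)) :=
        norm_sum_le_of_le _ fun j hj =>
          h.norm_velocity_sub_vortex_le ht (Finset.ne_of_mem_erase hj).symm hx
    _ ≤ ∑ j, kernelLip α d * (|a j| * ‖x - z i t‖ + ∫ w, ‖w - z j t‖ ∂(μ j).map (Φ t)) := by
        refine Finset.sum_le_sum_of_subset_of_nonneg (Finset.erase_subset _ _) fun j _ _ => ?_
        have : 0 ≤ ∫ w, ‖w - z j t‖ ∂(μ j).map (Φ t) := integral_nonneg fun w => norm_nonneg _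
        positivity
    _ = _ := by rw [← Finset.mul_sum, Finset.sum_add_distrib, Finset.sum_mul]

/-- A uniform bound for the velocity. -/
lemma norm_velocity_le (h : BlobSystem α d D ε b a z μ σ Φ Λ)
    {t : ℝ} (ht : t ∈ Icc 0 b) (x : Plane) (s : Finset (Fin N)) :
    ‖∑ j ∈ s, σ j • measureVelocity α ((μ j).map (Φ t)) x‖ ≤
      ∑ j, |kernelConst α| * (D * (rieszConst (1 + α) * 1 ^ (1 - α)) +
        1 ^ (-(1 + α)) * |a j|) := by
  have hα := h.alpha_lt_one
  have hr := rieszConst_nonneg (γ := 1 + α) (by linarith)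
  have hD := h.D_nonneg
  refine (norm_sum_le_of_le s (f := fun j => σ j • measureVelocity α ((μ j).map (Φ t)) x)
    fun j _ => ?_).trans (Finset.sum_le_sum_of_subset_of_nonneg
      (f := fun j => |kernelConst α| * (D * (rieszConst (1 + α) * 1 ^ (1 - α)) +
        1 ^ (-(1 + α)) * |a j|)) (Finset.subset_univ s) fun j _ _ => by positivity)
  have := h.finite j
  rw [norm_smul, Real.norm_eq_abs, h.sign, one_mul, ← h.real_map_univ ht j]
  exact norm_measureVelocity_le h.alpha_pos hα hD (h.density t ht j) one_pos x

lemma exists_vortexVelocity_bound (h : BlobSystem α d D ε b a z μ σ Φ Λ)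
    (i : Fin N) : ∃ C, ∀ t ∈ Icc 0 b,
    ‖∑ j ∈ Finset.univ.erase i, a j • kernel α (z i t - z j t)‖ ≤ C := by
  refine ⟨∑ j ∈ Finset.univ.erase i, |a j| * (|kernelConst α| * d ^ (-(1 + α))),
    fun t ht => norm_sum_le_of_le _ fun j hj => ?_⟩
  have h1 := h.separated t ht i j (Finset.ne_of_mem_erase hj).symm
  have hα := h.alpha_pos
  rw [dist_eq_norm] at h1
  rw [norm_smul, Real.norm_eq_abs, norm_kernel hα]
  have := Real.rpow_le_rpow_of_nonpos h.d_pos h1 (show -(1 + α) ≤ 0 by linarith)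
  gcongr

lemma stronglyMeasurable_externalField (h : BlobSystem α d D ε b a z μ σ Φ Λ)
    (i : Fin N) (t : ℝ) :
    StronglyMeasurable (externalField α μ σ Φ i t) := by
  unfold externalField
  refine Finset.stronglyMeasurable_fun_sum _ fun j _ => ?_
  have := h.finite j
  exact (stronglyMeasurable_measureVelocity (ν := (μ j).map (Φ t)) h.alpha_pos).const_smul (σ j)

lemma integrable_externalField (h : BlobSystem α d D ε b a z μ σ Φ Λ)
    {t : ℝ} (ht : t ∈ Icc 0 b) (i k : Fin N) :
    Integrable (externalField α μ σ Φ i t) ((μ k).map (Φ t)) := by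
  have := h.finite k
  exact (integrable_const (∑ j, |kernelConst α| * (D * (rieszConst (1 + α) * 1 ^ (1 - α)) +
    1 ^ (-(1 + α)) * |a j|))).mono' (h.stronglyMeasurable_externalField i t).aestronglyMeasurable
    (ae_of_all _ fun x => h.norm_velocity_le ht x _)

lemma integral_comp_eq (h : BlobSystem α d D ε b a z μ σ Φ Λ)
    {E : Type*} [NormedAddCommGroup E] [NormedSpace ℝ E] {t : ℝ}
    (ht : t ∈ Icc 0 b) (i : Fin N) {f : Plane → E} (hf : StronglyMeasurable f) :
    ∫ y, f (Φ t y) ∂μ i = ∫ x, f x ∂(μ i).map (Φ t) :=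
  (integral_map (h.measurable t ht).aemeasurable hf.aestronglyMeasurable).symm

lemma totalMoment_eq (h : BlobSystem α d D ε b a z μ σ Φ Λ)
    {t : ℝ} (ht : t ∈ Icc 0 b) :
    totalMoment z μ Φ t = ∑ i, ∫ x, ‖x - z i t‖ ^ 2 ∂(μ i).map (Φ t) := by
  refine Finset.sum_congr rfl fun i _ => ?_
  exact h.integral_comp_eq ht i (f := fun x => ‖x - z i t‖ ^ 2)
    (by fun_prop : Continuous fun x : Plane => ‖x - z i t‖ ^ 2).stronglyMeasurable

/-- Cauchy–Schwarz over all blobs at once, with total mass `∑ j, |a j|`: the integral of `(τ - ‖w -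
z j t‖)²` is a nonnegative quadratic in `τ`, so its discriminant is nonpositive. -/
lemma sq_sum_integral_norm_le (h : BlobSystem α d D ε b a z μ σ Φ Λ)
    {t : ℝ} (ht : t ∈ Icc 0 b) :
    (∑ j, ∫ w, ‖w - z j t‖ ∂(μ j).map (Φ t)) ^ 2 ≤ (∑ j, |a j|) * totalMoment z μ Φ t := by
  set P := ∑ j, ∫ w, ‖w - z j t‖ ∂(μ j).map (Φ t)
  have h1 : ∀ τ : ℝ, 0 ≤ (∑ j, |a j|) * (τ * τ) + (-2 * P) * τ + totalMoment z μ Φ t := by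
    intro τ
    have h2 : ∀ j, ∫ w, (τ - ‖w - z j t‖) ^ 2 ∂(μ j).map (Φ t) = |a j| * (τ * τ) +
        (-2 * ∫ w, ‖w - z j t‖ ∂(μ j).map (Φ t)) * τ +
          ∫ w, ‖w - z j t‖ ^ 2 ∂(μ j).map (Φ t) := by
      intro j
      have := h.finite j
      have i1 : Integrable (fun w => ‖w - z j t‖) ((μ j).map (Φ t)) :=
        h.integrable_comp ht j (by fun_prop)
      have i2 : Integrable (fun w => ‖w - z j t‖ ^ 2) ((μ j).map (Φ t)) :=
        h.integrable_comp ht j (by fun_prop)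
      have h3 : ∀ w : Plane, (τ - ‖w - z j t‖) ^ 2 =
          τ * τ + (-2 * τ) * ‖w - z j t‖ + ‖w - z j t‖ ^ 2 := fun w => by ring
      simp only [h3]
      have i3 : Integrable (fun w => τ * τ + -2 * τ * ‖w - z j t‖) ((μ j).map (Φ t)) :=
        (integrable_const _).add (i1.const_mul _)
      rw [integral_add i3 i2, integral_add (integrable_const _) (i1.const_mul _), integral_const,
        integral_const_mul,
        h.real_map_univ ht, smul_eq_mul]
      ring
    have h4 : 0 ≤ ∑ j, ∫ w, (τ - ‖w - z j t‖) ^ 2 ∂(μ j).map (Φ t) :=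
      Finset.sum_nonneg fun j _ => integral_nonneg fun w => sq_nonneg _
    simp only [h2] at h4
    rw [Finset.sum_add_distrib, Finset.sum_add_distrib, ← Finset.sum_mul, ← Finset.sum_mul,
      ← Finset.mul_sum, ← h.totalMoment_eq ht] at h4
    exact h4
  have h5 := discrim_le_zero h1
  unfold discrim at h5
  nlinarith

/-- The own field of the blob drops out by `integral_inner_sub_measureVelocity`. What remains is the
gap between the external field and the velocity of the pseudo-vortex. -/
lemma integral_inner_velocity_le (h : BlobSystem α d D ε b a z μ σ Φ Λ)
    {t : ℝ} (ht : t ∈ Icc 0 b) (i : Fin N) :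
    ∫ y, 2 * inner ℝ (Φ t y - z i t) (∑ j, σ j • measureVelocity α ((μ j).map (Φ t)) (Φ t y) -
      ∑ j ∈ Finset.univ.erase i, a j • kernel α (z i t - z j t)) ∂μ i ≤
    2 * kernelLip α d * (∑ j, |a j|) * ∫ x, ‖x - z i t‖ ^ 2 ∂(μ i).map (Φ t) +
      2 * kernelLip α d * (∑ j, ∫ w, ‖w - z j t‖ ∂(μ j).map (Φ t)) *
        ∫ x, ‖x - z i t‖ ∂(μ i).map (Φ t) := by
  have := h.finite i
  set v := ∑ j ∈ Finset.univ.erase i, a j • kernel α (z i t - z j t) with hv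
  set P := ∑ j, ∫ w, ‖w - z j t‖ ∂(μ j).map (Φ t) with hP
  have i1 : Integrable (fun w => ‖w - z i t‖) ((μ i).map (Φ t)) :=
    h.integrable_comp ht i (by fun_prop)
  have i2 : Integrable (fun w => ‖w - z i t‖ ^ 2) ((μ i).map (Φ t)) :=
    h.integrable_comp ht i (by fun_prop)
  have m1 : StronglyMeasurable fun x : Plane => x - z i t :=
    (by fun_prop : Continuous fun x : Plane => x - z i t).stronglyMeasurable
  have hself := stronglyMeasurable_measureVelocity (ν := (μ i).map (Φ t)) h.alpha_pos
  have hext := h.stronglyMeasurable_externalField i t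
  have i3 : Integrable (fun x => inner ℝ (x - z i t) (measureVelocity α ((μ i).map (Φ t)) x))
      ((μ i).map (Φ t)) := by
    refine (integrable_const (d / 4 * (|kernelConst α| * (D * (rieszConst (1 + α) * 1 ^ (1 - α)) +
      1 ^ (-(1 + α)) * ((μ i).map (Φ t)).real univ)))).mono'
      (m1.inner hself).aestronglyMeasurable ?_
    filter_upwards [h.ae_map ht i] with x hx
    exact (norm_inner_le_norm _ _).trans (mul_le_mul hx (norm_measureVelocity_le h.alpha_pos
      h.alpha_lt_one h.D_nonneg (h.density t ht i) one_pos x) (norm_nonneg _)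
      (by linarith [h.d_pos]))
  have i4 : Integrable (fun x => inner ℝ (x - z i t) (externalField α μ σ Φ i t x - v))
      ((μ i).map (Φ t)) := by
    refine (((i2.const_mul (kernelLip α d * ∑ j, |a j|))).add
      (i1.const_mul (kernelLip α d * P))).mono'
      (m1.inner (hext.sub stronglyMeasurable_const)).aestronglyMeasurable ?_
    filter_upwards [h.ae_map ht i] with x hx
    refine (norm_inner_le_norm _ _).trans ?_
    have h2 := mul_le_mul_of_nonneg_left (h.norm_externalField_sub_vortex_le ht hx)
      (norm_nonneg (x - z i t))
    refine h2.trans (le_of_eq ?_)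
    simp only [Pi.add_apply]
    ring
  have h1 : ∫ y, 2 * inner ℝ (Φ t y - z i t)
      (∑ j, σ j • measureVelocity α ((μ j).map (Φ t)) (Φ t y) - v) ∂μ i =
      2 * ∫ x, inner ℝ (x - z i t) (externalField α μ σ Φ i t x - v) ∂(μ i).map (Φ t) := by
    simp only [velocity_eq α μ σ Φ t i]
    have hm : StronglyMeasurable fun x => inner ℝ (x - z i t)
        (σ i • measureVelocity α ((μ i).map (Φ t)) x + externalField α μ σ Φ i t x - v) :=
      m1.inner (((hself.const_smul (σ i)).add hext).sub stronglyMeasurable_const)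
    rw [integral_const_mul]
    congr 1
    refine (h.integral_comp_eq ht i hm).trans ?_
    simp only [add_sub_assoc, inner_add_right, inner_smul_right]
    rw [integral_add (i3.const_mul _) i4, integral_const_mul,
      integral_inner_sub_measureVelocity h.alpha_pos h.alpha_lt_one h.D_nonneg (h.density t ht i)
        (z i t) (h.ae_map_norm_le ht i), mul_zero, zero_add]
  rw [h1]
  have h3 : ∫ x, inner ℝ (x - z i t) (externalField α μ σ Φ i t x - v) ∂(μ i).map (Φ t) ≤
      ∫ x, (kernelLip α d * (∑ j, |a j|) * ‖x - z i t‖ ^ 2 + kernelLip α d * P * ‖x - z i t‖)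
        ∂(μ i).map (Φ t) := by
    refine integral_mono_ae i4 ((i2.const_mul _).add (i1.const_mul _)) ?_
    filter_upwards [h.ae_map ht i] with x hx
    refine (real_inner_le_norm _ _).trans ?_
    have h2 := mul_le_mul_of_nonneg_left (h.norm_externalField_sub_vortex_le ht hx)
      (norm_nonneg (x - z i t))
    refine h2.trans (le_of_eq ?_)
    ring
  rw [integral_add (i2.const_mul _) (i1.const_mul _), integral_const_mul, integral_const_mul] at h3
  linarith

lemma integrable_comp_flow (h : BlobSystem α d D ε b a z μ σ Φ Λ)
    {E : Type*} [NormedAddCommGroup E] {t : ℝ} (ht : t ∈ Icc 0 b)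
    (i : Fin N) {f : Plane → E} (hf : Integrable f ((μ i).map (Φ t))) :
    Integrable (fun y => f (Φ t y)) (μ i) :=
  hf.comp_measurable (h.measurable t ht)

lemma hasDerivWithinAt_totalMoment (h : BlobSystem α d D ε b a z μ σ Φ Λ)
    {t : ℝ} (ht : t ∈ Icc 0 b) :
    HasDerivWithinAt (totalMoment z μ Φ)
      (∑ i, ∫ y, 2 * inner ℝ (Φ t y - z i t)
        (∑ j, σ j • measureVelocity α ((μ j).map (Φ t)) (Φ t y) -
          ∑ j ∈ Finset.univ.erase i, a j • kernel α (z i t - z j t)) ∂μ i) (Icc 0 b) t := by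
  unfold totalMoment
  refine HasDerivWithinAt.fun_sum fun i _ => ?_
  have := h.finite i
  obtain ⟨C, hC⟩ := h.exists_vortexVelocity_bound i
  refine hasDerivWithinAt_integral (g := fun t y => ‖Φ t y - z i t‖ ^ 2)
    (g' := fun t y => 2 * inner ℝ (Φ t y - z i t)
        (∑ j, σ j • measureVelocity α ((μ j).map (Φ t)) (Φ t y) -
          ∑ j ∈ Finset.univ.erase i, a j • kernel α (z i t - z j t)))
    (h.mem_support i) (fun s hs => ?_) (fun y hy s hs => ?_)
    (C := 2 * (d / 4 * ((∑ j, |kernelConst α| * (D * (rieszConst (1 + α) * 1 ^ (1 - α)) +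
        1 ^ (-(1 + α)) * |a j|)) + C))) (fun y hy s hs => ?_) ht
  · exact h.integrable_comp_flow hs i (h.integrable_comp hs i
      (f := fun x => ‖x - z i s‖ ^ 2) (by fun_prop))
  · exact ((h.trajectory i y hy s hs).sub (h.motion i s hs)).norm_sq
  · rw [norm_mul, Real.norm_of_nonneg (by norm_num : (0 : ℝ) ≤ 2)]
    refine mul_le_mul_of_nonneg_left ((norm_inner_le_norm _ _).trans ?_) (by norm_num)
    have h1 := h.close i y hy s hs
    rw [dist_eq_norm] at h1
    exact mul_le_mul h1 ((norm_sub_le _ _).trans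
      (add_le_add (h.norm_velocity_le hs _ _) (hC s hs))) (norm_nonneg _) (by linarith [h.d_pos])

/-- The second moments grow at most exponentially. -/
lemma totalMoment_le (h : BlobSystem α d D ε b a z μ σ Φ Λ)
    {t : ℝ} (ht : t ∈ Icc 0 b) :
    totalMoment z μ Φ t ≤
      (∑ j, |a j|) * ε ^ 2 * Real.exp (4 * kernelLip α d * (∑ j, |a j|) * t) := by
  have hL := h.kernelLip_nonneg
  have hA : 0 ≤ ∑ j, |a j| := Finset.sum_nonneg fun j _ => abs_nonneg _
  have h1 := le_mul_exp_of_deriv_le (f := totalMoment z μ Φ) (e := 0)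
    (C := 4 * kernelLip α d * (∑ j, |a j|)) (fun s hs => h.hasDerivWithinAt_totalMoment hs)
    (fun s hs => ?_) ht
  · rw [add_zero, add_zero] at h1
    refine h1.trans ?_
    gcongr
    have h0 : (0 : ℝ) ∈ Icc 0 b := ⟨le_rfl, ht.1.trans ht.2⟩
    rw [totalMoment, Finset.sum_mul]
    refine Finset.sum_le_sum fun i _ => ?_
    have := h.finite i
    have h2 : ∀ᵐ y ∂μ i, ‖‖Φ 0 y - z i 0‖ ^ 2‖ ≤ ε ^ 2 := by
      filter_upwards [h.mem_support i] with y hy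
      have h3 := h.initial i y hy
      rw [dist_eq_norm] at h3
      rw [Real.norm_of_nonneg (by positivity)]
      gcongr
    have h4 := norm_integral_le_of_norm_le_const h2
    rw [h.real_univ i] at h4
    linarith [Real.le_norm_self (∫ y, ‖Φ 0 y - z i 0‖ ^ 2 ∂μ i)]
  · have h2 := Finset.sum_le_sum fun i (_ : i ∈ Finset.univ) => h.integral_inner_velocity_le hs i
    refine h2.trans ?_
    rw [Finset.sum_add_distrib, ← Finset.mul_sum, ← Finset.mul_sum, ← h.totalMoment_eq hs]
    -- Summed over `i`, the first moments form a square, which Cauchy–Schwarz bounds by the total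
    -- second moment. Two equal contributions make the rate `4 * kernelLip α d * ∑ j, |a j|`.
    have h3 := mul_le_mul_of_nonneg_left (h.sq_sum_integral_norm_le hs) hL
    nlinarith

end BlobSystem

/-! ### Centers of the blobs and the centered distributions. -/

/-- The center of the blob `i`. -/
def blobCenter {N : ℕ} (μ : Fin N → Measure Plane) (Φ : ℝ → Plane → Plane) (i : Fin N) (t : ℝ) :
    Plane :=
  ((μ i).real univ)⁻¹ • ∫ y, Φ t y ∂μ i

/-- The velocity of the center of the blob `i`. -/
def centerVelocity (α : ℝ) {N : ℕ} (μ : Fin N → Measure Plane) (σ : Fin N → ℝ)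
    (Φ : ℝ → Plane → Plane) (i : Fin N) (t : ℝ) : Plane :=
  ((μ i).real univ)⁻¹ • ∫ x, externalField α μ σ Φ i t x ∂(μ i).map (Φ t)

/-- The distribution of the blob `i` around its center. -/
def centeredBlob {N : ℕ} (μ : Fin N → Measure Plane) (Φ : ℝ → Plane → Plane) (i : Fin N)
    (t : ℝ) : Measure Plane :=
  ((μ i).map (Φ t)).map fun x => x - blobCenter μ Φ i t

/-- Integrate the pointwise inequality `f ≤ f² / (2ρ) + ρ / 2`. -/
lemma integral_norm_le_of_integral_sq_le {ν : Measure Plane} [IsFiniteMeasure ν] {f : Plane → ℝ}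
    {ρ : ℝ} (hρ : 0 < ρ) (hf : Integrable f ν) (hf2 : Integrable (fun x => f x ^ 2) ν)
    (h : ∫ x, f x ^ 2 ∂ν ≤ ν.real univ * ρ ^ 2) : ∫ x, f x ∂ν ≤ ν.real univ * ρ := by
  have h1 : ∫ x, f x ∂ν ≤ ∫ x, ((2 * ρ)⁻¹ * f x ^ 2 + ρ / 2) ∂ν := by
    refine integral_mono hf ((hf2.const_mul _).add (integrable_const _)) fun x => ?_
    have h2 : (2 * ρ)⁻¹ * f x ^ 2 + ρ / 2 - f x = (2 * ρ)⁻¹ * (f x - ρ) ^ 2 := by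
      field_simp
      ring
    have h3 : 0 ≤ (2 * ρ)⁻¹ * (f x - ρ) ^ 2 := by positivity
    simp only
    linarith
  rw [integral_add (hf2.const_mul _) (integrable_const _), integral_const_mul, integral_const,
    smul_eq_mul] at h1
  have h4 : (2 * ρ)⁻¹ * ∫ x, f x ^ 2 ∂ν ≤ (2 * ρ)⁻¹ * (ν.real univ * ρ ^ 2) := by gcongr
  have h5 : (2 * ρ)⁻¹ * (ν.real univ * ρ ^ 2) = ν.real univ * (ρ / 2) := by field_simp
  linarith

lemma measureVelocity_map_sub {α : ℝ} (hα : 0 < α) (ν : Measure Plane) (c x : Plane) :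
    measureVelocity α (ν.map fun y => y - c) (x - c) = measureVelocity α ν x := by
  unfold measureVelocity
  rw [integral_map (by fun_prop)]
  · simp
  · exact ((measurable_kernel hα).comp (measurable_const.sub measurable_id)).aestronglyMeasurable

lemma map_sub_le_smul_volume {ν : Measure Plane} {c : ENNReal} (hν : ν ≤ c • volume) (p : Plane) :
    (ν.map fun y => y - p) ≤ c • volume := by
  refine (Measure.map_mono hν (by fun_prop)).trans_eq ?_
  rw [Measure.map_smul, (measurePreserving_sub_right volume p).map_eq]

namespace BlobSystem

variable {α d D ε b : ℝ} {N : ℕ} {a : Fin N → ℝ} {z : Fin N → ℝ → Plane}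
  {μ : Fin N → Measure Plane} {σ : Fin N → ℝ} {Φ : ℝ → Plane → Plane} {Λ : Fin N → Set Plane}

lemma integrable_id_map (h : BlobSystem α d D ε b a z μ σ Φ Λ)
    {t : ℝ} (ht : t ∈ Icc 0 b) (i : Fin N) :
    Integrable (fun x => x) ((μ i).map (Φ t)) := by
  have := h.finite i
  exact (integrable_const (d / 4 + ‖z i t‖)).mono' measurable_id.aestronglyMeasurable
    (h.ae_map_norm_le ht i)

lemma integral_sub_center (h : BlobSystem α d D ε b a z μ σ Φ Λ)
    {t : ℝ} (ht : t ∈ Icc 0 b) {i : Fin N} (hi : a i ≠ 0) :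
    ∫ x, (x - blobCenter μ Φ i t) ∂(μ i).map (Φ t) = 0 := by
  have := h.finite i
  have hm : (μ i).real univ ≠ 0 := by
    rw [h.real_univ]
    exact abs_ne_zero.2 hi
  rw [integral_sub (h.integrable_id_map ht i) (integrable_const _), integral_const,
    h.real_map_univ ht, ← h.real_univ, blobCenter, smul_smul, mul_inv_cancel₀ hm, one_smul,
    h.integral_comp_eq ht i (f := fun x => x) stronglyMeasurable_id, sub_self]

lemma hasDerivWithinAt_blobCenter (h : BlobSystem α d D ε b a z μ σ Φ Λ)
    {t : ℝ} (ht : t ∈ Icc 0 b) (i : Fin N) :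
    HasDerivWithinAt (blobCenter μ Φ i) (centerVelocity α μ σ Φ i t) (Icc 0 b) t := by
  have := h.finite i
  have h1 := hasDerivWithinAt_integral (μ := μ i) (g := Φ) (b := b)
    (g' := fun t y => ∑ j, σ j • measureVelocity α ((μ j).map (Φ t)) (Φ t y))
    (h.mem_support i)
    (fun s hs => h.integrable_comp_flow hs i (f := fun x => x) (h.integrable_id_map hs i))
    (h.trajectory i)
    (fun y _ s hs => h.norm_velocity_le hs (Φ s y) _) ht
  have h2 : ∫ y, ∑ j, σ j • measureVelocity α ((μ j).map (Φ t)) (Φ t y) ∂μ i =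
      ∫ x, externalField α μ σ Φ i t x ∂(μ i).map (Φ t) := by
    simp only [velocity_eq α μ σ Φ t i]
    have hself := stronglyMeasurable_measureVelocity (ν := (μ i).map (Φ t)) h.alpha_pos
    have hm : StronglyMeasurable fun x => σ i • measureVelocity α ((μ i).map (Φ t)) x +
        externalField α μ σ Φ i t x :=
      (hself.const_smul (σ i)).add (h.stronglyMeasurable_externalField i t)
    have hi := integrable_measureVelocity h.alpha_pos h.alpha_lt_one h.D_nonneg (h.density t ht i)
    refine (h.integral_comp_eq ht i hm).trans ?_
    rw [integral_add (f := fun x => σ i • measureVelocity α ((μ i).map (Φ t)) x)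
      (hi.smul (σ i)) (h.integrable_externalField ht i i), integral_smul,
      integral_measureVelocity h.alpha_pos h.alpha_lt_one h.D_nonneg (h.density t ht i),
      smul_zero, zero_add]
  rw [h2] at h1
  exact h1.fun_const_smul ((μ i).real univ)⁻¹

lemma norm_centerVelocity_le (h : BlobSystem α d D ε b a z μ σ Φ Λ)
    {t : ℝ} (ht : t ∈ Icc 0 b) (i : Fin N) :
    ‖centerVelocity α μ σ Φ i t‖ ≤ ((μ i).real univ)⁻¹ *
      ((∑ j, |kernelConst α| * (D * (rieszConst (1 + α) * 1 ^ (1 - α)) +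
        1 ^ (-(1 + α)) * |a j|)) * |a i|) := by
  have := h.finite i
  rw [centerVelocity, norm_smul, norm_inv, Real.norm_of_nonneg measureReal_nonneg]
  gcongr
  rw [← h.real_map_univ ht i]
  exact norm_integral_le_of_norm_le_const (ae_of_all _ fun x => h.norm_velocity_le ht x _)

/-- Among all base points the center of mass minimizes the second moment: the cross term has zero
mean. -/
lemma integral_sq_sub_center_le (h : BlobSystem α d D ε b a z μ σ Φ Λ)
    {t : ℝ} (ht : t ∈ Icc 0 b) {i : Fin N} (hi : a i ≠ 0) :
    ∫ x, ‖x - blobCenter μ Φ i t‖ ^ 2 ∂(μ i).map (Φ t) ≤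
      ∫ x, ‖x - z i t‖ ^ 2 ∂(μ i).map (Φ t) := by
  have := h.finite i
  set B := blobCenter μ Φ i t with hB
  have i1 : Integrable (fun x => x - B) ((μ i).map (Φ t)) :=
    (h.integrable_id_map ht i).sub (integrable_const _)
  have i2 : Integrable (fun x => ‖x - B‖ ^ 2) ((μ i).map (Φ t)) :=
    h.integrable_comp ht i (by fun_prop)
  have h1 : ∀ x : Plane, ‖x - z i t‖ ^ 2 =
      ‖x - B‖ ^ 2 + (2 * inner ℝ (B - z i t) (x - B) + ‖B - z i t‖ ^ 2) := by
    intro x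
    have h2 : x - z i t = (x - B) + (B - z i t) := by abel
    rw [h2, norm_add_sq_real, real_inner_comm]
    ring
  have i3 : Integrable (fun x => 2 * inner ℝ (B - z i t) (x - B)) ((μ i).map (Φ t)) :=
    (i1.const_inner _).const_mul 2
  have i4 : Integrable (fun x => 2 * inner ℝ (B - z i t) (x - B) + ‖B - z i t‖ ^ 2)
      ((μ i).map (Φ t)) := i3.add (integrable_const _)
  rw [integral_congr_ae (ae_of_all _ h1), integral_add i2 i4, integral_add i3 (integrable_const _),
    integral_const_mul, integral_inner i1, h.integral_sub_center ht hi, inner_zero_right,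
    integral_const, smul_eq_mul]
  have : 0 ≤ ((μ i).map (Φ t)).real univ * ‖B - z i t‖ ^ 2 := by positivity
  linarith

lemma norm_center_sub_le (h : BlobSystem α d D ε b a z μ σ Φ Λ)
    {t : ℝ} (ht : t ∈ Icc 0 b) {i : Fin N} (hi : a i ≠ 0) {ρ : ℝ}
    (hρ : 0 < ρ) (hJ : ∫ x, ‖x - z i t‖ ^ 2 ∂(μ i).map (Φ t) ≤ |a i| * ρ ^ 2) :
    ‖blobCenter μ Φ i t - z i t‖ ≤ ρ := by
  have := h.finite i
  have hm : 0 < |a i| := abs_pos.2 hi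
  have i1 := h.integrable_id_map ht i
  have h1 : blobCenter μ Φ i t - z i t =
      |a i|⁻¹ • ∫ x, (x - z i t) ∂(μ i).map (Φ t) := by
    rw [integral_sub i1 (integrable_const _), integral_const, h.real_map_univ ht, smul_sub,
      smul_smul, inv_mul_cancel₀ hm.ne', one_smul, blobCenter, h.real_univ,
      h.integral_comp_eq ht i (f := fun x => x) stronglyMeasurable_id]
  rw [← h.real_map_univ ht i] at hJ
  have h2 := integral_norm_le_of_integral_sq_le hρ
    (h.integrable_comp ht i (f := fun x => ‖x - z i t‖) (by fun_prop))
    (h.integrable_comp ht i (by fun_prop)) hJ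
  rw [h.real_map_univ ht i] at h2
  rw [h1, norm_smul, norm_inv, Real.norm_eq_abs, abs_abs, inv_mul_le_iff₀ hm]
  exact (norm_integral_le_integral_norm _).trans h2

/-- The field felt by a blob varies little around the velocity of the center. -/
lemma norm_externalField_sub_centerVelocity_le (h : BlobSystem α d D ε b a z μ σ Φ Λ)
    {t : ℝ} (ht : t ∈ Icc 0 b) {i : Fin N}
    (hi : a i ≠ 0) {ρ : ℝ} (hρ : 0 < ρ)
    (hJ : ∫ x, ‖x - z i t‖ ^ 2 ∂(μ i).map (Φ t) ≤ |a i| * ρ ^ 2) {x : Plane}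
    (hx : ‖x - z i t‖ ≤ d / 4) :
    ‖externalField α μ σ Φ i t x - centerVelocity α μ σ Φ i t‖ ≤
      kernelLip α d * (∑ j, |a j|) * (‖x - blobCenter μ Φ i t‖ + ρ) := by
  have := h.finite i
  have hm : 0 < |a i| := abs_pos.2 hi
  have hL := h.kernelLip_nonneg
  have hA : 0 ≤ ∑ j, |a j| := Finset.sum_nonneg fun j _ => abs_nonneg _
  set B := blobCenter μ Φ i t with hB
  -- The center moves with the mean of the external field over the blob, so the difference is a mean
  -- of increments of that field.
  have h1 : externalField α μ σ Φ i t x - centerVelocity α μ σ Φ i t =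
      |a i|⁻¹ • ∫ w, (externalField α μ σ Φ i t x - externalField α μ σ Φ i t w)
        ∂(μ i).map (Φ t) := by
    rw [integral_sub (integrable_const _) (h.integrable_externalField ht i i), integral_const,
      h.real_map_univ ht, smul_sub, smul_smul, inv_mul_cancel₀ hm.ne', one_smul, centerVelocity,
      h.real_univ]
  have i1 : Integrable (fun w => ‖w - B‖) ((μ i).map (Φ t)) :=
    h.integrable_comp ht i (by fun_prop)
  have h2 : ‖∫ w, (externalField α μ σ Φ i t x - externalField α μ σ Φ i t w)
      ∂(μ i).map (Φ t)‖ ≤ ∫ w, kernelLip α d * (∑ j, |a j|) * (‖x - B‖ + ‖w - B‖)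
        ∂(μ i).map (Φ t) := by
    refine norm_integral_le_of_norm_le (((integrable_const _).add i1).const_mul _) ?_
    filter_upwards [h.ae_map ht i] with w hw
    refine (h.norm_externalField_sub_le ht hx hw).trans ?_
    gcongr
    calc ‖x - w‖ = ‖(x - B) - (w - B)‖ := by congr 1; abel
      _ ≤ _ := norm_sub_le _ _
  rw [integral_const_mul, integral_add (integrable_const _) i1, integral_const, smul_eq_mul] at h2
  have h3 : ∫ w, ‖w - B‖ ∂(μ i).map (Φ t) ≤ ((μ i).map (Φ t)).real univ * ρ := by
    refine integral_norm_le_of_integral_sq_le hρ i1 (h.integrable_comp ht i (by fun_prop)) ?_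
    rw [h.real_map_univ ht]
    exact (h.integral_sq_sub_center_le ht hi).trans hJ
  rw [h.real_map_univ ht i] at h2 h3
  rw [h1, norm_smul, norm_inv, Real.norm_eq_abs, abs_abs, inv_mul_le_iff₀ hm]
  refine h2.trans ?_
  calc kernelLip α d * (∑ j, |a j|) * (|a i| * ‖x - B‖ + ∫ w, ‖w - B‖ ∂(μ i).map (Φ t))
      ≤ kernelLip α d * (∑ j, |a j|) * (|a i| * ‖x - B‖ + |a i| * ρ) := by gcongr
    _ = _ := by ring

lemma isFiniteMeasure_centeredBlob (h : BlobSystem α d D ε b a z μ σ Φ Λ)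
    (i : Fin N) (t : ℝ) :
    IsFiniteMeasure (centeredBlob μ Φ i t) := by
  have := h.finite i
  unfold centeredBlob
  infer_instance

lemma centeredBlob_le (h : BlobSystem α d D ε b a z μ σ Φ Λ)
    {t : ℝ} (ht : t ∈ Icc 0 b) (i : Fin N) :
    centeredBlob μ Φ i t ≤ ENNReal.ofReal D • volume :=
  map_sub_le_smul_volume (h.density t ht i) _

lemma integral_centeredBlob (h : BlobSystem α d D ε b a z μ σ Φ Λ)
    {E : Type*} [NormedAddCommGroup E] [NormedSpace ℝ E] {t : ℝ}
    (ht : t ∈ Icc 0 b) (i : Fin N) {f : Plane → E} (hf : StronglyMeasurable f) :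
    ∫ x, f x ∂centeredBlob μ Φ i t = ∫ y, f (Φ t y - blobCenter μ Φ i t) ∂μ i := by
  have hc : Measurable fun x : Plane => x - blobCenter μ Φ i t := by fun_prop
  rw [centeredBlob, integral_map hc.aemeasurable hf.aestronglyMeasurable]
  exact (h.integral_comp_eq ht i (hf.comp_measurable hc)).symm

lemma real_centeredBlob_univ (h : BlobSystem α d D ε b a z μ σ Φ Λ)
    {t : ℝ} (ht : t ∈ Icc 0 b) (i : Fin N) :
    (centeredBlob μ Φ i t).real univ = |a i| := by
  rw [← h.real_map_univ ht i, measureReal_def, centeredBlob,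
    Measure.map_apply (by fun_prop) MeasurableSet.univ, preimage_univ, measureReal_def]

lemma ae_centeredBlob (h : BlobSystem α d D ε b a z μ σ Φ Λ)
    {t : ℝ} (ht : t ∈ Icc 0 b) (i : Fin N) :
    ∀ᵐ x ∂centeredBlob μ Φ i t, ‖x‖ ≤ d / 4 + ‖blobCenter μ Φ i t - z i t‖ := by
  have hc : Measurable fun x : Plane => x - blobCenter μ Φ i t := by fun_prop
  rw [centeredBlob, ae_map_iff hc.aemeasurable (measurableSet_le measurable_norm measurable_const)]
  filter_upwards [h.ae_map ht i] with x hx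
  have h1 : x - blobCenter μ Φ i t = (x - z i t) - (blobCenter μ Φ i t - z i t) := by abel
  rw [h1]
  exact (norm_sub_le _ _).trans (by gcongr)

lemma integral_id_centeredBlob (h : BlobSystem α d D ε b a z μ σ Φ Λ)
    {t : ℝ} (ht : t ∈ Icc 0 b) {i : Fin N} (hi : a i ≠ 0) :
    ∫ x, x ∂centeredBlob μ Φ i t = 0 := by
  rw [h.integral_centeredBlob ht i (f := fun x => x) stronglyMeasurable_id, ← h.integral_sub_center
      ht hi]
  exact h.integral_comp_eq ht i (f := fun x => x - blobCenter μ Φ i t)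
    (by fun_prop : Continuous fun x : Plane => x - blobCenter μ Φ i t).stronglyMeasurable

lemma integral_sq_centeredBlob_le (h : BlobSystem α d D ε b a z μ σ Φ Λ)
    {t : ℝ} (ht : t ∈ Icc 0 b) {i : Fin N} (hi : a i ≠ 0) :
    ∫ x, ‖x‖ ^ 2 ∂centeredBlob μ Φ i t ≤ ∫ x, ‖x - z i t‖ ^ 2 ∂(μ i).map (Φ t) := by
  refine le_trans (le_of_eq ?_) (h.integral_sq_sub_center_le ht hi)
  have hc : Measurable fun x : Plane => x - blobCenter μ Φ i t := by fun_prop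
  exact integral_map hc.aemeasurable
    (by fun_prop : Continuous fun x : Plane => ‖x‖ ^ 2).aestronglyMeasurable

lemma integral_sq_le_totalMoment (h : BlobSystem α d D ε b a z μ σ Φ Λ)
    {t : ℝ} (ht : t ∈ Icc 0 b) (i : Fin N) :
    ∫ x, ‖x - z i t‖ ^ 2 ∂(μ i).map (Φ t) ≤ totalMoment z μ Φ t := by
  rw [h.totalMoment_eq ht]
  exact Finset.single_le_sum (f := fun i => ∫ x, ‖x - z i t‖ ^ 2 ∂(μ i).map (Φ t))
    (fun j _ => integral_nonneg fun x => by positivity) (Finset.mem_univ i)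

end BlobSystem

/-! ### Control radius and growth of the excess moments. -/

/-- The exponential rate at which the control radius of the blobs grows. -/
def growthRate (α d : ℝ) {N : ℕ} (a : Fin N → ℝ) : ℝ := 2 * (kernelLip α d * ∑ j, |a j|) + 1

/-- The control radius of the blobs. -/
def controlRadius (α d : ℝ) {N : ℕ} (a : Fin N → ℝ) (R₀ t : ℝ) : ℝ :=
  R₀ * Real.exp (growthRate α d a * t)

/-- Compatibility of the length scales: `J` bounds the second moments, `R₀` and `R₁` the control
radius, `q` the self-interaction of the blobs, and `w` is the resulting scale of the excess. -/
structure Scales (α d D ε b : ℝ) {N : ℕ} (a : Fin N → ℝ) (J R₀ R₁ r q w : ℝ) : Prop where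
  R_pos : 0 < R₀
  r_pos : 0 < r
  two_mul_eps_le : 2 * ε ≤ R₀
  moment_le : ∀ i, a i ≠ 0 → J ≤ |a i| * R₀ ^ 2
  moment_le_total : J ≤ (∑ j, |a j|) * R₀ ^ 2
  core : coreConst α * R₀ ^ (-(2 + α)) * J ≤ q
  outer : |kernelConst α| * (D * (rieszConst α * r ^ (2 - α)) + r ^ (-α) * (4 * J / R₀ ^ 2)) ≤ q
  w_nonneg : 0 ≤ w
  q_le : q ≤ w
  q_mul_le : q * R₁ ^ 2 ≤ w ^ 2
  exp_le : R₀ * Real.exp (growthRate α d a * b) ≤ R₁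

/-- The rate of change of a power of the excess along a trajectory. -/
def excessRate (α d : ℝ) {N : ℕ} (a : Fin N → ℝ) (μ : Fin N → Measure Plane) (σ : Fin N → ℝ)
    (Φ : ℝ → Plane → Plane) (R₀ : ℝ) (k : ℕ) (i : Fin N) (t : ℝ) (x : Plane) : ℝ :=
  (k + 2) * excess (controlRadius α d a R₀ t) (x - blobCenter μ Φ i t) ^ (k + 1) *
    (2 * inner ℝ (x - blobCenter μ Φ i t) (∑ j, σ j • measureVelocity α ((μ j).map (Φ t)) x -
      centerVelocity α μ σ Φ i t) -
      2 * growthRate α d a * controlRadius α d a R₀ t ^ 2)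

/-- The moment of the excess of the blob `i` over the disk of the control radius. -/
def excessMoment (α d : ℝ) {N : ℕ} (a : Fin N → ℝ) (μ : Fin N → Measure Plane)
    (Φ : ℝ → Plane → Plane) (R₀ : ℝ) (k : ℕ) (i : Fin N) (t : ℝ) : ℝ :=
  ∫ y, excess (controlRadius α d a R₀ t) (Φ t y - blobCenter μ Φ i t) ^ (k + 2) ∂μ i

lemma hasDerivAt_controlRadius_sq (α d : ℝ) {N : ℕ} (a : Fin N → ℝ) (R₀ t : ℝ) :
    HasDerivAt (fun t => controlRadius α d a R₀ t ^ 2)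
      (2 * growthRate α d a * controlRadius α d a R₀ t ^ 2) t := by
  unfold controlRadius
  have h1 := ((((hasDerivAt_id t).const_mul (growthRate α d a)).exp).const_mul R₀).fun_pow 2
  refine h1.congr_deriv ?_
  simp
  ring

lemma measureReal_le_of_integral_sq {ν : Measure Plane} [IsFiniteMeasure ν] {C ρ : ℝ}
    (hC : ∀ᵐ x ∂ν, ‖x‖ ≤ C) (hρ : 0 < ρ) :
    ν.real {y | ρ / 2 ≤ ‖y‖} ≤ 4 * (∫ y, ‖y‖ ^ 2 ∂ν) / ρ ^ 2 := by
  have hi : Integrable (fun y : Plane => ‖y‖ ^ 2) ν :=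
    integrable_of_continuous_of_bounded (by fun_prop) hC
  have h1 := mul_meas_ge_le_integral_of_nonneg (μ := ν) (f := fun y : Plane => ‖y‖ ^ 2)
    (ae_of_all _ fun y => by positivity) hi ((ρ / 2) ^ 2)
  have h2 : {y : Plane | (ρ / 2) ^ 2 ≤ ‖y‖ ^ 2} = {y | ρ / 2 ≤ ‖y‖} := by
    ext y
    exact pow_le_pow_iff_left₀ (by positivity) (norm_nonneg _) two_ne_zero
  rw [h2] at h1
  rw [le_div_iff₀ (by positivity)]
  linarith

namespace BlobSystem

variable {α d D ε b : ℝ} {N : ℕ} {a : Fin N → ℝ} {z : Fin N → ℝ → Plane}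
  {μ : Fin N → Measure Plane} {σ : Fin N → ℝ} {Φ : ℝ → Plane → Plane} {Λ : Fin N → Set Plane}
  {J R₀ R₁ r q w : ℝ}

lemma growthRate_pos (h : BlobSystem α d D ε b a z μ σ Φ Λ) :
    0 < growthRate α d a := by
  have hL := h.kernelLip_nonneg
  have hA : 0 ≤ ∑ j, |a j| := Finset.sum_nonneg fun j _ => abs_nonneg _
  unfold growthRate
  positivity

lemma le_controlRadius (h : BlobSystem α d D ε b a z μ σ Φ Λ)
    (hs : Scales α d D ε b a J R₀ R₁ r q w) {t : ℝ} (ht : t ∈ Icc 0 b) :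
    R₀ ≤ controlRadius α d a R₀ t := by
  have h1 := h.growthRate_pos
  have h2 : 1 ≤ Real.exp (growthRate α d a * t) := Real.one_le_exp (by have := ht.1; positivity)
  have h3 := hs.R_pos
  unfold controlRadius
  nlinarith

lemma controlRadius_le (h : BlobSystem α d D ε b a z μ σ Φ Λ)
    (hs : Scales α d D ε b a J R₀ R₁ r q w) {t : ℝ} (ht : t ∈ Icc 0 b) :
    controlRadius α d a R₀ t ≤ R₁ := by
  refine le_trans ?_ hs.exp_le
  have h1 := h.growthRate_pos
  have h2 := hs.R_pos
  have h3 := ht.2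
  unfold controlRadius
  gcongr

lemma integral_sq_le (h : BlobSystem α d D ε b a z μ σ Φ Λ)
    (hJ : ∀ t ∈ Icc 0 b, totalMoment z μ Φ t ≤ J) {t : ℝ}
    (ht : t ∈ Icc 0 b) (i : Fin N) : ∫ x, ‖x - z i t‖ ^ 2 ∂(μ i).map (Φ t) ≤ J :=
  (h.integral_sq_le_totalMoment ht i).trans (hJ t ht)

lemma norm_center_sub_le_radius (h : BlobSystem α d D ε b a z μ σ Φ Λ)
    (hs : Scales α d D ε b a J R₀ R₁ r q w)
    (hJ : ∀ t ∈ Icc 0 b, totalMoment z μ Φ t ≤ J) {t : ℝ} (ht : t ∈ Icc 0 b) {i : Fin N}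
    (hi : a i ≠ 0) : ‖blobCenter μ Φ i t - z i t‖ ≤ R₀ :=
  h.norm_center_sub_le ht hi hs.R_pos ((h.integral_sq_le hJ ht i).trans (hs.moment_le i hi))

lemma norm_sub_center_le (h : BlobSystem α d D ε b a z μ σ Φ Λ)
    (hs : Scales α d D ε b a J R₀ R₁ r q w)
    (hJ : ∀ t ∈ Icc 0 b, totalMoment z μ Φ t ≤ J) {t : ℝ} (ht : t ∈ Icc 0 b) {i : Fin N}
    (hi : a i ≠ 0) {x : Plane} (hx : ‖x - z i t‖ ≤ d / 4) :
    ‖x - blobCenter μ Φ i t‖ ≤ d / 4 + R₀ := by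
  have h1 : x - blobCenter μ Φ i t = (x - z i t) - (blobCenter μ Φ i t - z i t) := by abel
  rw [h1]
  exact (norm_sub_le _ _).trans (add_le_add hx (h.norm_center_sub_le_radius hs hJ ht hi))

/-- A purely qualitative bound: it provides the domination for differentiating the excess moment, so
its size is irrelevant. -/
lemma exists_excessRate_bound (h : BlobSystem α d D ε b a z μ σ Φ Λ)
    (hs : Scales α d D ε b a J R₀ R₁ r q w)
    (hJ : ∀ t ∈ Icc 0 b, totalMoment z μ Φ t ≤ J) {i : Fin N} (hi : a i ≠ 0) (k : ℕ) :
    ∃ C, ∀ t ∈ Icc 0 b, ∀ x, ‖x - z i t‖ ≤ d / 4 →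
      ‖excessRate α d a μ σ Φ R₀ k i t x‖ ≤ C := by
  set V := ∑ j, |kernelConst α| * (D * (rieszConst (1 + α) * 1 ^ (1 - α)) +
    1 ^ (-(1 + α)) * |a j|)
  set c := d / 4 + R₀
  refine ⟨(k + 2) * (c ^ 2) ^ (k + 1) * (2 * (c * (V + ((μ i).real univ)⁻¹ * (V * |a i|))) +
    2 * growthRate α d a * R₁ ^ 2), fun t ht x hx => ?_⟩
  have hg := h.growthRate_pos
  have hR : 0 ≤ controlRadius α d a R₀ t := hs.R_pos.le.trans (h.le_controlRadius hs ht)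
  have hR1 := h.controlRadius_le hs ht
  have hxc := h.norm_sub_center_le hs hJ ht hi hx
  have he := excess_nonneg (controlRadius α d a R₀ t) (x - blobCenter μ Φ i t)
  have h1 : excess (controlRadius α d a R₀ t) (x - blobCenter μ Φ i t) ≤ c ^ 2 :=
    (excess_le_sq _ _).trans (by gcongr)
  have h2 : ‖(2 * inner ℝ (x - blobCenter μ Φ i t)
      (∑ j, σ j • measureVelocity α ((μ j).map (Φ t)) x - centerVelocity α μ σ Φ i t) -
      2 * growthRate α d a * controlRadius α d a R₀ t ^ 2)‖ ≤
      2 * (c * (V + ((μ i).real univ)⁻¹ * (V * |a i|))) + 2 * growthRate α d a * R₁ ^ 2 := by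
    refine (norm_sub_le _ _).trans (add_le_add ?_ ?_)
    · rw [norm_mul, Real.norm_of_nonneg (by norm_num : (0 : ℝ) ≤ 2)]
      refine mul_le_mul_of_nonneg_left ((norm_inner_le_norm _ _).trans ?_) (by norm_num)
      exact mul_le_mul hxc ((norm_sub_le _ _).trans
        (add_le_add (h.norm_velocity_le ht x _) (h.norm_centerVelocity_le ht i)))
        (norm_nonneg _) ((norm_nonneg _).trans hxc)
    · rw [Real.norm_of_nonneg (by positivity)]
      gcongr
  rw [excessRate, norm_mul, Real.norm_of_nonneg (by positivity)]
  exact mul_le_mul (by gcongr) h2 (norm_nonneg _) (by positivity)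

lemma hasDerivWithinAt_excessMoment (h : BlobSystem α d D ε b a z μ σ Φ Λ)
    (hs : Scales α d D ε b a J R₀ R₁ r q w)
    (hJ : ∀ t ∈ Icc 0 b, totalMoment z μ Φ t ≤ J) {i : Fin N} (hi : a i ≠ 0) (k : ℕ) {t : ℝ}
    (ht : t ∈ Icc 0 b) :
    HasDerivWithinAt (excessMoment α d a μ Φ R₀ k i)
      (∫ y, excessRate α d a μ σ Φ R₀ k i t (Φ t y) ∂μ i) (Icc 0 b) t := by
  have := h.finite i
  obtain ⟨C, hC⟩ := h.exists_excessRate_bound hs hJ hi k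
  refine hasDerivWithinAt_integral
    (g := fun t y => excess (controlRadius α d a R₀ t) (Φ t y - blobCenter μ Φ i t) ^ (k + 2))
    (g' := fun t y => excessRate α d a μ σ Φ R₀ k i t (Φ t y))
    (h.mem_support i) (fun s hs => ?_) (fun y hy s hs => ?_) (C := C) (fun y hy s hs => ?_) ht
  · have hc := continuous_excess (controlRadius α d a R₀ s)
    exact h.integrable_comp_flow hs i (h.integrable_comp hs i (f := fun x =>
      excess (controlRadius α d a R₀ s) (x - blobCenter μ Φ i s) ^ (k + 2)) (by fun_prop))
  · have h1 := ((h.trajectory i y hy s hs).sub (h.hasDerivWithinAt_blobCenter hs i)).norm_sq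
    have h2 := h1.sub (hasDerivAt_controlRadius_sq α d a R₀ s).hasDerivWithinAt
    have h3 := (hasDerivAt_max_zero_pow k (‖Φ s y - blobCenter μ Φ i s‖ ^ 2 -
      controlRadius α d a R₀ s ^ 2)).comp_hasDerivWithinAt s h2
    exact h3
  · refine hC s hs _ ?_
    rw [← dist_eq_norm]
    exact h.close i y hy s hs

lemma stronglyMeasurable_excessRate (h : BlobSystem α d D ε b a z μ σ Φ Λ)
    (R₀ : ℝ) (k : ℕ) (i : Fin N) (t : ℝ) :
    StronglyMeasurable (excessRate α d a μ σ Φ R₀ k i t) := by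
  have hc := continuous_excess (controlRadius α d a R₀ t)
  have h1 : StronglyMeasurable fun x : Plane => x - blobCenter μ Φ i t :=
    (by fun_prop : Continuous fun x : Plane => x - blobCenter μ Φ i t).stronglyMeasurable
  have h2 : StronglyMeasurable fun x : Plane => (k + 2 : ℝ) *
      excess (controlRadius α d a R₀ t) (x - blobCenter μ Φ i t) ^ (k + 1) :=
    (by fun_prop : Continuous fun x : Plane => (k + 2 : ℝ) *
      excess (controlRadius α d a R₀ t) (x - blobCenter μ Φ i t) ^ (k + 1)).stronglyMeasurable
  have h3 : StronglyMeasurable fun x => ∑ j, σ j • measureVelocity α ((μ j).map (Φ t)) x := by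
    refine Finset.stronglyMeasurable_fun_sum _ fun j _ => ?_
    have := h.finite j
    exact (stronglyMeasurable_measureVelocity (ν := (μ j).map (Φ t)) h.alpha_pos).const_smul (σ j)
  exact h2.mul (((h1.inner (h3.sub stronglyMeasurable_const)).const_mul 2).sub
    stronglyMeasurable_const)

lemma excess_external_le (h : BlobSystem α d D ε b a z μ σ Φ Λ)
    (hs : Scales α d D ε b a J R₀ R₁ r q w)
    (hJ : ∀ t ∈ Icc 0 b, totalMoment z μ Φ t ≤ J) {i : Fin N} (hi : a i ≠ 0) (k : ℕ) {t : ℝ}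
    (ht : t ∈ Icc 0 b) {x : Plane} (hx : ‖x - z i t‖ ≤ d / 4) :
    excess (controlRadius α d a R₀ t) (x - blobCenter μ Φ i t) ^ (k + 1) *
      (inner ℝ (x - blobCenter μ Φ i t)
        (externalField α μ σ Φ i t x - centerVelocity α μ σ Φ i t) -
        growthRate α d a * controlRadius α d a R₀ t ^ 2) ≤
    2 * (kernelLip α d * ∑ j, |a j|) *
      excess (controlRadius α d a R₀ t) (x - blobCenter μ Φ i t) ^ (k + 2) := by
  set X := x - blobCenter μ Φ i t
  set R := controlRadius α d a R₀ t
  set L := kernelLip α d * ∑ j, |a j| with hLdef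
  have hL : 0 ≤ L := mul_nonneg h.kernelLip_nonneg (Finset.sum_nonneg fun j _ => abs_nonneg _)
  have hR : R₀ ≤ R := h.le_controlRadius hs ht
  have he := excess_nonneg R X
  rcases le_total ‖X‖ R with hXR | hXR
  · rw [excess_eq_zero hXR]
    simp
  · have h1 := h.norm_externalField_sub_centerVelocity_le ht hi hs.R_pos
      ((h.integral_sq_le hJ ht i).trans (hs.moment_le i hi)) hx
    have h2 : inner ℝ X (externalField α μ σ Φ i t x - centerVelocity α μ σ Φ i t) ≤
        2 * L * ‖X‖ ^ 2 := by
      refine (real_inner_le_norm _ _).trans ?_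
      calc ‖X‖ * ‖externalField α μ σ Φ i t x - centerVelocity α μ σ Φ i t‖
          ≤ ‖X‖ * (L * (‖X‖ + ‖X‖)) := by
            refine mul_le_mul_of_nonneg_left (h1.trans ?_) (norm_nonneg _)
            change L * _ ≤ _
            gcongr
            linarith
        _ = _ := by ring
    have h3 : excess R X = ‖X‖ ^ 2 - R ^ 2 := by
      have : R ^ 2 ≤ ‖X‖ ^ 2 := by
        have : 0 ≤ R := hs.R_pos.le.trans hR
        gcongr
      exact max_eq_left (by linarith)
    have h4 : inner ℝ X (externalField α μ σ Φ i t x - centerVelocity α μ σ Φ i t) -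
        growthRate α d a * R ^ 2 ≤ 2 * L * excess R X := by
      -- Since `‖X‖²` is the excess plus `R²`, the part `2L` of the growth rate cancels the `R²`
      -- term. The extra `1` is not needed here; it makes the later barriers strict.
      rw [h3, growthRate, ← hLdef]
      nlinarith [sq_nonneg R]
    calc excess R X ^ (k + 1) * (inner ℝ X (externalField α μ σ Φ i t x -
          centerVelocity α μ σ Φ i t) - growthRate α d a * R ^ 2)
        ≤ excess R X ^ (k + 1) * (2 * L * excess R X) := by gcongr
      _ = _ := by ring

/-- The static estimate is applied to the centered blob with power `k + 1`, which must be at least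
two. Negative powers of the control radius are bounded at its lower bound `R₀`, positive ones at its
upper bound `R₁`; Chebyshev gives the outer mass. -/
lemma abs_integral_excess_self_le (h : BlobSystem α d D ε b a z μ σ Φ Λ)
    (hs : Scales α d D ε b a J R₀ R₁ r q w)
    (hJ : ∀ t ∈ Icc 0 b, totalMoment z μ Φ t ≤ J) {i : Fin N} (hi : a i ≠ 0) {k : ℕ}
    (hk : 1 ≤ k) {t : ℝ} (ht : t ∈ Icc 0 b) :
    |∫ y, excess (controlRadius α d a R₀ t) (Φ t y - blobCenter μ Φ i t) ^ (k + 1) *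
      inner ℝ (Φ t y - blobCenter μ Φ i t) (measureVelocity α ((μ i).map (Φ t)) (Φ t y)) ∂μ i| ≤
    (4 * (k + 1) + 2) * (excessMoment α d a μ Φ R₀ k i t + w ^ (k + 2) * |a i|) := by
  have := h.isFiniteMeasure_centeredBlob i t
  set R := controlRadius α d a R₀ t with hRdef
  set ν := centeredBlob μ Φ i t with hν
  have hR : R₀ ≤ R := h.le_controlRadius hs ht
  have hR0 := hs.R_pos
  have hRpos : 0 < R := hR0.trans_le hR
  have hα := h.alpha_pos
  have hα1 := h.alpha_lt_one
  have hJ0 : ∫ y, ‖y‖ ^ 2 ∂ν ≤ J :=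
    (h.integral_sq_centeredBlob_le ht hi).trans (h.integral_sq_le hJ ht i)
  have hI0 : 0 ≤ ∫ y, ‖y‖ ^ 2 ∂ν := integral_nonneg fun y => by positivity
  have hcc := coreConst_nonneg hα
  have hcore : coreConst α * R ^ (-(2 + α)) * ∫ y, ‖y‖ ^ 2 ∂ν ≤ q := by
    refine le_trans ?_ hs.core
    have : R ^ (-(2 + α)) ≤ R₀ ^ (-(2 + α)) := Real.rpow_le_rpow_of_nonpos hR0 hR (by linarith)
    have h0 := Real.rpow_nonneg hRpos.le (-(2 + α))
    have h1 := Real.rpow_nonneg hR0.le (-(2 + α))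
    exact mul_le_mul (mul_le_mul_of_nonneg_left this hcc) hJ0 hI0 (by positivity)
  have hc := h.ae_centeredBlob ht i
  have hν1 := h.centeredBlob_le ht i
  have hQ : ∀ x, ∫ y in {y | R / 2 ≤ ‖y‖}, ‖x - y‖ ^ (-α) ∂ν ≤
      D * (rieszConst α * r ^ (2 - α)) + r ^ (-α) * (4 * J / R₀ ^ 2) := by
    intro x
    refine (integral_riesz_le h.D_nonneg (Measure.restrict_le_self.trans hν1) hα (by linarith)
      hs.r_pos x).trans ?_
    have h1 := measureReal_le_of_integral_sq hc hRpos
    have h2 : 4 * (∫ y, ‖y‖ ^ 2 ∂ν) / R ^ 2 ≤ 4 * J / R₀ ^ 2 := by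
      have : 0 ≤ J := hI0.trans hJ0
      gcongr
    have h3 := Real.rpow_nonneg hs.r_pos.le (-α)
    rw [measureReal_restrict_apply_univ]
    have h4 := h1.trans h2
    gcongr
  have h1 := integral_excess_self_le_moment hα hα1 h.D_nonneg hν1 hc
    (h.integral_id_centeredBlob ht hi) hRpos (n := k + 1) (by omega) hcore hQ hs.outer
    hs.w_nonneg hs.q_le (w := w) (by
      have h2 := h.controlRadius_le hs ht
      have h3 : 0 ≤ q := le_trans (by
        have := Real.rpow_nonneg hRpos.le (-(2 + α))
        positivity) hcore
      refine le_trans ?_ hs.q_mul_le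
      gcongr)
  rw [h.real_centeredBlob_univ ht i] at h1
  have hce := continuous_excess R
  have h4 : ∫ x, excess R x ^ (k + 1 + 1) ∂ν = excessMoment α d a μ Φ R₀ k i t :=
    h.integral_centeredBlob ht i (f := fun x => excess R x ^ (k + 1 + 1))
      (by fun_prop : Continuous fun x => excess R x ^ (k + 1 + 1)).stronglyMeasurable
  have h5 : ∫ x, inner ℝ (excess R x ^ (k + 1) • x) (measureVelocity α ν x) ∂ν =
      ∫ y, excess R (Φ t y - blobCenter μ Φ i t) ^ (k + 1) *
        inner ℝ (Φ t y - blobCenter μ Φ i t) (measureVelocity α ((μ i).map (Φ t)) (Φ t y))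
          ∂μ i := by
    have hm : StronglyMeasurable fun x => inner ℝ (excess R x ^ (k + 1) • x)
        (measureVelocity α ν x) :=
      (by fun_prop : Continuous fun x => excess R x ^ (k + 1) • x).stronglyMeasurable.inner
        (stronglyMeasurable_measureVelocity hα)
    refine (h.integral_centeredBlob ht i hm).trans ?_
    refine integral_congr_ae (ae_of_all _ fun y => ?_)
    simp only [real_inner_smul_left]
    rw [hν, centeredBlob, measureVelocity_map_sub hα]
  rw [h4, h5] at h1
  refine h1.trans (le_of_eq ?_)
  push_cast
  ring

/-- Self-interaction contributes `4(k+1) + 2`, the external field after cancellation by the growing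
radius contributes `2L`, and differentiating the power gives the prefactor `2(k+2)`. The form suits
`le_mul_exp_of_deriv_le`. -/
lemma integral_excessRate_le (h : BlobSystem α d D ε b a z μ σ Φ Λ)
    (hs : Scales α d D ε b a J R₀ R₁ r q w)
    (hJ : ∀ t ∈ Icc 0 b, totalMoment z μ Φ t ≤ J) {i : Fin N} (hi : a i ≠ 0) {k : ℕ}
    (hk : 1 ≤ k) {t : ℝ} (ht : t ∈ Icc 0 b) :
    ∫ y, excessRate α d a μ σ Φ R₀ k i t (Φ t y) ∂μ i ≤
      2 * (k + 2) * (4 * (k + 1) + 2 + 2 * (kernelLip α d * ∑ j, |a j|)) *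
        (excessMoment α d a μ Φ R₀ k i t + w ^ (k + 2) * |a i|) := by
  have := h.finite i
  set R := controlRadius α d a R₀ t with hRdef
  set B := blobCenter μ Φ i t with hB
  set L := kernelLip α d * ∑ j, |a j| with hLdef
  have hL : 0 ≤ L := mul_nonneg h.kernelLip_nonneg (Finset.sum_nonneg fun j _ => abs_nonneg _)
  have hce := continuous_excess R
  obtain ⟨C, hC⟩ := h.exists_excessRate_bound hs hJ hi k
  have i1 : Integrable (fun y => excessRate α d a μ σ Φ R₀ k i t (Φ t y)) (μ i) := by
    refine h.integrable_comp_flow ht i ?_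
    refine (integrable_const C).mono'
      (h.stronglyMeasurable_excessRate R₀ k i t).aestronglyMeasurable ?_
    filter_upwards [h.ae_map ht i] with x hx
    exact hC t ht x hx
  have i2 : Integrable (fun y => excess R (Φ t y - B) ^ (k + 2)) (μ i) :=
    h.integrable_comp_flow ht i (h.integrable_comp ht i (f := fun x => excess R (x - B) ^ (k + 2))
      (by fun_prop))
  have i3 : Integrable (fun y => excess R (Φ t y - B) ^ (k + 1) *
      inner ℝ (Φ t y - B) (measureVelocity α ((μ i).map (Φ t)) (Φ t y))) (μ i) := by
    have hm : StronglyMeasurable fun x => excess R (x - B) ^ (k + 1) *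
        inner ℝ (x - B) (measureVelocity α ((μ i).map (Φ t)) x) :=
      (by fun_prop : Continuous fun x => excess R (x - B) ^ (k + 1)).stronglyMeasurable.mul
        ((by fun_prop : Continuous fun x : Plane => x - B).stronglyMeasurable.inner
          (stronglyMeasurable_measureVelocity h.alpha_pos))
    refine h.integrable_comp_flow ht i (f := fun x => excess R (x - B) ^ (k + 1) *
        inner ℝ (x - B) (measureVelocity α ((μ i).map (Φ t)) x)) ?_
    refine (((h.integrable_comp ht i (f := fun x => excess R (x - B) ^ (k + 1) * ‖x - B‖)
      (by fun_prop)).mul_const (|kernelConst α| * (D * (rieszConst (1 + α) * 1 ^ (1 - α)) +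
      1 ^ (-(1 + α)) * ((μ i).map (Φ t)).real univ))).mono' hm.aestronglyMeasurable
      (ae_of_all _ fun x => ?_))
    rw [norm_mul, Real.norm_of_nonneg (pow_nonneg (excess_nonneg R _) _), mul_assoc]
    refine mul_le_mul_of_nonneg_left ((norm_inner_le_norm _ _).trans ?_)
      (pow_nonneg (excess_nonneg R _) _)
    exact mul_le_mul_of_nonneg_left (norm_measureVelocity_le h.alpha_pos h.alpha_lt_one
      h.D_nonneg (h.density t ht i) one_pos x) (norm_nonneg _)
  have h1 : ∫ y, excessRate α d a μ σ Φ R₀ k i t (Φ t y) ∂μ i ≤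
      ∫ y, 2 * (k + 2) * (σ i * (excess R (Φ t y - B) ^ (k + 1) *
        inner ℝ (Φ t y - B) (measureVelocity α ((μ i).map (Φ t)) (Φ t y))) +
        2 * L * excess R (Φ t y - B) ^ (k + 2)) ∂μ i := by
    refine integral_mono_ae i1 (((i3.const_mul _).add (i2.const_mul _)).const_mul _) ?_
    filter_upwards [h.mem_support i] with y hy
    have hx := h.close i y hy t ht
    rw [dist_eq_norm] at hx
    have h2 := h.excess_external_le hs hJ hi k ht hx
    rw [excessRate, velocity_eq α μ σ Φ t i, add_sub_assoc, inner_add_right, inner_smul_right]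
    have h3 := mul_le_mul_of_nonneg_left h2 (show (0 : ℝ) ≤ 2 * (k + 2) by positivity)
    linarith
  refine h1.trans ?_
  rw [integral_const_mul, integral_add (i3.const_mul _) (i2.const_mul _), integral_const_mul,
    integral_const_mul, mul_assoc (2 * ((k : ℝ) + 2))]
  refine mul_le_mul_of_nonneg_left ?_ (by positivity)
  have h4 := h.abs_integral_excess_self_le hs hJ hi hk ht
  have h5 : σ i * ∫ y, excess R (Φ t y - B) ^ (k + 1) *
      inner ℝ (Φ t y - B) (measureVelocity α ((μ i).map (Φ t)) (Φ t y)) ∂μ i ≤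
      (4 * (k + 1) + 2) * (excessMoment α d a μ Φ R₀ k i t + w ^ (k + 2) * |a i|) := by
    refine (le_abs_self _).trans ?_
    rw [abs_mul, h.sign, one_mul]
    exact h4
  have h6 : 0 ≤ w ^ (k + 2) * |a i| := by
    have := hs.w_nonneg
    positivity
  have h7 : 2 * L * ∫ y, excess R (Φ t y - B) ^ (k + 2) ∂μ i ≤
      2 * L * (excessMoment α d a μ Φ R₀ k i t + w ^ (k + 2) * |a i|) := by
    change 2 * L * excessMoment α d a μ Φ R₀ k i t ≤ _
    gcongr
    linarith
  linarith

/-- The moments of the excess stay small. -/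
lemma excessMoment_le (h : BlobSystem α d D ε b a z μ σ Φ Λ)
    (hs : Scales α d D ε b a J R₀ R₁ r q w)
    (hJ : ∀ t ∈ Icc 0 b, totalMoment z μ Φ t ≤ J) {i : Fin N} (hi : a i ≠ 0) {k : ℕ}
    (hk : 1 ≤ k) {t : ℝ} (ht : t ∈ Icc 0 b) :
    excessMoment α d a μ Φ R₀ k i t ≤ w ^ (k + 2) * |a i| * Real.exp
      (2 * (k + 2) * (4 * (k + 1) + 2 + 2 * (kernelLip α d * ∑ j, |a j|)) * t) := by
  have h1 := le_mul_exp_of_deriv_le (fun s hs' => h.hasDerivWithinAt_excessMoment hs hJ hi k hs')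
    (fun s hs' => h.integral_excessRate_le hs hJ hi hk hs') ht
  have h0 : (0 : ℝ) ∈ Icc 0 b := ⟨le_rfl, ht.1.trans ht.2⟩
  have h2 : ∀ᵐ x ∂(μ i).map (Φ 0), ‖x - z i 0‖ ≤ ε := by
    rw [ae_map_iff (h.measurable 0 h0).aemeasurable
      (measurableSet_le (by fun_prop) measurable_const)]
    filter_upwards [h.mem_support i] with y hy
    rw [← dist_eq_norm]
    exact h.initial i y hy
  have hc : ‖blobCenter μ Φ i 0 - z i 0‖ ≤ ε := by
    have := h.finite i
    refine h.norm_center_sub_le h0 hi h.eps_pos ?_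
    have h3 : ∀ᵐ x ∂(μ i).map (Φ 0), ‖‖x - z i 0‖ ^ 2‖ ≤ ε ^ 2 := by
      filter_upwards [h2] with x hx
      rw [Real.norm_of_nonneg (by positivity)]
      gcongr
    have h4 := norm_integral_le_of_norm_le_const h3
    rw [h.real_map_univ h0] at h4
    linarith [Real.le_norm_self (∫ x, ‖x - z i 0‖ ^ 2 ∂(μ i).map (Φ 0))]
  -- Initially the particles and the center are within `ε` of the pseudo-vortex, and `2ε ≤ R₀`, so
  -- there is no excess.
  have h3 : excessMoment α d a μ Φ R₀ k i 0 = 0 := by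
    refine integral_eq_zero_of_ae ?_
    filter_upwards [h.mem_support i] with y hy
    have h4 := h.initial i y hy
    rw [dist_eq_norm] at h4
    have h5 : ‖Φ 0 y - blobCenter μ Φ i 0‖ ≤ controlRadius α d a R₀ 0 := by
      have h6 : Φ 0 y - blobCenter μ Φ i 0 = (Φ 0 y - z i 0) - (blobCenter μ Φ i 0 - z i 0) := by
        abel
      rw [h6]
      refine (norm_sub_le _ _).trans ?_
      have h7 := hs.two_mul_eps_le
      simp only [controlRadius, mul_zero, Real.exp_zero, mul_one]
      linarith
    rw [excess_eq_zero h5]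
    simp
  rw [h3, zero_add] at h1
  have h6 : 0 ≤ w ^ (k + 2) * |a i| := by
    have := hs.w_nonneg
    positivity
  linarith

end BlobSystem

/-! ### From tiny outer mass to confinement of every particle. -/

namespace BlobSystem

variable {α d D ε b : ℝ} {N : ℕ} {a : Fin N → ℝ} {z : Fin N → ℝ → Plane}
  {μ : Fin N → Measure Plane} {σ : Fin N → ℝ} {Φ : ℝ → Plane → Plane} {Λ : Fin N → Set Plane}
  {J R₀ R₁ r q w : ℝ}

/-- Almost no mass of a blob lies outside twice the control radius. -/
lemma real_centeredBlob_far_le (h : BlobSystem α d D ε b a z μ σ Φ Λ)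
    (hs : Scales α d D ε b a J R₀ R₁ r q w)
    (hJ : ∀ t ∈ Icc 0 b, totalMoment z μ Φ t ≤ J) {i : Fin N} (hi : a i ≠ 0) {k : ℕ}
    (hk : 1 ≤ k) {t : ℝ} (ht : t ∈ Icc 0 b) :
    (centeredBlob μ Φ i t).real {y | 4 * controlRadius α d a R₀ t / 2 ≤ ‖y‖} ≤
      |a i| * (w / (3 * R₀ ^ 2)) ^ (k + 2) * Real.exp
        (2 * (k + 2) * (4 * (k + 1) + 2 + 2 * (kernelLip α d * ∑ j, |a j|)) * b) := by
  have := h.isFiniteMeasure_centeredBlob i t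
  set R := controlRadius α d a R₀ t with hRdef
  have hR : R₀ ≤ R := h.le_controlRadius hs ht
  have hR0 := hs.R_pos
  have hRpos : 0 < R := hR0.trans_le hR
  have hw := hs.w_nonneg
  have hL : 0 ≤ kernelLip α d * ∑ j, |a j| :=
    mul_nonneg h.kernelLip_nonneg (Finset.sum_nonneg fun j _ => abs_nonneg _)
  have hce := continuous_excess R
  have hcont : Continuous fun x => excess R x ^ (k + 2) := by fun_prop
  have h1 := mul_meas_ge_le_integral_of_nonneg (μ := centeredBlob μ Φ i t)
    (f := fun x => excess R x ^ (k + 2))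
    (ae_of_all _ fun x => pow_nonneg (excess_nonneg R x) _)
    (integrable_of_continuous_of_bounded hcont (h.ae_centeredBlob ht i)) ((3 * R₀ ^ 2) ^ (k + 2))
  have h2 : ∫ x, excess R x ^ (k + 2) ∂centeredBlob μ Φ i t = excessMoment α d a μ Φ R₀ k i t :=
    h.integral_centeredBlob ht i hcont.stronglyMeasurable
  -- The radius `2R` is written as half of `4R` to match the core estimate at distance `4R`. Beyond
  -- it the excess is at least `4R² - R² ≥ 3R₀²`.
  have h3 : {y : Plane | 4 * R / 2 ≤ ‖y‖} ⊆
      {x | (3 * R₀ ^ 2) ^ (k + 2) ≤ excess R x ^ (k + 2)} := by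
    intro y hy
    have hy : 4 * R / 2 ≤ ‖y‖ := hy
    have h4 : (2 * R) ^ 2 ≤ ‖y‖ ^ 2 := by
      gcongr
      linarith
    have h5 : 3 * R₀ ^ 2 ≤ excess R y := by
      refine le_trans ?_ (le_max_left _ _)
      have : R₀ ^ 2 ≤ R ^ 2 := by gcongr
      linarith
    exact pow_le_pow_left₀ (by positivity) h5 _
  have h4 := measureReal_mono (μ := centeredBlob μ Φ i t) h3
  have h5 := h.excessMoment_le hs hJ hi hk ht
  have h6 : Real.exp (2 * (k + 2) * (4 * (k + 1) + 2 + 2 * (kernelLip α d * ∑ j, |a j|)) * t) ≤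
      Real.exp (2 * (k + 2) * (4 * (k + 1) + 2 + 2 * (kernelLip α d * ∑ j, |a j|)) * b) := by
    have := ht.2
    gcongr
  rw [h2] at h1
  have h7 : (3 * R₀ ^ 2) ^ (k + 2) *
      (centeredBlob μ Φ i t).real {y | 4 * R / 2 ≤ ‖y‖} ≤ w ^ (k + 2) * |a i| * Real.exp
        (2 * (k + 2) * (4 * (k + 1) + 2 + 2 * (kernelLip α d * ∑ j, |a j|)) * b) := by
    calc _ ≤ (3 * R₀ ^ 2) ^ (k + 2) * (centeredBlob μ Φ i t).real
          {x | (3 * R₀ ^ 2) ^ (k + 2) ≤ excess R x ^ (k + 2)} := by gcongr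
      _ ≤ _ := h1.trans (h5.trans (mul_le_mul_of_nonneg_left h6 (by positivity)))
  rw [← le_div_iff₀' (by positivity)] at h7
  refine h7.trans (le_of_eq ?_)
  rw [div_pow]
  ring

/-- The particles of a blob of nonzero intensity stay close to its center. -/
lemma norm_sub_center_le_controlRadius (h : BlobSystem α d D ε b a z μ σ Φ Λ)
    (hs : Scales α d D ε b a J R₀ R₁ r q w)
    (hJ : ∀ t ∈ Icc 0 b, totalMoment z μ Φ t ≤ J) {i : Fin N} (hi : a i ≠ 0) {k : ℕ}
    (hk : 1 ≤ k) (hq : q ≤ R₀ ^ 2) {r' : ℝ} (hr' : 0 < r')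
    (hfar : |kernelConst α| * (D * (rieszConst (1 + α) * r' ^ (1 - α)) + r' ^ (-(1 + α)) *
      (|a i| * (w / (3 * R₀ ^ 2)) ^ (k + 2) * Real.exp
        (2 * (k + 2) * (4 * (k + 1) + 2 + 2 * (kernelLip α d * ∑ j, |a j|)) * b))) ≤ R₀)
    {y : Plane} (hy : y ∈ Λ i) {t : ℝ} (ht : t ∈ Icc 0 b) :
    ‖Φ t y - blobCenter μ Φ i t‖ ≤ 4 * controlRadius α d a R₀ t := by
  have hα := h.alpha_pos
  have hα1 := h.alpha_lt_one
  have hR0 := hs.R_pos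
  have h0 : (0 : ℝ) ∈ Icc 0 b := ⟨le_rfl, ht.1.trans ht.2⟩
  set L := kernelLip α d * ∑ j, |a j| with hLdef
  have hL : 0 ≤ L := mul_nonneg h.kernelLip_nonneg (Finset.sum_nonneg fun j _ => abs_nonneg _)
  have hfin : 0 < controlRadius α d a R₀ t := hR0.trans_le (h.le_controlRadius hs ht)
  refine (sq_le_sq₀ (norm_nonneg _) (by positivity)).1 ?_
  refine le_of_barrier (b := b) (f := fun t => ‖Φ t y - blobCenter μ Φ i t‖ ^ 2)
    (B := fun t => (4 * controlRadius α d a R₀ t) ^ 2)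
    (B' := fun t => 16 * (2 * growthRate α d a * controlRadius α d a R₀ t ^ 2))
    (fun s hs' =>
      ((h.trajectory i y hy s hs').fun_sub (h.hasDerivWithinAt_blobCenter hs' i)).norm_sq)
    (fun s hs' => ?_) ?_ (fun s hs' heq => ?_) ht
  · have h1 := ((hasDerivAt_controlRadius_sq α d a R₀ s).const_mul 16).hasDerivWithinAt
      (s := Icc 0 b)
    refine h1.congr_of_mem (fun x _ => ?_) hs'
    ring
  · have h1 := h.initial i y hy
    rw [dist_eq_norm] at h1
    have h2 := h.norm_center_sub_le_radius hs hJ h0 hi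
    have h3 : Φ 0 y - blobCenter μ Φ i 0 = (Φ 0 y - z i 0) - (blobCenter μ Φ i 0 - z i 0) := by
      abel
    have h4 := norm_sub_le (Φ 0 y - z i 0) (blobCenter μ Φ i 0 - z i 0)
    rw [← h3] at h4
    have h5 := hs.two_mul_eps_le
    have h6 := h.eps_pos
    simp only [controlRadius, mul_zero, Real.exp_zero, mul_one]
    gcongr
    linarith
  · have := h.finite i
    have := h.isFiniteMeasure_centeredBlob i s
    set R := controlRadius α d a R₀ s with hRdef
    set X := Φ s y - blobCenter μ Φ i s with hX
    set ν := centeredBlob μ Φ i s with hν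
    have hR : R₀ ≤ R := h.le_controlRadius hs hs'
    have hRpos : 0 < R := hR0.trans_le hR
    have hXR : ‖X‖ = 4 * R :=
      (sq_eq_sq₀ (norm_nonneg _) (by positivity)).1 heq
    have hc := h.ae_centeredBlob hs' i
    have hν1 := h.centeredBlob_le hs' i
    have hE : MeasurableSet {y : Plane | 4 * R / 2 ≤ ‖y‖} :=
      measurableSet_le measurable_const measurable_norm
    have hsplit : measureVelocity α ((μ i).map (Φ s)) (Φ s y) =
        measureVelocity α (ν.restrict {y | 4 * R / 2 ≤ ‖y‖}ᶜ) X +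
          measureVelocity α (ν.restrict {y | 4 * R / 2 ≤ ‖y‖}) X := by
      rw [← measureVelocity_map_sub hα ((μ i).map (Φ s)) (blobCenter μ Φ i s), add_comm]
      exact (integral_add_compl hE (integrable_kernel hα hα1 hν1 X)).symm
    have hJ0 : ∫ y, ‖y‖ ^ 2 ∂ν ≤ J :=
      (h.integral_sq_centeredBlob_le hs' hi).trans (h.integral_sq_le hJ hs' i)
    have hI0 : 0 ≤ ∫ y, ‖y‖ ^ 2 ∂ν := integral_nonneg fun y => by positivity
    have hcore : |inner ℝ X (measureVelocity α (ν.restrict {y | 4 * R / 2 ≤ ‖y‖}ᶜ) X)| ≤ q := by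
      refine (abs_integral_core_le hα hα1 hν1 hc (h.integral_id_centeredBlob hs' hi)
        (show 0 < 4 * R by positivity) hXR.ge).trans (le_trans ?_ hs.core)
      have h1 : (4 * R) ^ (-(2 + α)) ≤ R₀ ^ (-(2 + α)) :=
        Real.rpow_le_rpow_of_nonpos hR0 (by linarith) (by linarith)
      have h2 := Real.rpow_nonneg hR0.le (-(2 + α))
      have hcc := coreConst_nonneg hα
      exact mul_le_mul (mul_le_mul_of_nonneg_left h1 hcc) hJ0 hI0 (by positivity)
    -- The mass beyond `2R` is now so small that the crude velocity bound, without any cancellation,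
    -- gives at most `R₀`.
    have hout : |inner ℝ X (measureVelocity α (ν.restrict {y | 4 * R / 2 ≤ ‖y‖}) X)| ≤
        4 * R * R₀ := by
      refine (abs_real_inner_le_norm _ _).trans ?_
      rw [hXR]
      refine mul_le_mul_of_nonneg_left (le_trans ?_ hfar) (by positivity)
      refine (norm_measureVelocity_le hα hα1 h.D_nonneg (Measure.restrict_le_self.trans hν1)
        hr' X).trans ?_
      rw [measureReal_restrict_apply_univ]
      have h1 := h.real_centeredBlob_far_le hs hJ hi hk hs'
      have h2 := Real.rpow_nonneg hr'.le (-(1 + α))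
      gcongr
    have hclose := h.close i y hy s hs'
    rw [dist_eq_norm] at hclose
    have hext := h.norm_externalField_sub_centerVelocity_le hs' hi hR0
      ((h.integral_sq_le hJ hs' i).trans (hs.moment_le i hi)) hclose
    have hext' : inner ℝ X (externalField α μ σ Φ i s (Φ s y) - centerVelocity α μ σ Φ i s) ≤
        4 * R * (L * (4 * R + R₀)) := by
      refine (real_inner_le_norm _ _).trans ?_
      rw [← hX, hXR] at hext
      rw [hXR]
      exact mul_le_mul_of_nonneg_left hext (by positivity)
    rw [velocity_eq α μ σ Φ s i, add_sub_assoc, inner_add_right, inner_smul_right, hsplit,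
      inner_add_right]
    have hself : σ i * (inner ℝ X (measureVelocity α (ν.restrict {y | 4 * R / 2 ≤ ‖y‖}ᶜ) X) +
        inner ℝ X (measureVelocity α (ν.restrict {y | 4 * R / 2 ≤ ‖y‖}) X)) ≤
        q + 4 * R * R₀ := by
      refine (le_abs_self _).trans ?_
      rw [abs_mul, h.sign, one_mul]
      exact (abs_add_le _ _).trans (add_le_add hcore hout)
    -- At contact, half the derivative of `‖X‖²` is at most `q + 4RR₀ + 4RL(4R + R₀) ≤ 5R² + 20LR²`,
    -- strictly below half the derivative of the barrier, `16(2L + 1)R²`.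
    have hLR : L * R * R₀ ≤ L * R * R := by gcongr
    have hRR : R * R₀ ≤ R * R := by gcongr
    have hRR2 : R₀ ^ 2 ≤ R ^ 2 := by gcongr
    have hpos : 0 < R ^ 2 := by positivity
    have hLR2 : 0 ≤ L * R ^ 2 := by positivity
    rw [growthRate, ← hLdef]
    nlinarith

/-- The particles of a blob of zero intensity stay close to the pseudo-vortex. -/
lemma norm_sub_vortex_le_controlRadius (h : BlobSystem α d D ε b a z μ σ Φ Λ)
    (hs : Scales α d D ε b a J R₀ R₁ r q w)
    (hJ : ∀ t ∈ Icc 0 b, totalMoment z μ Φ t ≤ J) {i : Fin N} (hi : a i = 0)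
    {y : Plane} (hy : y ∈ Λ i) {t : ℝ} (ht : t ∈ Icc 0 b) :
    ‖Φ t y - z i t‖ ≤ controlRadius α d a R₀ t := by
  have hR0 := hs.R_pos
  have hL0 := h.kernelLip_nonneg
  have hA : 0 ≤ ∑ j, |a j| := Finset.sum_nonneg fun j _ => abs_nonneg _
  have hfin : 0 < controlRadius α d a R₀ t := hR0.trans_le (h.le_controlRadius hs ht)
  refine (sq_le_sq₀ (norm_nonneg _) hfin.le).1 ?_
  refine le_of_barrier (b := b) (f := fun t => ‖Φ t y - z i t‖ ^ 2)
    (B := fun t => controlRadius α d a R₀ t ^ 2)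
    (B' := fun t => 2 * growthRate α d a * controlRadius α d a R₀ t ^ 2)
    (fun s hs' => ((h.trajectory i y hy s hs').fun_sub (h.motion i s hs')).norm_sq)
    (fun s _ => (hasDerivAt_controlRadius_sq α d a R₀ s).hasDerivWithinAt) ?_
    (fun s hs' heq => ?_) ht
  · have h1 := h.initial i y hy
    rw [dist_eq_norm] at h1
    have h5 := hs.two_mul_eps_le
    have h6 := h.eps_pos
    simp only [controlRadius, mul_zero, Real.exp_zero, mul_one]
    gcongr
    linarith
  · set R := controlRadius α d a R₀ s with hRdef
    have hR : R₀ ≤ R := h.le_controlRadius hs hs'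
    have hRpos : 0 < R := hR0.trans_le hR
    have hXR : ‖Φ s y - z i s‖ = R := (sq_eq_sq₀ (norm_nonneg _) hRpos.le).1 heq
    -- A blob of definite sign and zero intensity is the null measure, yet `Λ i` may be nonempty: in
    -- the application it is the closed support of a density vanishing only almost everywhere. Such
    -- particles feel only the other blobs.
    have hzero : μ i = 0 := by
      have := h.finite i
      have h1 := h.real_univ i
      rw [hi, abs_zero] at h1
      exact Measure.measure_univ_eq_zero.1 ((measureReal_eq_zero_iff).1 h1)
    have hself : measureVelocity α ((μ i).map (Φ s)) (Φ s y) = 0 := by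
      simp [measureVelocity, hzero]
    have hP : ∑ j, ∫ v, ‖v - z j s‖ ∂(μ j).map (Φ s) ≤ (∑ j, |a j|) * R := by
      refine abs_le_of_sq_le_sq' ?_ (by positivity) |>.2
      refine (h.sq_sum_integral_norm_le hs').trans ?_
      calc (∑ j, |a j|) * totalMoment z μ Φ s
          ≤ (∑ j, |a j|) * ((∑ j, |a j|) * R ^ 2) := by
            gcongr
            refine (hJ s hs').trans (hs.moment_le_total.trans ?_)
            gcongr
        _ = _ := by ring
    have hclose := h.close i y hy s hs'
    rw [dist_eq_norm] at hclose
    have hext := h.norm_externalField_sub_vortex_le hs' hclose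
    rw [hXR] at hext
    rw [velocity_eq α μ σ Φ s i, hself, smul_zero, zero_add]
    have h2 := real_inner_le_norm (Φ s y - z i s) (externalField α μ σ Φ i s (Φ s y) -
      ∑ j ∈ Finset.univ.erase i, a j • kernel α (z i s - z j s))
    rw [hXR] at h2
    have h3 : R * ‖externalField α μ σ Φ i s (Φ s y) -
        ∑ j ∈ Finset.univ.erase i, a j • kernel α (z i s - z j s)‖ ≤
        R * (kernelLip α d * ((∑ j, |a j|) * R + (∑ j, |a j|) * R)) := by
      refine mul_le_mul_of_nonneg_left (hext.trans ?_) hRpos.le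
      gcongr
    have hpos : 0 < R ^ 2 := by positivity
    rw [growthRate]
    nlinarith

/-- Localization of the blobs around the pseudo-vortices. -/
lemma dist_le (h : BlobSystem α d D ε b a z μ σ Φ Λ)
    (hs : Scales α d D ε b a J R₀ R₁ r q w)
    (hJ : ∀ t ∈ Icc 0 b, totalMoment z μ Φ t ≤ J) {k : ℕ} (hk : 1 ≤ k) (hq : q ≤ R₀ ^ 2)
    {r' : ℝ} (hr' : 0 < r')
    (hfar : ∀ i, |kernelConst α| * (D * (rieszConst (1 + α) * r' ^ (1 - α)) + r' ^ (-(1 + α)) *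
      (|a i| * (w / (3 * R₀ ^ 2)) ^ (k + 2) * Real.exp
        (2 * (k + 2) * (4 * (k + 1) + 2 + 2 * (kernelLip α d * ∑ j, |a j|)) * b))) ≤ R₀)
    {i : Fin N} {y : Plane} (hy : y ∈ Λ i) {t : ℝ} (ht : t ∈ Icc 0 b) :
    dist (Φ t y) (z i t) ≤ 5 * R₁ := by
  rw [dist_eq_norm]
  have h1 := h.controlRadius_le hs ht
  have h2 := h.le_controlRadius hs ht
  have h3 := hs.R_pos
  by_cases hi : a i = 0
  · have := h.norm_sub_vortex_le_controlRadius hs hJ hi hy ht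
    linarith
  · have h4 := h.norm_sub_center_le_controlRadius hs hJ hi hk hq hr' (hfar i) hy ht
    have h5 := h.norm_center_sub_le_radius hs hJ ht hi
    have h6 : Φ t y - z i t = (Φ t y - blobCenter μ Φ i t) + (blobCenter μ Φ i t - z i t) := by
      abel
    rw [h6]
    refine (norm_add_le _ _).trans ?_
    linarith

end BlobSystem

/-! ### From a weak solution with particle flow to a system of blobs. -/

/-- The sign of a blob. -/
def blobSign (f : Plane → ℝ) : ℝ := by
  classical
  exact if ∀ x, 0 ≤ f x then 1 else -1

/-- The distribution of the intensity of a blob. -/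
def blobMeasure (f : Plane → ℝ) : Measure Plane :=
  volume.withDensity fun x => ENNReal.ofReal |f x|

lemma abs_blobSign (f : Plane → ℝ) : |blobSign f| = 1 := by
  unfold blobSign
  split_ifs <;> simp

lemma blobSign_mul_abs {f : Plane → ℝ} (hf : (∀ x, 0 ≤ f x) ∨ ∀ x, f x ≤ 0) (x : Plane) :
    blobSign f * |f x| = f x := by
  unfold blobSign
  split_ifs with h
  · rw [abs_of_nonneg (h x), one_mul]
  · rw [abs_of_nonpos ((hf.resolve_left h) x)]
    ring

section BlobMeasure

variable {f : Plane → ℝ}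

lemma aemeasurable_ofReal_abs (hf : Integrable f) :
    AEMeasurable (fun x => ENNReal.ofReal |f x|) volume :=
  hf.abs.aestronglyMeasurable.aemeasurable.ennreal_ofReal

lemma isFiniteMeasure_blobMeasure (hf : Integrable f) : IsFiniteMeasure (blobMeasure f) :=
  isFiniteMeasure_withDensity_ofReal hf.abs.2

lemma integral_blobMeasure {E : Type*} [NormedAddCommGroup E] [NormedSpace ℝ E]
    (hf : Integrable f) (g : Plane → E) : ∫ x, g x ∂blobMeasure f = ∫ x, |f x| • g x := by
  rw [blobMeasure, integral_withDensity_eq_integral_toReal_smul₀ (aemeasurable_ofReal_abs hf)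
    (ae_of_all _ fun x => ENNReal.ofReal_lt_top)]
  simp only [ENNReal.toReal_ofReal (abs_nonneg _)]

lemma integrable_blobMeasure_iff {E : Type*} [NormedAddCommGroup E] [NormedSpace ℝ E]
    (hf : Integrable f) {g : Plane → E} :
    Integrable g (blobMeasure f) ↔ Integrable fun x => |f x| • g x := by
  rw [blobMeasure, integrable_withDensity_iff_integrable_smul₀' (aemeasurable_ofReal_abs hf)
    (ae_of_all _ fun x => ENNReal.ofReal_lt_top)]
  simp only [ENNReal.toReal_ofReal (abs_nonneg _)]

lemma ae_blobMeasure_mem_tsupport (hf : Integrable f) : ∀ᵐ x ∂blobMeasure f, x ∈ tsupport f := by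
  rw [blobMeasure, ae_withDensity_iff' (aemeasurable_ofReal_abs hf)]
  refine ae_of_all _ fun x hx => subset_tsupport f ?_
  intro h0
  simp [h0] at hx

lemma blobMeasure_le {D : ℝ} (hD : ∀ x, |f x| ≤ D) :
    blobMeasure f ≤ ENNReal.ofReal D • volume := by
  rw [← withDensity_const]
  exact withDensity_mono (ae_of_all _ fun x => ENNReal.ofReal_le_ofReal (hD x))

lemma blobSign_mul_real_univ (hf : Integrable f) (hs : (∀ x, 0 ≤ f x) ∨ ∀ x, f x ≤ 0) :
    blobSign f * (blobMeasure f).real univ = ∫ x, f x := by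
  have := isFiniteMeasure_blobMeasure hf
  have h1 : (blobMeasure f).real univ = ∫ x, |f x| := by
    have h2 := integral_blobMeasure hf (fun _ => (1 : ℝ))
    simpa using h2
  rw [h1, ← integral_const_mul]
  simp only [blobSign_mul_abs hs]

end BlobMeasure

lemma IsConcentratedDatum.eq_zero {N : ℕ} {a : Fin N → ℝ} {z₀ : Fin N → Plane} {M ε : ℝ}
    {θ₀ : Fin N → Plane → ℝ} (h : IsConcentratedDatum a z₀ M ε θ₀) {i : Fin N} {x : Plane}
    (hx : x ∉ Metric.ball (z₀ i) ε) : θ₀ i x = 0 :=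
  image_eq_zero_of_notMem_tsupport fun hm => hx (h.support i hm)

/-- The disks are disjoint, so on the disk of blob `i` the total datum coincides with this blob. -/
lemma IsConcentratedDatum.abs_le {N : ℕ} {a : Fin N → ℝ} {z₀ : Fin N → Plane} {M ε : ℝ}
    {θ₀ : Fin N → Plane → ℝ} (h : IsConcentratedDatum a z₀ M ε θ₀) (i : Fin N) (x : Plane) :
    |θ₀ i x| ≤ M * ε ^ (-2 : ℤ) := by
  by_cases hx : x ∈ Metric.ball (z₀ i) ε
  · have h1 : ∑ j, θ₀ j x = θ₀ i x := by
      refine Finset.sum_eq_single i (fun j _ hj => h.eq_zero fun hxj => ?_) (by simp)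
      exact Set.disjoint_left.1 (h.disjoint j i hj) hxj hx
    rw [← h1]
    exact h.bound x
  · rw [h.eq_zero hx, abs_zero]
    exact (abs_nonneg _).trans (h.bound x)

/-- Area preservation allows the change of variables along the flow, and conservation of `θ` turns
the integrand into the initial datum, which splits into blobs of definite sign. -/
lemma velocity_eq_sum {α : ℝ} (hα₀ : 0 < α) (hα₁ : α < 1) {N : ℕ} {a : Fin N → ℝ}
    {z₀ : Fin N → Plane} {M ε : ℝ} {θ₀ : Fin N → Plane → ℝ}
    (h : IsConcentratedDatum a z₀ M ε θ₀) {θt : Plane → ℝ} {Φt : Plane → Plane}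
    (hθ : Integrable θt) (hΦ : MeasurePreserving Φt volume volume)
    (htr : ∀ᵐ x₀, θt (Φt x₀) = ∑ i, θ₀ i x₀) (x : Plane) :
    velocity α θt x =
      ∑ j, blobSign (θ₀ j) • measureVelocity α ((blobMeasure (θ₀ j)).map Φt) x := by
  have hK : Measurable fun y => kernel α (x - y) :=
    (measurable_kernel hα₀).comp (measurable_const.sub measurable_id)
  have h1 : velocity α θt x = ∫ y, θt (Φt y) • kernel α (x - Φt y) := by
    rw [velocity]
    nth_rewrite 1 [← hΦ.map_eq]
    refine integral_map hΦ.measurable.aemeasurable ?_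
    rw [hΦ.map_eq]
    exact hθ.aestronglyMeasurable.smul hK.aestronglyMeasurable
  have h2 : velocity α θt x = ∫ y, ∑ j, θ₀ j y • kernel α (x - Φt y) := by
    rw [h1]
    refine integral_congr_ae ?_
    filter_upwards [htr] with y hy
    rw [hy, Finset.sum_smul]
  have hfin := fun j => isFiniteMeasure_blobMeasure (h.integrable j)
  have hden : ∀ j, (blobMeasure (θ₀ j)).map Φt ≤ ENNReal.ofReal (M * ε ^ (-2 : ℤ)) • volume := by
    intro j
    refine (Measure.map_mono (blobMeasure_le (h.abs_le j)) hΦ.measurable).trans_eq ?_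
    rw [Measure.map_smul, hΦ.map_eq]
  have hint : ∀ j, Integrable fun y => θ₀ j y • kernel α (x - Φt y) := by
    intro j
    have h3 := (integrable_kernel hα₀ hα₁ (hden j) x).comp_measurable hΦ.measurable
    have h4 := (integrable_blobMeasure_iff (h.integrable j)).1 h3
    refine (h4.smul (blobSign (θ₀ j))).congr (ae_of_all _ fun y => ?_)
    simp only [Pi.smul_apply, Function.comp]
    rw [smul_smul, blobSign_mul_abs (h.sign j)]
  rw [h2, integral_finsetSum _ fun j _ => hint j]
  refine Finset.sum_congr rfl fun j _ => ?_
  rw [measureVelocity, integral_map hΦ.measurable.aemeasurable hK.aestronglyMeasurable,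
    integral_blobMeasure (h.integrable j), ← integral_smul]
  simp only [smul_smul, blobSign_mul_abs (h.sign j)]

/-- A concentrated solution defines a system of blobs as long as it is localized. -/
lemma blobSystem_of_solution {α : ℝ} (hα₀ : 0 < α) (hα₁ : α < 1) {N : ℕ} {a : Fin N → ℝ}
    {z₀ : Fin N → Plane} {z : Fin N → ℝ → Plane} {M ε d b : ℝ} {θ₀ : Fin N → Plane → ℝ}
    {T : EReal} {θ : ℝ → Plane → ℝ} {Φ : ℝ → Plane → Plane} (hM : 0 < M) (hε : 0 < ε)
    (hd : 0 < d) (hz : IsPseudoVortexSolution α a z₀ z)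
    (hsep : ∀ t : ℝ, 0 ≤ t → ∀ i j, i ≠ j → d ≤ dist (z i t) (z j t))
    (h : IsConcentratedDatum a z₀ M ε θ₀) (h0 : ∀ x, θ 0 x = ∑ i, θ₀ i x)
    (hw : IsWeakSolution α T θ) (hp : IsParticleFlow α T θ Φ) (hb : (b : EReal) < T)
    (hclose : ∀ i, ∀ y ∈ tsupport (θ₀ i), ∀ t ∈ Icc 0 b, dist (Φ t y) (z i t) ≤ d / 4) :
    BlobSystem α d (M * ε ^ (-2 : ℤ)) ε b a z (fun i => blobMeasure (θ₀ i))
      (fun i => blobSign (θ₀ i)) Φ (fun i => tsupport (θ₀ i)) := by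
  have hT : ∀ t ∈ Icc 0 b, (t : EReal) < T := fun t ht =>
    (EReal.coe_le_coe_iff.2 ht.2).trans_lt hb
  refine
    { alpha_pos := hα₀
      alpha_lt_one := hα₁
      d_pos := hd
      D_nonneg := by positivity
      eps_pos := hε
      finite := fun i => isFiniteMeasure_blobMeasure (h.integrable i)
      sign := fun i => abs_blobSign _
      mass := fun i => (blobSign_mul_real_univ (h.integrable i) (h.sign i)).trans (h.intensity i)
      mem_support := fun i => ae_blobMeasure_mem_tsupport (h.integrable i)
      measurable := fun t ht => (hp.measurePreserving t ht.1 (hT t ht)).measurable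
      density := fun t ht i => ?_
      initial := fun i y hy => ?_
      trajectory := fun i y hy t ht => ?_
      close := hclose
      motion := fun i t ht => (hz.motion i t ht.1).mono Icc_subset_Ici_self
      separated := fun t ht => hsep t ht.1 }
  · have hΦ := hp.measurePreserving t ht.1 (hT t ht)
    refine (Measure.map_mono (blobMeasure_le (h.abs_le i)) hΦ.measurable).trans_eq ?_
    rw [Measure.map_smul, hΦ.map_eq]
  · rw [hp.initial, hz.initial]
    exact (Metric.mem_ball.1 (h.support i hy)).le
  · have h1 := (hp.trajectory y t ht.1 (hT t ht)).mono (Icc_subset_Ici_self : Icc 0 b ⊆ Ici 0)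
    rwa [velocity_eq_sum hα₀ hα₁ h (hw.integrable t ht.1 (hT t ht))
      (hp.measurePreserving t ht.1 (hT t ht))
      (by simpa only [h0] using hp.transport t ht.1 (hT t ht))] at h1

/-! ### Choice of the exponents and length scales. -/

lemma eventually_mul_rpow_le_one (c : ℝ) {e : ℝ} (he : 0 < e) :
    ∀ᶠ ε : ℝ in nhdsWithin 0 (Ioi 0), c * ε ^ e ≤ 1 := by
  have h1 : Filter.Tendsto (fun ε : ℝ => c * ε ^ e) (nhds 0) (nhds (c * 0 ^ e)) :=
    (Real.continuousAt_rpow_const 0 e (Or.inr he.le)).tendsto.const_mul c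
  rw [Real.zero_rpow he.ne', mul_zero] at h1
  exact (h1.mono_left nhdsWithin_le_nhds).eventually_le_const one_pos

lemma mul_rpow_le_rpow {ε c e e₁ e₂ : ℝ} (hε : 0 < ε) (h : c * ε ^ e₁ ≤ 1) (he : e = e₁ + e₂) :
    c * ε ^ e ≤ ε ^ e₂ := by
  rw [he, Real.rpow_add hε, ← mul_assoc]
  exact mul_le_of_le_one_left (Real.rpow_nonneg hε.le _) h

/-- The constant in the bound for the self-interaction of the blobs. -/
def selfConst (α M A : ℝ) : ℝ :=
  coreConst α * A + |kernelConst α| * (M * rieszConst α + 4 * A)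

section Parameters

variable {α d M β β' δ χ κ ε b : ℝ} {N : ℕ} {a : Fin N → ℝ} {k : ℕ}

/-- Since `exp(Cζ|log ε|) = ε^(-Cζ)`, a logarithmic time costs only a small power of `ε`. -/
lemma exp_mul_le_rpow (hε : 0 < ε) (hε1 : ε < 1) {C ζ c : ℝ} (hb : 0 ≤ b)
    (hbζ : b ≤ ζ * |Real.log ε|) (hc : c ≤ C) (hC : 0 ≤ C) (hCζ : C * ζ ≤ χ) :
    Real.exp (c * b) ≤ ε ^ (-χ) := by
  rw [Real.rpow_def_of_pos hε]
  refine Real.exp_le_exp.2 ?_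
  have hlog : Real.log ε < 0 := Real.log_neg hε hε1
  rw [abs_of_neg hlog] at hbζ
  calc c * b ≤ C * b := by gcongr
    _ ≤ C * (ζ * -Real.log ε) := by gcongr
    _ = (C * ζ) * -Real.log ε := by ring
    _ ≤ χ * -Real.log ε := mul_le_mul_of_nonneg_right hCζ (by linarith)
    _ = Real.log ε * -χ := by ring

/-- The cutoff `ε^(2-β')` balances the density `ε^(-2)` against the outer mass `ε^(2-2β')`, up to
`χ`. With `δ` the distance to the threshold, `q` is smaller than `R₀²` by `ε^(δ-χ)`, and `w`,
smaller than `R₀²` by only `ε^(δ/4)`, leaves room for `q R₁² ≤ w²`. -/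
lemma scales_of_small (hα₀ : 0 < α) (hα₁ : α < 1) (hM : 0 < M) (hε : 0 < ε) (hε1 : ε < 1)
    (hβ'1 : β' < 1) (hχ : 0 < χ)
    (hδ : δ = 2 - 2 * α - (4 - α) * β')
    (hexp : Real.exp (growthRate α d a * b) ≤ ε ^ (-χ))
    (hsmall_eps : 2 * ε ^ (1 - β') ≤ 1)
    (hsmall_mass : ∀ i, (∑ j, |a j|) / |a i| * ε ^ (2 - χ - 2 * β') ≤ 1)
    (hsmall_one : 1 * ε ^ (2 - χ - 2 * β') ≤ 1)
    (hsmall_w : selfConst α M (∑ j, |a j|) * ε ^ (3 * δ / 4 - χ) ≤ 1)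
    (hsmall_w2 : selfConst α M (∑ j, |a j|) * ε ^ (δ / 2 - 3 * χ) ≤ 1) :
    Scales α d (M * ε ^ (-2 : ℤ)) ε b a ((∑ j, |a j|) * ε ^ (2 - χ)) (ε ^ β') (ε ^ (β' - χ))
      (ε ^ (2 - β')) (selfConst α M (∑ j, |a j|) * ε ^ (δ - χ + 2 * β'))
      (ε ^ (δ / 4 + 2 * β')) := by
  set A := ∑ j, |a j| with hA
  have hA0 : 0 ≤ A := Finset.sum_nonneg fun j _ => abs_nonneg _
  have hcc := coreConst_nonneg hα₀
  have hrc := rieszConst_nonneg (γ := α) (by linarith)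
  have hpos : ∀ e : ℝ, 0 < ε ^ e := fun e => Real.rpow_pos_of_pos hε e
  have hR2 : (ε ^ β') ^ 2 = ε ^ (2 * β') := by
    rw [← Real.rpow_natCast, ← Real.rpow_mul hε.le]
    congr 1
    push_cast
    ring
  have hz2 : ε ^ (-2 : ℤ) = ε ^ (-2 : ℝ) := by
    rw [← Real.rpow_intCast]
    norm_num
  refine
    { R_pos := hpos _
      r_pos := hpos _
      two_mul_eps_le := ?_
      moment_le := fun i hi => ?_
      moment_le_total := ?_
      core := ?_
      outer := ?_
      w_nonneg := (hpos _).le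
      q_le := mul_rpow_le_rpow hε hsmall_w (by ring)
      q_mul_le := ?_
      exp_le := ?_ }
  · have := mul_rpow_le_rpow (e := 1) (e₂ := β') hε hsmall_eps (by ring)
    rwa [Real.rpow_one] at this
  · have h1 := mul_rpow_le_rpow (e := 2 - χ) (e₂ := 2 * β') hε (hsmall_mass i) (by ring)
    have h2 : 0 < |a i| := abs_pos.2 hi
    rw [hR2]
    calc A * ε ^ (2 - χ) = |a i| * (A / |a i| * ε ^ (2 - χ)) := by field_simp
      _ ≤ _ := by gcongr
  · have h1 := mul_rpow_le_rpow (e := 2 - χ) (e₂ := 2 * β') hε hsmall_one (by ring)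
    rw [hR2]
    rw [one_mul] at h1
    gcongr
  · have h1 : coreConst α * (ε ^ β') ^ (-(2 + α)) * (A * ε ^ (2 - χ)) =
        coreConst α * A * ε ^ (β' * -(2 + α) + (2 - χ)) := by
      rw [← Real.rpow_mul hε.le, Real.rpow_add hε]
      ring
    -- The exponent of the core exceeds that of `q` by `2α(1 - β')`, so the outer part is the
    -- limiting one.
    have h2 : ε ^ (β' * -(2 + α) + (2 - χ)) ≤ ε ^ (δ - χ + 2 * β') :=
      Real.rpow_le_rpow_of_exponent_ge hε hε1.le (by rw [hδ]; nlinarith)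
    rw [h1, selfConst, add_mul]
    have h3 : 0 ≤ |kernelConst α| * (M * rieszConst α + 4 * A) * ε ^ (δ - χ + 2 * β') := by
      have := hpos (δ - χ + 2 * β')
      positivity
    have h4 : coreConst α * A * ε ^ (β' * -(2 + α) + (2 - χ)) ≤
        coreConst α * A * ε ^ (δ - χ + 2 * β') := by gcongr
    linarith
  · have h1 : M * ε ^ (-2 : ℤ) * (rieszConst α * (ε ^ (2 - β')) ^ (2 - α)) =
        M * rieszConst α * ε ^ (-2 + (2 - β') * (2 - α)) := by
      rw [hz2, ← Real.rpow_mul hε.le, Real.rpow_add hε]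
      ring
    have h2 : ε ^ (-2 + (2 - β') * (2 - α)) ≤ ε ^ (δ - χ + 2 * β') :=
      Real.rpow_le_rpow_of_exponent_ge hε hε1.le (by rw [hδ]; nlinarith)
    have h3 : (ε ^ (2 - β')) ^ (-α) * (4 * (A * ε ^ (2 - χ)) / (ε ^ β') ^ 2) =
        4 * A * ε ^ (δ - χ + 2 * β') := by
      have h4 : δ - χ + 2 * β' = (2 - β') * -α + (2 - χ) - 2 * β' := by rw [hδ]; ring
      rw [hR2, h4, Real.rpow_sub hε ((2 - β') * -α + (2 - χ)), Real.rpow_add hε,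
        ← Real.rpow_mul hε.le]
      ring
    rw [h1, h3, selfConst, add_mul]
    have h5 : 0 ≤ coreConst α * A * ε ^ (δ - χ + 2 * β') := by
      have := hpos (δ - χ + 2 * β')
      positivity
    have h6 : |kernelConst α| * (M * rieszConst α * ε ^ (-2 + (2 - β') * (2 - α)) +
        4 * A * ε ^ (δ - χ + 2 * β')) ≤
        |kernelConst α| * (M * rieszConst α * ε ^ (δ - χ + 2 * β') +
        4 * A * ε ^ (δ - χ + 2 * β')) := by gcongr
    linarith
  · have h1 : selfConst α M A * ε ^ (δ - χ + 2 * β') * (ε ^ (β' - χ)) ^ 2 =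
        selfConst α M A * ε ^ (δ - χ + 2 * β' + (β' - χ) * 2) := by
      rw [Real.rpow_add hε (δ - χ + 2 * β'), Real.rpow_mul hε.le (β' - χ), mul_assoc]
      norm_num
    have h2 : (ε ^ (δ / 4 + 2 * β')) ^ 2 = ε ^ ((δ / 4 + 2 * β') * 2) := by
      rw [Real.rpow_mul hε.le]
      norm_num
    rw [h1, h2]
    exact mul_rpow_le_rpow hε hsmall_w2 (by ring)
  · calc ε ^ β' * Real.exp (growthRate α d a * b) ≤ ε ^ β' * ε ^ (-χ) := by
          have := hpos β'
          gcongr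
      _ = _ := by rw [← Real.rpow_add hε, sub_eq_add_neg]

/-- With cutoff `ε^κ` and `κ(1-α) = 4` the density term is of order `ε^(-2+4) = ε²`. The mass term
carries `ε^(-κ(1+α))`, which the power `(k+2)δ/4` coming from the high moment outweighs, again
leaving `ε²`. -/
lemma far_le_of_small (hα₁ : α < 1) (hε : 0 < ε) (hε1 : ε < 1)
    (hχ1 : χ ≤ 1) (hκ : κ * (1 - α) = 4) (hk : κ * (1 + α) + 3 ≤ δ / 4 * (k + 2)) {C : ℝ}
    (hexp : Real.exp (C * b) ≤ ε ^ (-χ))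
    (hsmall : |kernelConst α| * (M * rieszConst (1 + α) + ∑ j, |a j|) * ε ^ (2 - β') ≤ 1)
    (i : Fin N) :
    |kernelConst α| * (M * ε ^ (-2 : ℤ) * (rieszConst (1 + α) * (ε ^ κ) ^ (1 - α)) +
      (ε ^ κ) ^ (-(1 + α)) * (|a i| * (ε ^ (δ / 4 + 2 * β') / (3 * (ε ^ β') ^ 2)) ^ (k + 2) *
        Real.exp (C * b))) ≤ ε ^ β' := by
  have hrc := rieszConst_nonneg (γ := 1 + α) (by linarith)
  have hpos : ∀ e : ℝ, 0 < ε ^ e := fun e => Real.rpow_pos_of_pos hε e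
  have hz2 : ε ^ (-2 : ℤ) = ε ^ (-2 : ℝ) := by
    rw [← Real.rpow_intCast]
    norm_num
  have h1 : M * ε ^ (-2 : ℤ) * (rieszConst (1 + α) * (ε ^ κ) ^ (1 - α)) =
      M * rieszConst (1 + α) * ε ^ (2 : ℝ) := by
    rw [hz2, ← Real.rpow_mul hε.le, hκ, show (2 : ℝ) = -2 + 4 by norm_num, Real.rpow_add hε]
    norm_num
    ring
  have h2 : ε ^ (δ / 4 + 2 * β') / (3 * (ε ^ β') ^ 2) ≤ ε ^ (δ / 4) := by
    have h3 : ε ^ (δ / 4 + 2 * β') = ε ^ (δ / 4) * (ε ^ β') ^ 2 := by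
      rw [Real.rpow_add hε, mul_comm 2 β', Real.rpow_mul hε.le]
      norm_num
    have h4 := hpos β'
    have h5 := hpos (δ / 4)
    rw [h3, div_le_iff₀ (by positivity)]
    nlinarith [mul_pos h5 (pow_pos h4 2)]
  have h3 : (ε ^ κ) ^ (-(1 + α)) * (|a i| *
      (ε ^ (δ / 4 + 2 * β') / (3 * (ε ^ β') ^ 2)) ^ (k + 2) * Real.exp (C * b)) ≤
      |a i| * ε ^ (2 : ℝ) := by
    have h4 := hpos (δ / 4 + 2 * β')
    have h5 := hpos β'
    have h6 := hpos κ
    calc _ ≤ (ε ^ κ) ^ (-(1 + α)) * (|a i| * (ε ^ (δ / 4)) ^ (k + 2) * ε ^ (-χ)) := by gcongr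
      _ = |a i| * ε ^ (κ * -(1 + α) + δ / 4 * (k + 2) + -χ) := by
          rw [Real.rpow_add hε, Real.rpow_add hε, Real.rpow_mul hε.le κ,
            Real.rpow_mul hε.le (δ / 4), show ((k : ℝ) + 2) = ((k + 2 : ℕ) : ℝ) by push_cast; ring,
            Real.rpow_natCast]
          ring
      _ ≤ _ := by
          have := Real.rpow_le_rpow_of_exponent_ge hε hε1.le
            (show 2 ≤ κ * -(1 + α) + δ / 4 * (k + 2) + -χ by linarith)
          gcongr
  have h4 : |a i| ≤ ∑ j, |a j| :=
    Finset.single_le_sum (f := fun j => |a j|) (fun j _ => abs_nonneg _) (Finset.mem_univ i)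
  calc _ ≤ |kernelConst α| * (M * rieszConst (1 + α) * ε ^ (2 : ℝ) + |a i| * ε ^ (2 : ℝ)) := by
        rw [h1]
        gcongr
    _ ≤ |kernelConst α| * (M * rieszConst (1 + α) * ε ^ (2 : ℝ) +
        (∑ j, |a j|) * ε ^ (2 : ℝ)) := by
        have := hpos 2
        gcongr
    _ = |kernelConst α| * (M * rieszConst (1 + α) + ∑ j, |a j|) * ε ^ (2 : ℝ) := by ring
    _ ≤ _ := mul_rpow_le_rpow hε hsmall (by ring)

end Parameters

/-- Choice of the length scales for small `ε` and times of order `|log ε|`. -/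
lemma exists_scales {α : ℝ} (hα₀ : 0 < α) (hα₁ : α < 1) {N : ℕ} (a : Fin N → ℝ) {M : ℝ}
    (hM : 0 < M) {d : ℝ} (hd : 0 < d) {β : ℝ} (hβ₀ : 0 < β)
    (hβ₁ : β < (2 - 2 * α) / (4 - α)) :
    ∃ ε₀ ζ : ℝ, ∃ k : ℕ, 0 < ε₀ ∧ ε₀ < 1 ∧ 0 < ζ ∧ 1 ≤ k ∧ ∀ ε, 0 < ε → ε < ε₀ →
      ε ^ β ≤ d / 4 ∧ ∀ b, 0 ≤ b → b ≤ ζ * |Real.log ε| → ∃ J R₀ R₁ r q w r' : ℝ,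
        Scales α d (M * ε ^ (-2 : ℤ)) ε b a J R₀ R₁ r q w ∧
        (∑ j, |a j|) * ε ^ 2 * Real.exp (4 * kernelLip α d * (∑ j, |a j|) * b) ≤ J ∧
        q ≤ R₀ ^ 2 ∧ 0 < r' ∧
        (∀ i, |kernelConst α| * (M * ε ^ (-2 : ℤ) * (rieszConst (1 + α) * r' ^ (1 - α)) +
          r' ^ (-(1 + α)) * (|a i| * (w / (3 * R₀ ^ 2)) ^ (k + 2) * Real.exp
          (2 * (k + 2) * (4 * (k + 1) + 2 + 2 * (kernelLip α d * ∑ j, |a j|)) * b))) ≤ R₀) ∧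
        5 * R₁ ≤ ε ^ β / 2 := by
  have h4α : 0 < 4 - α := by linarith
  set A := ∑ j, |a j| with hA
  have hA0 : 0 ≤ A := Finset.sum_nonneg fun j _ => abs_nonneg _
  have hL : 0 ≤ kernelLip α d := by
    unfold kernelLip
    positivity
  set γ := (2 - 2 * α) / (4 - α) with hγ
  have hγ4 : (4 - α) * γ = 2 - 2 * α := by
    rw [hγ]
    field_simp
  have hγ1 : γ < 1 / 2 := by
    rw [hγ, div_lt_iff₀ h4α]
    linarith
  -- The midpoint leaves room on both sides: `β' < γ` makes `δ` positive, and `β < β'` pays for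
  -- `ε^(-χ)` and the numerical factor `10` at the end.
  set β' := (β + γ) / 2 with hβ'
  have hββ' : β < β' := by linarith
  have hβ'γ : β' < γ := by linarith
  set δ := 2 - 2 * α - (4 - α) * β' with hδ
  have hδ0 : 0 < δ := by
    rw [hδ, ← hγ4]
    nlinarith
  have hδ2 : δ < 2 := by
    rw [hδ]
    nlinarith
  -- The first bound keeps `δ/2 - 3χ` and the other spare exponents positive, the second keeps `β' -
  -- χ - β` positive.
  set χ := min (δ / 12) ((β' - β) / 2) with hχ
  have hχ0 : 0 < χ := lt_min (by linarith) (by linarith)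
  have hχδ : χ ≤ δ / 12 := min_le_left _ _
  have hχβ : χ ≤ (β' - β) / 2 := min_le_right _ _
  set κ := 4 / (1 - α) with hκ
  have hκ4 : κ * (1 - α) = 4 := div_mul_cancel₀ _ (by linarith)
  obtain ⟨k, hk⟩ := exists_nat_ge ((κ * (1 + α) + 3) / (δ / 4) + 1)
  have hκ0 : 0 < κ := div_pos (by norm_num) (by linarith)
  have hk1 : 1 ≤ k := by
    have h1 : 0 ≤ (κ * (1 + α) + 3) / (δ / 4) := by positivity
    have h2 : (1 : ℝ) ≤ k := by linarith
    exact_mod_cast h2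
  have hkδ : κ * (1 + α) + 3 ≤ δ / 4 * (k + 2) := by
    have h1 : (κ * (1 + α) + 3) / (δ / 4) ≤ k + 2 := by linarith
    rw [div_le_iff₀ (by positivity)] at h1
    linarith
  set Ck := 2 * ((k : ℝ) + 2) * (4 * (k + 1) + 2 + 2 * (kernelLip α d * A)) with hCk
  have hCk0 : 0 ≤ Ck := by positivity
  -- This dominates the three exponential rates, those of the second moment, the control radius and
  -- the excess moment, so that one `ζ = χ / C` serves them all.
  set C := 4 * kernelLip α d * A + growthRate α d a + Ck with hC
  have hg : 1 ≤ growthRate α d a := by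
    unfold growthRate
    rw [← hA]
    have : 0 ≤ kernelLip α d * A := by positivity
    linarith
  have h4L : 0 ≤ 4 * kernelLip α d * A := by positivity
  have hC0 : 0 < C := by linarith
  have hCζ : C * (χ / C) ≤ χ := by
    rw [mul_div_cancel₀ _ hC0.ne']
  have hev : ∀ᶠ ε : ℝ in nhdsWithin 0 (Ioi 0),
      2 * ε ^ (1 - β') ≤ 1 ∧ (∀ i, A / |a i| * ε ^ (2 - χ - 2 * β') ≤ 1) ∧
      1 * ε ^ (2 - χ - 2 * β') ≤ 1 ∧ selfConst α M A * ε ^ (3 * δ / 4 - χ) ≤ 1 ∧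
      selfConst α M A * ε ^ (δ / 2 - 3 * χ) ≤ 1 ∧ selfConst α M A * ε ^ (δ - χ) ≤ 1 ∧
      |kernelConst α| * (M * rieszConst (1 + α) + A) * ε ^ (2 - β') ≤ 1 ∧
      10 * ε ^ (β' - χ - β) ≤ 1 ∧ 4 / d * ε ^ β ≤ 1 := by
    refine (eventually_mul_rpow_le_one _ (by linarith)).and
      ((Filter.eventually_all.2 fun i => eventually_mul_rpow_le_one _ (by linarith)).and
      ((eventually_mul_rpow_le_one _ (by linarith)).and
      ((eventually_mul_rpow_le_one _ (by linarith)).and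
      ((eventually_mul_rpow_le_one _ (by linarith)).and
      ((eventually_mul_rpow_le_one _ (by linarith)).and
      ((eventually_mul_rpow_le_one _ (by linarith)).and
      ((eventually_mul_rpow_le_one _ (by linarith)).and
      (eventually_mul_rpow_le_one _ hβ₀))))))))
  obtain ⟨ε₁, hε₁, hsub⟩ := mem_nhdsGT_iff_exists_Ioo_subset.1 hev
  have hε₁ : 0 < ε₁ := hε₁
  refine ⟨min ε₁ (1 / 2), χ / C, k, lt_min hε₁ (by norm_num),
    (min_le_right _ _).trans_lt (by norm_num), by positivity, hk1, fun ε hε hlt => ?_⟩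
  obtain ⟨s1, s2, s3, s4, s5, s6, s7, s8, s9⟩ := hsub ⟨hε, hlt.trans_le (min_le_left _ _)⟩
  have hε1 : ε < 1 := (hlt.trans_le (min_le_right _ _)).trans (by norm_num)
  refine ⟨?_, fun b hb hbζ => ?_⟩
  · rw [div_mul_eq_mul_div, div_le_one hd] at s9
    linarith
  have hexp : ∀ c, c ≤ C → Real.exp (c * b) ≤ ε ^ (-χ) := fun c hc =>
    exp_mul_le_rpow hε hε1 hb hbζ hc hC0.le hCζ
  refine ⟨_, _, _, _, _, _, ε ^ κ, scales_of_small hα₀ hα₁ hM hε hε1 (by linarith) hχ0 hδ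
    (hexp _ (by linarith)) s1 s2 s3 s4 s5, ?_, ?_, Real.rpow_pos_of_pos hε κ,
    far_le_of_small hα₁ hε hε1 (by linarith) hκ4 hkδ (hexp Ck (by linarith)) s7, ?_⟩
  · have h1 : ε ^ (2 - χ) = ε ^ 2 * ε ^ (-χ) := by
      rw [sub_eq_add_neg, Real.rpow_add hε]
      norm_num
    rw [h1, mul_assoc A]
    have := hexp (4 * kernelLip α d * A) (by linarith)
    gcongr
  · have h1 := mul_rpow_le_rpow (e := δ - χ + 2 * β') (e₂ := β' * 2) hε s6 (by ring)
    rw [Real.rpow_mul hε.le β'] at h1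
    exact_mod_cast h1
  · have h1 := mul_rpow_le_rpow (e := β' - χ) (e₂ := β) hε s8 (by ring)
    linarith

/-! ### Localization time and continuous induction. -/

lemma le_sSup_coe_of_forall {T : EReal} (hT : 0 < T) {s : Set ℝ}
    (hs : ∀ t : ℝ, 0 < t → (t : EReal) < T → t ∈ s) :
    T ≤ sSup ((fun t : ℝ => (t : EReal)) '' s) := by
  refine le_of_forall_lt fun c hc => ?_
  obtain ⟨t, h1, h2⟩ := EReal.lt_iff_exists_real_btwn.1 (max_lt hc hT)
  have ht : (0 : EReal) < t := (le_max_right _ _).trans_lt h1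
  exact ((le_max_left _ _).trans_lt h1).trans_le
    (le_sSup ⟨t, hs t (EReal.coe_pos.1 ht) h2, rfl⟩)

/-- If the blobs are localized slightly beyond the time `Z`, then either the localization time
exceeds `Z` or the blobs are localized during the whole life of the solution. -/
lemma localizationTime_eq_or_lt {N : ℕ} {T : EReal} (hT : 0 < T) {Λ : Fin N → Set Plane}
    {Φ : ℝ → Plane → Plane} {z : Fin N → ℝ → Plane} {ε β Z η : ℝ} (hZ : 0 ≤ Z) (hη : 0 < η)
    (h : ∀ t : ℝ, 0 ≤ t → t ≤ Z + η → (t : EReal) < T → ∀ i, ∀ y ∈ Λ i,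
      dist (Φ t y) (z i t) < ε ^ β) :
    localizationTime T Λ Φ z ε β = T ∨ (Z : EReal) < localizationTime T Λ Φ z ε β := by
  unfold localizationTime
  rcases isEmpty_or_nonempty (Fin N) with hN | ⟨⟨i₀⟩⟩
  · right
    rw [iInf_of_empty]
    exact EReal.coe_lt_top Z
  rcases le_or_gt T (Z : EReal) with hTZ | hTZ
  · left
    refine le_antisymm ((iInf_le _ i₀).trans (sSup_le ?_)) (le_iInf fun i => ?_)
    · rintro _ ⟨t, ht, rfl⟩
      exact ht.2.1.le
    · refine le_sSup_coe_of_forall hT fun t ht htT => ⟨ht, htT, fun s hs y hy => ?_⟩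
      have h1 : t < Z := EReal.coe_lt_coe_iff.1 (htT.trans_le hTZ)
      exact h s hs.1 (by linarith [hs.2]) ((EReal.coe_le_coe_iff.2 hs.2).trans_lt htT) i y hy
  · right
    obtain ⟨c, h1, h2⟩ := EReal.lt_iff_exists_real_btwn.1 hTZ
    have h1 : Z < c := EReal.coe_lt_coe_iff.1 h1
    -- The margin `η`, cut down to the lifetime, turns localization up to `Z` into the strict
    -- inequality.
    have h3 : Z < min c (Z + η) := lt_min h1 (by linarith)
    refine (EReal.coe_lt_coe_iff.2 h3).trans_le (le_iInf fun i => le_sSup ⟨_, ⟨?_, ?_, ?_⟩, rfl⟩)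
    · linarith
    · exact (EReal.coe_le_coe_iff.2 (min_le_left _ _)).trans_lt h2
    · intro s hs y hy
      exact h s hs.1 (hs.2.trans (min_le_right _ _))
        ((EReal.coe_le_coe_iff.2 (hs.2.trans (min_le_left _ _))).trans_lt h2) i y hy

/-- Continuous induction with a uniform speed bound. -/
lemma dist_lt_of_bootstrap {N : ℕ} {T : EReal} {Λ : Fin N → Set Plane} {Φ : ℝ → Plane → Plane}
    {z : Fin N → ℝ → Plane} {ρ Z W : ℝ} (hρ : 0 < ρ) (hZ : 0 ≤ Z) (hW : 0 < W)
    (hspeed : ∀ i, ∀ y ∈ Λ i, ∀ s t : ℝ, 0 ≤ s → s ≤ t → (t : EReal) < T →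
      dist (Φ t y) (z i t) ≤ dist (Φ s y) (z i s) + W * (t - s))
    (hinit : ∀ i, ∀ y ∈ Λ i, dist (Φ 0 y) (z i 0) ≤ ρ)
    (hkey : ∀ b : ℝ, 0 ≤ b → b ≤ Z → (b : EReal) < T →
      (∀ i, ∀ y ∈ Λ i, ∀ t ∈ Icc 0 b, dist (Φ t y) (z i t) ≤ ρ) →
      ∀ i, ∀ y ∈ Λ i, dist (Φ b y) (z i b) ≤ ρ / 2) :
    ∀ t : ℝ, 0 ≤ t → t ≤ Z + ρ / (4 * W) → (t : EReal) < T → ∀ i, ∀ y ∈ Λ i,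
      dist (Φ t y) (z i t) < ρ := by
  set η := ρ / (4 * W) with hη
  have hη0 : 0 < η := by positivity
  have hWη : W * η = ρ / 4 := by
    rw [hη]
    field_simp
  -- During a step of length `η` the distance grows by at most `ρ/4`, hence from `ρ/2` to `3ρ/4 <
  -- ρ`. So `hkey` applies on the longer interval and restores `ρ/2`, simultaneously for all
  -- particles.
  have hind : ∀ n : ℕ, ∀ t : ℝ, 0 ≤ t → t ≤ Z → t ≤ n * η → (t : EReal) < T →
      ∀ i, ∀ y ∈ Λ i, dist (Φ t y) (z i t) ≤ ρ / 2 := by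
    intro n
    induction n with
    | zero =>
      intro t ht0 htZ ht htT
      have ht : t = 0 := le_antisymm (by simpa using ht) ht0
      subst ht
      refine hkey 0 le_rfl htZ htT fun i y hy t ht => ?_
      have : t = 0 := le_antisymm ht.2 ht.1
      subst this
      exact hinit i y hy
    | succ n ih =>
      intro t ht0 htZ ht htT
      refine hkey t ht0 htZ htT fun i y hy s hs => ?_
      have hsT : (s : EReal) < T := (EReal.coe_le_coe_iff.2 hs.2).trans_lt htT
      push_cast at ht
      rcases le_total s (n * η) with hsn | hsn
      · have := ih s hs.1 (hs.2.trans htZ) hsn hsT i y hy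
        linarith
      · have h0 : 0 ≤ n * η := by positivity
        have h1 := ih (n * η) h0 (hsn.trans (hs.2.trans htZ)) le_rfl
          ((EReal.coe_le_coe_iff.2 hsn).trans_lt hsT) i y hy
        have h2 := hspeed i y hy (n * η) s h0 hsn hsT
        have h3 : W * (s - n * η) ≤ W * η := by
          refine mul_le_mul_of_nonneg_left ?_ hW.le
          linarith [hs.2]
        linarith
  have hall : ∀ t : ℝ, 0 ≤ t → t ≤ Z → (t : EReal) < T →
      ∀ i, ∀ y ∈ Λ i, dist (Φ t y) (z i t) ≤ ρ / 2 := by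
    intro t ht0 htZ htT
    obtain ⟨n, hn⟩ := exists_nat_ge (t / η)
    exact hind n t ht0 htZ ((div_le_iff₀ hη0).1 hn) htT
  intro t ht0 ht htT i y hy
  rcases le_total t Z with htZ | htZ
  · have := hall t ht0 htZ htT i y hy
    linarith
  · have h1 := hall Z hZ le_rfl ((EReal.coe_le_coe_iff.2 htZ).trans_lt htT) i y hy
    have h2 := hspeed i y hy Z t hZ htZ htT
    have h3 : W * (t - Z) ≤ W * η := mul_le_mul_of_nonneg_left (by linarith) hW.le
    linarith

/-- The bound may depend on `ε`, which is harmless: it only has to make the induction step positive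
and uniform over particles and times. -/
lemma exists_speed_bound {α : ℝ} (hα₀ : 0 < α) (hα₁ : α < 1) {N : ℕ} {a : Fin N → ℝ}
    {z₀ : Fin N → Plane} {z : Fin N → ℝ → Plane} {M ε d : ℝ} {θ₀ : Fin N → Plane → ℝ}
    {T : EReal} {θ : ℝ → Plane → ℝ} {Φ : ℝ → Plane → Plane} (hM : 0 < M)
    (hd : 0 < d) (hz : IsPseudoVortexSolution α a z₀ z)
    (hsep : ∀ t : ℝ, 0 ≤ t → ∀ i j, i ≠ j → d ≤ dist (z i t) (z j t))
    (h : IsConcentratedDatum a z₀ M ε θ₀) (h0 : ∀ x, θ 0 x = ∑ i, θ₀ i x)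
    (hw : IsWeakSolution α T θ) (hp : IsParticleFlow α T θ Φ) :
    ∃ W : ℝ, 0 < W ∧ ∀ i y, ∀ s t : ℝ, 0 ≤ s → s ≤ t → (t : EReal) < T →
      dist (Φ t y) (z i t) ≤ dist (Φ s y) (z i s) + W * (t - s) := by
  have hfin := fun j => isFiniteMeasure_blobMeasure (h.integrable j)
  set V := ∑ j, |kernelConst α| * (M * ε ^ (-2 : ℤ) * (rieszConst (1 + α) * 1 ^ (1 - α)) +
    1 ^ (-(1 + α)) * (blobMeasure (θ₀ j)).real univ) with hV
  set V' := ∑ j, |a j| * (|kernelConst α| * d ^ (-(1 + α))) with hV'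
  have hrc := rieszConst_nonneg (γ := 1 + α) (by linarith)
  have hε2 : 0 ≤ ε ^ (-2 : ℤ) := Even.zpow_nonneg (by decide) ε
  have hV0 : 0 ≤ V := Finset.sum_nonneg fun j _ => by positivity
  have hV'0 : 0 ≤ V' := Finset.sum_nonneg fun j _ => by positivity
  have hvel : ∀ t : ℝ, 0 ≤ t → (t : EReal) < T → ∀ x, ‖velocity α (θ t) x‖ ≤ V := by
    intro t ht0 htT x
    have hΦ := hp.measurePreserving t ht0 htT
    rw [velocity_eq_sum hα₀ hα₁ h (hw.integrable t ht0 htT) hΦ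
      (by simpa only [h0] using hp.transport t ht0 htT)]
    refine norm_sum_le_of_le _ fun j _ => ?_
    have hden : (blobMeasure (θ₀ j)).map (Φ t) ≤
        ENNReal.ofReal (M * ε ^ (-2 : ℤ)) • volume := by
      refine (Measure.map_mono (blobMeasure_le (h.abs_le j)) hΦ.measurable).trans_eq ?_
      rw [Measure.map_smul, hΦ.map_eq]
    have hmass : ((blobMeasure (θ₀ j)).map (Φ t)).real univ = (blobMeasure (θ₀ j)).real univ := by
      rw [measureReal_def, Measure.map_apply hΦ.measurable MeasurableSet.univ, preimage_univ,
        measureReal_def]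
    rw [norm_smul, Real.norm_eq_abs, abs_blobSign, one_mul, ← hmass]
    exact norm_measureVelocity_le hα₀ hα₁ (by positivity) hden one_pos x
  have hvort : ∀ i, ∀ t : ℝ, 0 ≤ t →
      ‖∑ j ∈ Finset.univ.erase i, a j • kernel α (z i t - z j t)‖ ≤ V' := by
    intro i t ht
    refine (norm_sum_le_of_le _ (f := fun j => a j • kernel α (z i t - z j t))
      (n := fun j => |a j| * (|kernelConst α| * d ^ (-(1 + α)))) fun j hj => ?_).trans
      (Finset.sum_le_sum_of_subset_of_nonneg (Finset.erase_subset _ _) fun j _ _ => by positivity)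
    have h1 := hsep t ht i j (Finset.ne_of_mem_erase hj).symm
    rw [dist_eq_norm] at h1
    rw [norm_smul, Real.norm_eq_abs, norm_kernel hα₀]
    have := Real.rpow_le_rpow_of_nonpos hd h1 (show -(1 + α) ≤ 0 by linarith)
    gcongr
  refine ⟨V + V' + 1, by positivity, fun i y s t hs hst htT => ?_⟩
  have hlt : ∀ u ∈ Icc s t, (u : EReal) < T := fun u hu =>
    (EReal.coe_le_coe_iff.2 hu.2).trans_lt htT
  have hsub : Icc s t ⊆ Ici 0 := fun u hu => hs.trans hu.1
  have h1 := Convex.norm_image_sub_le_of_norm_hasDerivWithin_le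
    (f := fun u => Φ u y - z i u) (C := V + V') (s := Icc s t)
    (fun u hu => ((hp.trajectory y u (hsub hu) (hlt u hu)).mono hsub).fun_sub
      ((hz.motion i u (hsub hu)).mono hsub))
    (fun u hu => (norm_sub_le _ _).trans (add_le_add (hvel u (hsub hu) (hlt u hu) _)
      (hvort i u (hsub hu)))) (convex_Icc s t) (left_mem_Icc.2 hst) (right_mem_Icc.2 hst)
  rw [Real.norm_of_nonneg (sub_nonneg.2 hst)] at h1
  rw [dist_eq_norm, dist_eq_norm]
  have h2 := norm_sub_norm_le (Φ t y - z i t) (Φ s y - z i s)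
  nlinarith

end MSQG

end

/-! ### Assembly of the bootstrap. -/

theorem theorem1 (α : ℝ) (hα₀ : 0 < α) (hα₁ : α < 1) (N : ℕ)
    (a : Fin N → ℝ) (z₀ : Fin N → MSQG.Plane) (M : ℝ) (hM : 0 < M)
    (z : Fin N → ℝ → MSQG.Plane)
    (hz : MSQG.IsPseudoVortexSolution α a z₀ z) (hsep : MSQG.NoCollapse z)
    (β : ℝ) (hβ₀ : 0 < β) (hβ₁ : β < (2 - 2 * α) / (4 - α)) :
    ∃ ε₀ ζ₀ : ℝ, 0 < ε₀ ∧ ε₀ < 1 ∧ 0 < ζ₀ ∧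
      ∀ ε : ℝ, 0 < ε → ε < ε₀ →
      ∀ θ₀ : Fin N → MSQG.Plane → ℝ, MSQG.IsConcentratedDatum a z₀ M ε θ₀ →
      ∀ (T : EReal) (θ : ℝ → MSQG.Plane → ℝ) (Φ : ℝ → MSQG.Plane → MSQG.Plane), 0 < T →
        (∀ x, θ 0 x = ∑ i, θ₀ i x) →
        MSQG.IsWeakSolution α T θ → MSQG.IsParticleFlow α T θ Φ →
        -- for a global solution (`T = ∞`) the first alternative is contained in the second one
        (MSQG.localizationTime T (fun i => tsupport (θ₀ i)) Φ z ε β = T ∨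
          ((ζ₀ * |Real.log ε| : ℝ) : EReal) <
            MSQG.localizationTime T (fun i => tsupport (θ₀ i)) Φ z ε β) := by
  obtain ⟨d, hd, hsep⟩ := hsep
  obtain ⟨ε₀, ζ, k, hε₀, hε₀1, hζ, hk, hmain⟩ :=
    MSQG.exists_scales hα₀ hα₁ a hM hd hβ₀ hβ₁
  refine ⟨ε₀, ζ, hε₀, hε₀1, hζ, fun ε hε hlt θ₀ hdat T θ Φ hT h0 hw hp => ?_⟩
  obtain ⟨hρd, hscale⟩ := hmain ε hε hlt
  have hε1 : ε < 1 := hlt.trans hε₀1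
  have hρ : 0 < ε ^ β := Real.rpow_pos_of_pos hε β
  have hZ : 0 ≤ ζ * |Real.log ε| := by positivity
  obtain ⟨W, hW, hspeed⟩ := MSQG.exists_speed_bound hα₀ hα₁ hM hd hz hsep hdat h0 hw hp
  -- This gives `ε ≤ ε^β`, so the initial disks lie inside the bootstrap disks.
  have hβ1 : β ≤ 1 := by
    refine hβ₁.le.trans ?_
    rw [div_le_one (by linarith)]
    linarith
  refine MSQG.localizationTime_eq_or_lt hT hZ (η := ε ^ β / (4 * W)) (by positivity)
    (MSQG.dist_lt_of_bootstrap hρ hZ hW (fun i y _ => hspeed i y) (fun i y hy => ?_)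
      fun b hb hbZ hbT hclose i y hy => ?_)
  · rw [hp.initial, hz.initial]
    refine (Metric.mem_ball.1 (hdat.support i hy)).le.trans ?_
    simpa using Real.rpow_le_rpow_of_exponent_ge hε hε1.le hβ1
  · have hsys := MSQG.blobSystem_of_solution hα₀ hα₁ hM hε hd hz hsep hdat h0 hw hp hbT
      fun i y hy t ht => (hclose i y hy t ht).trans hρd
    obtain ⟨J, R₀, R₁, r, q, w, r', hs, hJ, hq, hr', hfar, hR₁⟩ := hscale b hb hbZ
    refine (hsys.dist_le hs (fun t ht => (hsys.totalMoment_le ht).trans (le_trans ?_ hJ)) hk hq hr'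
      hfar hy ⟨hb, le_rfl⟩).trans hR₁
    have hL := hsys.kernelLip_nonneg
    have hA : 0 ≤ ∑ j, |a j| := Finset.sum_nonneg fun j _ => abs_nonneg _
    have := ht.2
    gcongr
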